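/- **Setting.** Let $M=(\mathcal S,\mathcal A,r,p)$ be a Markov decision process with finite state space, $S=|\mathcal S|\ge 2$, finite non-empty action space, $A=|\mathcal A|$, mean rewards $r(s,a)\in[0,1]$ and transition probabilities $p(\cdot\mid s,a)$. Let $D=\max_{s\ne s'}\min_{\pi:\mathcal S\to\mathcal A}\mathbb E[T(s'\mid s,\pi,M)]$ be its diameter, where $T(s'\mid s,\pi,M)$ is the number of steps in which $M$, started at $s$ and controlled by $\pi$, first reaches $s'$; assume $D<\infty$. Let $\rho^*(M)$ be the maximal long-run average expected reward over all (history-dependent, randomized) policies and initial states. At each time $t=1,2,\dots$ the learner observes $s_t$ and chooses $a_t$. Every pair $(s,a)$ generates at time $t$ a random sequence $\boldsymbol r_t(s,a)=(r_{t,\tau}(s,a))_{\tau\ge0}$ of non-negative numbers; the component $r_{t,\tau}(s_t,a_t)$ is realized at time $t+\tau$. The sequences generated at time $t$ are independent of the past and of $s_t,a_t$, and given all these $s_{t+1}$ has law $p(\cdot\mid s_t,a_t)$. At time $t$ the learner observes only the vector $x_t(s)=\sum_{0<\tau\le t}r_{\tau,t-\tau}(s,a_\tau)\mathbf 1(s_\tau=s)$,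 $s\in\mathcal S$. *Assumption 1.* For every $(s,a)$, the law of the sequence $\boldsymbol r_t(s,a)$ does not depend on $t$; $\|\boldsymbol r_t(s,a)\|_1\in[0,1]$ almost surely; $\mathbb E\|\boldsymbol r_t(s,a)\|_1=r(s,a)$; and the sequences $\boldsymbol r_t(s,a)$, for all $t\ge 1$, $s$ and $a$, are mutually independent. *Assumption 2.* $d>0$ is a number such that, for every $t\ge1$, $\sum_{\tau_1\ge0}\max_{(s,a)}\sum_{\tau\ge\tau_1}r_{t,\tau}(s,a)\le d$ almost surely. **Algorithm DUCRL2** (input $\delta\in(0,1)$, $d$, $\mathcal S$, $\mathcal A$). It proceeds in epochs $k=1,2,\dots$; epoch $k$ starts at time $t_k$, with $t_1=1$. At time $t_k$ let $N_k(s,a)$ be the number of times $\tau<t_k$ with $(s_\tau,a_\tau)=(s,a)$, let $\mathcal E_j(s,a)\in\{0,1\}$ indicate whether $(s,a)$ occurs in epoch $j$, i.e. at a time $\tau$ with $t_j\le\tau<t_{j+1}$, and put $N_k^+=\max\{1,N_k\}$, $E_k=\sum_{0<j<k}\mathcal E_j$, $$\hat r_k(s,a)=\frac{\sum_{0<j<k}\mathcal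 E_j(s,a)\sum_{t_j\le\tau<t_{j+1}}x_\tau(s)}{N_k^+(s,a)},\qquad \hat p_k(s'\mid s,a)=\frac{\#\{0<\tau<t_k:(s_\tau,a_\tau,s_{\tau+1})=(s,a,s')\}}{N_k^+(s,a)},$$ $$\tilde r_k(s,a)=\hat r_k(s,a)+\sqrt{\frac{7\log(2SAt_k/\delta)}{2N_k^+(s,a)}}+d\,\frac{E_k(s,a)}{N_k^+(s,a)},$$ and let $\mathcal P_k(s,a)$ be the set of probability vectors $q$ on $\mathcal S$ with $\|q-\hat p_k(\cdot\mid s,a)\|_1\le\sqrt{14S\log(2At_k/\delta)/N_k^+(s,a)}$. Extended value iteration computes $u_0=0$ and $u_{i+1}(s)=\max_a\{\tilde r_k(s,a)+\max_{q\in\mathcal P_k(s,a)}\sum_{s'}q(s')u_i(s')\}$ and stops at the first $i$ with $\max_s(u_{i+1}(s)-u_i(s))-\min_s(u_{i+1}(s)-u_i(s))<1/\sqrt{t_k}$; then $\tilde\pi_k(s)$ is an action that attains the maximum over $a$ for this $u_i$, ties being broken by an arbitrary fixed rule. From time $t_k$ on, the learner plays $a_t=\tilde\pi_k(s_t)$ as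 long as the number of occurrences of $(s_t,\tilde\pi_k(s_t))$ in epoch $k$ before time $t$ is less than $N_k^+(s_t,\tilde\pi_k(s_t))$; at the first $t$ at which this fails, epoch $k+1$ starts with $t_{k+1}=t$. **Theorem.** Let $\mathrm{Reg}(T)=T\rho^*(M)-\sum_{t=1}^T\|\boldsymbol r_t(s_t,a_t)\|_1$ be the regret of DUCRL2 over $T$ steps. For every $\delta\in(0,1)$ and every initial state, with probability at least $1-\delta$ the following holds simultaneously for all integers $T>1$: $$\mathrm{Reg}(T)\le 34DS\sqrt{AT\log(T/\delta)}+2d(SA)^3\left[\log_2\frac{8T}{SA}\right]^2 .$$ Moreover, for every integer $T>1$, if DUCRL2 is run with $\delta=1/T$, then $\mathrm{Reg}(T)$ is integrable and $$\mathbb E[\mathrm{Reg}(T)]\le 68DS\sqrt{AT\log T}+2d(SA)^3\left[\log_2\frac{8T}{SA}\right]^2 .$$ -/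

import Mathlib

open scoped ENNReal NNReal
open MeasureTheory ProbabilityTheory Filter Finset

noncomputable section

namespace DelayedMDP

/-- A Markov decision process with mean reward function `r` and transition function `p`. -/
structure MDP (S A : Type*) [Fintype S] where
  r : S → A → ℝ
  p : S → A → S → ℝ
  r_mem : ∀ s a, r s a ∈ Set.Icc (0 : ℝ) 1
  p_mem : ∀ s a, p s a ∈ stdSimplex ℝ S

/-- A (possibly randomized) protocol that chooses an action from the list of the past
state-action pairs (oldest first) and from the current state. -/
structure Protocol (S A : Type*) [Fintype A] where
  prob : List (S × A) → S → A → ℝ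
  prob_mem : ∀ h s, prob h s ∈ stdSimplex ℝ A

section Model

variable {S A : Type*} [Fintype S] [DecidableEq S] [Fintype A] [DecidableEq A]

/-! ### Diameter -/

/-- The probability that the Markov chain which starts at `s` and follows the stationary
deterministic policy `π` needs more than `n` steps to reach `goal`. -/
def MDP.notReached (M : MDP S A) (π : S → A) (goal : S) : ℕ → S → ℝ
  | 0, s => if s = goal then 0 else 1
  | n + 1, s => if s = goal then 0 else ∑ y, M.p s (π s) y * M.notReached π goal n y

/-- The expected number of steps from `s` to `goal` under `π`, i.e. `∑ₙ Pr(time > n)`. -/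
def MDP.expectedTime (M : MDP S A) (π : S → A) (s goal : S) : ℝ≥0∞ :=
  ∑' n, ENNReal.ofReal (M.notReached π goal n s)

/-- The diameter: maximum over `s ≠ s'`, minimum over stationary deterministic policies,
of the expected time to reach `s'` from `s`. -/
def MDP.diameter (M : MDP S A) : ℝ≥0∞ :=
  ⨆ (s : S) (s' : S) (_ : s ≠ s'), ⨅ π : S → A, M.expectedTime π s s'

/-! ### Optimal average reward -/

/-- Expected total reward of the next `n` steps under the protocol `σ`, after the past `h`,
in the current state `s`. -/
def MDP.value (M : MDP S A) (σ : Protocol S A) : ℕ → List (S × A) → S → ℝ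
  | 0, _, _ => 0
  | n + 1, h, s =>
      ∑ a, σ.prob h s a * (M.r s a + ∑ y, M.p s a y * M.value σ n (h ++ [(s, a)]) y)

/-- The average reward of `σ` from `s`. The upper limit is used because the limit need not exist
for an arbitrary protocol; for stationary policies it is a limit. -/
def MDP.avgReward (M : MDP S A) (σ : Protocol S A) (s : S) : ℝ :=
  limsup (fun n : ℕ => M.value σ n [] s / n) atTop

/-- The optimal average reward `ρ*`. (With a finite diameter it is attained, from every state,
by a stationary deterministic policy.) -/
def MDP.optGain (M : MDP S A) : ℝ :=
  ⨆ q : Protocol S A × S, M.avgReward q.1 q.2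

/-! ### Extended value iteration -/

/-- Probability vectors at `ℓ¹` distance at most `β` from `phat`. -/
def transBall (phat : S → ℝ) (β : ℝ) : Set (S → ℝ) :=
  {q | q ∈ stdSimplex ℝ S ∧ ∑ y, |q y - phat y| ≤ β}

/-- `R(s,a) + max_{q ∈ P(s,a)} ∑_y q(y) u(y)`. -/
def eviQ (R : S → A → ℝ) (P : S → A → Set (S → ℝ)) (u : S → ℝ) (s : S) (a : A) : ℝ :=
  R s a + sSup ((fun q : S → ℝ => ∑ y, q y * u y) '' P s a)

/-- The utility vectors `u₀ = 0`, `u_{i+1}(s) = max_a eviQ u_i s a`. -/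
def eviU (R : S → A → ℝ) (P : S → A → Set (S → ℝ)) : ℕ → S → ℝ
  | 0 => fun _ => 0
  | i + 1 => fun s => ⨆ a, eviQ R P (eviU R P i) s a

/-- `max_s (u_{i+1}(s) - u_i(s)) - min_s (u_{i+1}(s) - u_i(s))`. -/
def eviError (R : S → A → ℝ) (P : S → A → Set (S → ℝ)) (i : ℕ) : ℝ :=
  (⨆ s, (eviU R P (i + 1) s - eviU R P i s)) - ⨅ s, (eviU R P (i + 1) s - eviU R P i s)

/-- The index at which the iteration stops: the first `i` with error less than `ε`. -/
def eviStop (R : S → A → ℝ) (P : S → A → Set (S → ℝ)) (ε : ℝ) : ℕ :=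
  sInf {i | eviError R P i < ε}

/-- The greedy policy of the terminal utility vector; `tie s F` is the maximizer that is used in
the state `s` when `F` is the set of all maximizing actions. -/
def eviPolicy (tie : S → Finset A → A) (R : S → A → ℝ) (P : S → A → Set (S → ℝ)) (ε : ℝ) :
    S → A := fun s =>
  tie s {a | ∀ b, eviQ R P (eviU R P (eviStop R P ε)) s b ≤
    eviQ R P (eviU R P (eviStop R P ε)) s a}

/-! ### The algorithm DUCRL2

`st`, `act`, `x` are the sequences of states, actions and observed reward vectors, indexed by the
times `1, 2, …`; `tk k` is the first time of the epoch `k ∈ {1, 2, …}`. The quantities attached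
to the start of epoch `k` only look at times before `tk k` (and at the state at time `tk k`). -/

/-- Number of times `τ` with `t₀ ≤ τ < t` at which the pair `(s, a)` occurs. -/
def visits (st : ℕ → S) (act : ℕ → A) (t₀ t : ℕ) (s : S) (a : A) : ℕ :=
  #{τ ∈ Ico t₀ t | st τ = s ∧ act τ = a}

/-- `N_k(s,a)`: occurrences before the start of epoch `k`. -/
def countN (st : ℕ → S) (act : ℕ → A) (tk : ℕ → ℕ) (k : ℕ) (s : S) (a : A) : ℕ :=
  visits st act 1 (tk k) s a

/-- `E_k(s,a)`: number of epochs before `k` in which `(s,a)` occurs. -/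
def countE (st : ℕ → S) (act : ℕ → A) (tk : ℕ → ℕ) (k : ℕ) (s : S) (a : A) : ℕ :=
  #{j ∈ Ico 1 k | 0 < visits st act (tk j) (tk (j + 1)) s a}

/-- The reward estimate: the observations at `s` in all epochs before `k` in which `(s,a)` occurs,
divided by `max{1, N_k(s,a)}`. -/
def rhat (st : ℕ → S) (act : ℕ → A) (x : ℕ → S → ℝ) (tk : ℕ → ℕ) (k : ℕ) (s : S) (a : A) : ℝ :=
  (∑ j ∈ Ico 1 k with 0 < visits st act (tk j) (tk (j + 1)) s a,
    ∑ τ ∈ Ico (tk j) (tk (j + 1)), x τ s) / max 1 (countN st act tk k s a : ℝ)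

/-- The empirical transition probabilities. -/
def phat (st : ℕ → S) (act : ℕ → A) (tk : ℕ → ℕ) (k : ℕ) (s : S) (a : A) (s' : S) : ℝ :=
  (#{τ ∈ Ico 1 (tk k) | st τ = s ∧ act τ = a ∧ st (τ + 1) = s'} : ℝ) /
    max 1 (countN st act tk k s a : ℝ)

/-- Confidence radius of the reward estimate. -/
def rewardRadius (δ d : ℝ) (st : ℕ → S) (act : ℕ → A) (tk : ℕ → ℕ) (k : ℕ) (s : S) (a : A) : ℝ :=
  √(7 * Real.log (2 * Fintype.card S * Fintype.card A * tk k / δ) /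
      (2 * max 1 (countN st act tk k s a : ℝ))) +
    d * (countE st act tk k s a / max 1 (countN st act tk k s a : ℝ))

/-- Confidence radius of the transition estimate. -/
def transRadius (δ : ℝ) (st : ℕ → S) (act : ℕ → A) (tk : ℕ → ℕ) (k : ℕ) (s : S) (a : A) : ℝ :=
  √(14 * Fintype.card S * Real.log (2 * Fintype.card A * tk k / δ) /
      max 1 (countN st act tk k s a : ℝ))

/-- The policy of epoch `k`: extended value iteration with accuracy `1/√t_k`. -/
def epochPolicy (δ d : ℝ) (tie : S → Finset A → A) (st : ℕ → S) (act : ℕ → A) (x : ℕ → S → ℝ)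
    (tk : ℕ → ℕ) (k : ℕ) : S → A :=
  eviPolicy tie
    (fun s a => rhat st act x tk k s a + rewardRadius δ d st act tk k s a)
    (fun s a => transBall (phat st act tk k s a) (transRadius δ st act tk k s a))
    (1 / √(tk k : ℝ))

/-- The loop condition of epoch `k` at time `t`: the pair that the policy of the epoch selects
now has occurred in the epoch less often than `max{1, N_k}`. -/
def epochContinues (δ d : ℝ) (tie : S → Finset A → A) (st : ℕ → S) (act : ℕ → A)
    (x : ℕ → S → ℝ) (tk : ℕ → ℕ) (k t : ℕ) : Prop :=
  let a := epochPolicy δ d tie st act x tk k (st t)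
  visits st act (tk k) t (st t) a < max 1 (countN st act tk k (st t) a)

/-- The actions are those of DUCRL2 (confidence `δ`, delay parameter `d`) with epochs that start
at `tk 1 < tk 2 < …`. -/
structure IsDUCRL2Run (δ d : ℝ) (tie : S → Finset A → A) (st : ℕ → S) (act : ℕ → A)
    (x : ℕ → S → ℝ) (tk : ℕ → ℕ) : Prop where
  first : tk 1 = 1
  lt_next : ∀ k, 1 ≤ k → tk k < tk (k + 1)
  act_eq : ∀ k, 1 ≤ k → ∀ t, tk k ≤ t → t < tk (k + 1) →
    act t = epochPolicy δ d tie st act x tk k (st t)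
  continues : ∀ k, 1 ≤ k → ∀ t, tk k ≤ t → t < tk (k + 1) →
    epochContinues δ d tie st act x tk k t
  stops : ∀ k, 1 ≤ k → ¬ epochContinues δ d tie st act x tk k (tk (k + 1))

/-! ### Interaction with delayed, composite, partially anonymous rewards

`r t s a ω τ` is the component, realized at time `t + τ`, of the reward sequence that the pair
`(s, a)` generates at time `t ≥ 1`. -/

/-- The `ℓ¹` norm of a reward sequence. -/
def norm1 (v : ℕ → ℝ≥0) : ℝ≥0∞ := ∑' τ, (v τ : ℝ≥0∞)

variable {Ω : Type*}

/-- The observed vector: the sum of all components realized at time `t` that were generated by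
earlier (or present) visits to `s`. -/
def observed (r : ℕ → S → A → Ω → ℕ → ℝ≥0) (st : ℕ → Ω → S) (act : ℕ → Ω → A) (ω : Ω)
    (t : ℕ) (s : S) : ℝ :=
  ∑ τ ∈ Icc 1 t, if st τ ω = s then (r τ s (act τ ω) ω (t - τ) : ℝ) else 0

/-- The regret over `T` steps. -/
def regret (M : MDP S A) (r : ℕ → S → A → Ω → ℕ → ℝ≥0) (st : ℕ → Ω → S) (act : ℕ → Ω → A)
    (T : ℕ) (ω : Ω) : ℝ :=
  T * M.optGain - ∑ t ∈ Icc 1 T, (norm1 (r t (st t ω) (act t ω) ω)).toReal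

variable [MeasurableSpace Ω]

/-- The assumption on the generated rewards. The reward sequences of a pair have the same law at
all times; their sums lie in `[0,1]`, with mean `M.r s a`; all of them are independent. -/
structure RewardAssumption (M : MDP S A) (μ : Measure Ω) (r : ℕ → S → A → Ω → ℕ → ℝ≥0) :
    Prop where
  meas : ∀ t s a, Measurable (r t s a)
  ident : ∀ t, 1 ≤ t → ∀ s a, IdentDistrib (r t s a) (r 1 s a) μ μ
  norm_le : ∀ t, 1 ≤ t → ∀ s a, ∀ᵐ ω ∂μ, norm1 (r t s a ω) ≤ 1
  mean : ∀ t, 1 ≤ t → ∀ s a, ∫⁻ ω, norm1 (r t s a ω) ∂μ = ENNReal.ofReal (M.r s a)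
  indep : iIndepFun (fun (q : ℕ × S × A) => r (q.1 + 1) q.2.1 q.2.2) μ

/-- The assumption on the spill-over parameter `d`. -/
def SpilloverAssumption (μ : Measure Ω) (r : ℕ → S → A → Ω → ℕ → ℝ≥0) (d : ℝ) : Prop :=
  ∀ t, 1 ≤ t → ∀ᵐ ω ∂μ,
    ∑' τ₁ : ℕ, ⨆ (s : S) (a : A), ∑' i : ℕ, (r t s a ω (τ₁ + i) : ℝ≥0∞) ≤ ENNReal.ofReal d

/-- The information in all the reward sequences generated at time `t`. -/
abbrev rewardSigma (r : ℕ → S → A → Ω → ℕ → ℝ≥0) (t : ℕ) : MeasurableSpace Ω :=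
  ⨆ (s : S) (a : A), MeasurableSpace.comap (r t s a) inferInstance

/-- The past at time `t`: states and actions up to time `t`, reward sequences before time `t`. -/
abbrev pastSigma (r : ℕ → S → A → Ω → ℕ → ℝ≥0) (st : ℕ → Ω → S) (act : ℕ → Ω → A) (t : ℕ) :
    MeasurableSpace Ω :=
  (⨆ τ ∈ Icc 1 t, (MeasurableSpace.comap (st τ) ⊤ ⊔ MeasurableSpace.comap (act τ) ⊤)) ⊔
    ⨆ τ ∈ Ico 1 t, rewardSigma r τ

/-- The processes `st`, `act`, `r` describe an interaction with the environment from the initial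
state `s₁`: the rewards generated at time `t` are independent of the past and of the present state
and action, and, given all these, the next state is drawn from `M.p (st t) (act t)`. -/
structure IsInteraction (M : MDP S A) (s₁ : S) (μ : Measure Ω) (r : ℕ → S → A → Ω → ℕ → ℝ≥0)
    (st : ℕ → Ω → S) (act : ℕ → Ω → A) : Prop where
  meas_st : ∀ t s, MeasurableSet {ω | st t ω = s}
  meas_act : ∀ t a, MeasurableSet {ω | act t ω = a}
  init : ∀ᵐ ω ∂μ, st 1 ω = s₁
  fresh : ∀ t, 1 ≤ t → Indep (rewardSigma r t) (pastSigma r st act t) μ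
  trans : ∀ t, 1 ≤ t → ∀ s',
    μ[Set.indicator {ω | st (t + 1) ω = s'} (fun _ => (1 : ℝ)) |
        pastSigma r st act t ⊔ rewardSigma r t]
      =ᵐ[μ] fun ω => M.p (st t ω) (act t ω) s'

end Model

end DelayedMDP

end

/-!
The regret splits into per-step regrets with respect to the mean rewards, plus two martingale noises.

*Optimism.* If the confidence sets of an epoch contain the true rewards (in the sense of an upper
bound) and the true transition probabilities, then the terminal utility vector of extended value
iteration bounds the optimal gain from above, and its span is at most `D` times the largest
increment of the last iteration, because the true transition probabilities make it a supersolution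
of the hitting-time equations (`MDP.sub_le_mul_diameter`). The optimistic rewards are not truncated
at `1`, so the utility vector is divided by that increment whenever it exceeds `1` (`eviBias`); the
normalized vector takes values in `[0, D]`. The resulting step inequality is `optGain_sub_le`. That
extended value iteration halts follows by compactness (`exists_eviError_lt`): in an `ℓ¹` ball, mass
can always be moved to any given state, so the limiting increments are constant.

*Delays.* In the reward estimate of `(s, a)`, all components of the rewards of `(s, a)` that are
realized in the epoch in which they were generated are counted, and apart from the rewards of
`(s, a)` only components that are realized after that epoch can intrude. The spill-over assumption
bounds the mean of the components of one epoch that are realized after it by `d`, whatever the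
actions are. Hence the bias of the estimate is at most `d` per epoch in both directions, up to
fluctuations.

*Concentration.* The time until the end of the epoch is not known when a reward is generated, so the
part of the reward that is realized within the epoch is not a function of the past and of the
fresh randomness alone. However, the policy of an epoch depends only on rewards generated before the
epoch (`policyPredictable_of_run`), so, given the trajectory of states and actions, the rewards of
the current epoch are still distributed as if they were fresh. This gives exponential moment bounds
for products whose factors look ahead to the end of the epoch
(`IsInteraction.lintegral_epochProd_le_one`), and with Markov's inequality all deviation bounds for
the rewards. The transitions are handled by the usual exponential supermartingale.

*Summation.* On the good event (`GoodAt` at all times) the step inequalities are summed, using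
`∑ 1 / √N ≤ 2 √2 √(S A T)` and the bound `S A log₂ (8 T / (S A))` on the number of epochs. The few
steps at which a pair has been visited less than `16 log (2 S A T / δ)` times cost at most `2 D` each.
If `T ≤ 34 D S √(A T log (T / δ))` there is nothing to prove, and otherwise `T` is so large that the
constants fit (`regret_constants`). For the bound in expectation, the regret on the exceptional event
is at most `T`, and the event has probability at most `1 / T`.
-/

namespace DelayedMDP

set_option linter.unusedSectionVars false

/-! ### Extended value iteration -/

section ValueIteration

variable {S A : Type*} [Fintype S]

lemma le_ciSup_fintype {ι : Type*} [Finite ι] (f : ι → ℝ) (i : ι) : f i ≤ ⨆ j, f j :=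
  le_ciSup (Set.finite_range f).bddAbove i

lemma ciInf_fintype_le {ι : Type*} [Finite ι] (f : ι → ℝ) (i : ι) : ⨅ j, f j ≤ f i :=
  ciInf_le (Set.finite_range f).bddBelow i

lemma sum_mul_le_of_mem_stdSimplex {q u : S → ℝ} {c : ℝ} (hq : q ∈ stdSimplex ℝ S)
    (hu : ∀ y, u y ≤ c) : ∑ y, q y * u y ≤ c := by
  calc ∑ y, q y * u y ≤ ∑ y, q y * c :=
        Finset.sum_le_sum fun y _ => mul_le_mul_of_nonneg_left (hu y) (hq.1 y)
    _ = c := by rw [← Finset.sum_mul, hq.2, one_mul]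

lemma le_sum_mul_of_mem_stdSimplex {q u : S → ℝ} {c : ℝ} (hq : q ∈ stdSimplex ℝ S)
    (hu : ∀ y, c ≤ u y) : c ≤ ∑ y, q y * u y := by
  calc c = ∑ y, q y * c := by rw [← Finset.sum_mul, hq.2, one_mul]
    _ ≤ ∑ y, q y * u y :=
        Finset.sum_le_sum fun y _ => mul_le_mul_of_nonneg_left (hu y) (hq.1 y)

/-- If an average of values `u y ≤ c` equals `c`, then `u = c` wherever the weight is positive. -/
lemma eq_of_sum_mul_eq {q u : S → ℝ} {c : ℝ} (hq : q ∈ stdSimplex ℝ S)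
    (hu : ∀ y, u y ≤ c) (h : ∑ y, q y * u y = c) {y : S} (hy : 0 < q y) : u y = c := by
  have h0 : ∑ y, q y * (c - u y) = 0 := by
    simp only [mul_sub, Finset.sum_sub_distrib, ← Finset.sum_mul, hq.2, h]; ring
  have h1 := (Finset.sum_eq_zero_iff_of_nonneg
    (fun y _ => mul_nonneg (hq.1 y) (sub_nonneg.2 (hu y)))).1 h0 y (Finset.mem_univ y)
  rcases mul_eq_zero.1 h1 with h2 | h2 <;> linarith

lemma bddAbove_image_expectation {P : Set (S → ℝ)} (hP : P ⊆ stdSimplex ℝ S) (u : S → ℝ) :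
    BddAbove ((fun q : S → ℝ => ∑ y, q y * u y) '' P) := by
  refine ⟨⨆ y, u y, ?_⟩
  rintro _ ⟨q, hq, rfl⟩
  exact sum_mul_le_of_mem_stdSimplex (hP hq) (le_ciSup_fintype u)

variable {R : S → A → ℝ} {P : S → A → Set (S → ℝ)}

lemma le_eviQ (hP : ∀ s a, P s a ⊆ stdSimplex ℝ S) (u : S → ℝ) (s : S) (a : A) {q : S → ℝ}
    (hq : q ∈ P s a) : R s a + ∑ y, q y * u y ≤ eviQ R P u s a := by
  unfold eviQ
  gcongr
  exact le_csSup (bddAbove_image_expectation (hP s a) u) ⟨q, hq, rfl⟩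

lemma exists_eviQ_eq (hP : ∀ s a, IsCompact (P s a)) (hne : ∀ s a, (P s a).Nonempty)
    (u : S → ℝ) (s : S) (a : A) :
    ∃ q ∈ P s a, eviQ R P u s a = R s a + ∑ y, q y * u y := by
  have hc : Continuous (fun q : S → ℝ => ∑ y, q y * u y) := by fun_prop
  obtain ⟨q, hq, h⟩ := ((hP s a).image hc).sSup_mem ((hne s a).image _)
  exact ⟨q, hq, by simp only [eviQ, ← h]⟩

lemma eviQ_le_add (hP : ∀ s a, P s a ⊆ stdSimplex ℝ S) (hne : ∀ s a, (P s a).Nonempty)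
    {u v : S → ℝ} {c : ℝ} (h : ∀ y, u y ≤ v y + c) (s : S) (a : A) :
    eviQ R P u s a ≤ eviQ R P v s a + c := by
  have : sSup ((fun q : S → ℝ => ∑ y, q y * u y) '' P s a) ≤
      sSup ((fun q : S → ℝ => ∑ y, q y * v y) '' P s a) + c := by
    refine csSup_le ((hne s a).image _) ?_
    rintro _ ⟨q, hq, rfl⟩
    have h1 : ∑ y, q y * u y ≤ ∑ y, q y * v y + c := by
      have := sum_mul_le_of_mem_stdSimplex (u := fun y => u y - v y) (hP s a hq)
        (fun y => by linarith [h y])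
      simp only [mul_sub, Finset.sum_sub_distrib] at this
      linarith
    have h2 := le_csSup (bddAbove_image_expectation (hP s a) v) ⟨q, hq, rfl⟩
    simp only at h2 ⊢
    linarith
  unfold eviQ
  linarith

/-- The optimality operator of extended value iteration: `eviU (i + 1) = bellman (eviU i)`. -/
noncomputable def bellman (R : S → A → ℝ) (P : S → A → Set (S → ℝ)) (u : S → ℝ) : S → ℝ :=
  fun s => ⨆ a, eviQ R P u s a

lemma eviU_succ (i : ℕ) : eviU R P (i + 1) = bellman R P (eviU R P i) := rfl

variable [Fintype A]

lemma eviQ_le_bellman (u : S → ℝ) (s : S) (a : A) : eviQ R P u s a ≤ bellman R P u s :=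
  le_ciSup_fintype (fun a => eviQ R P u s a) a

lemma exists_bellman_eq [Nonempty A] (u : S → ℝ) (s : S) :
    ∃ a, bellman R P u s = eviQ R P u s a := by
  obtain ⟨a, ha⟩ := exists_eq_ciSup_of_finite (f := fun a => eviQ R P u s a)
  exact ⟨a, ha.symm⟩

lemma bellman_le_add [Nonempty A] (hP : ∀ s a, P s a ⊆ stdSimplex ℝ S)
    (hne : ∀ s a, (P s a).Nonempty) {u v : S → ℝ} {c : ℝ} (h : ∀ y, u y ≤ v y + c) (s : S) :
    bellman R P u s ≤ bellman R P v s + c := by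
  obtain ⟨a, ha⟩ := exists_bellman_eq (R := R) (P := P) u s
  rw [ha]
  exact (eviQ_le_add hP hne h s a).trans (by gcongr; exact eviQ_le_bellman v s a)

lemma bellman_sub_const [Nonempty A] (hP : ∀ s a, P s a ⊆ stdSimplex ℝ S)
    (hne : ∀ s a, (P s a).Nonempty) (u : S → ℝ) (c : ℝ) (s : S) :
    bellman R P (fun y => u y - c) s = bellman R P u s - c := by
  apply le_antisymm
  · have := bellman_le_add (R := R) hP hne (u := fun y => u y - c) (v := u) (c := -c)
      (fun y => by linarith) s
    linarith
  · have := bellman_le_add (R := R) hP hne (u := u) (v := fun y => u y - c) (c := c)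
      (fun y => by linarith) s
    linarith

lemma continuous_bellman [Nonempty A] (hP : ∀ s a, P s a ⊆ stdSimplex ℝ S)
    (hne : ∀ s a, (P s a).Nonempty) : Continuous (bellman R P) := by
  refine LipschitzWith.continuous (K := 1) (LipschitzWith.of_dist_le_mul fun u v => ?_)
  rw [NNReal.coe_one, one_mul, dist_pi_le_iff dist_nonneg]
  intro s
  have huv : ∀ y, |u y - v y| ≤ dist u v := fun y => by
    rw [← Real.dist_eq]; exact dist_le_pi_dist u v y
  rw [Real.dist_eq, abs_sub_le_iff]
  constructor
  · have := bellman_le_add (R := R) hP hne (u := u) (v := v) (c := dist u v)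
      (fun y => by linarith [(abs_le.1 (huv y)).2]) s
    linarith
  · have := bellman_le_add (R := R) hP hne (u := v) (v := u) (c := dist u v)
      (fun y => by linarith [(abs_le.1 (huv y)).1]) s
    linarith

/-! ### Convergence of extended value iteration -/

variable [DecidableEq S]

/-- A set of probability vectors such that, from each vector without mass at `y₀`, a bit of mass
can be moved from some other point to `y₀` without leaving the set. -/
def CanMoveMass (Q : Set (S → ℝ)) : Prop :=
  ∀ q ∈ Q, ∀ y₀, q y₀ = 0 → ∃ y, ∃ ε > 0, y ≠ y₀ ∧
    (fun z => q z + ε * ((if z = y₀ then 1 else 0) - if z = y then 1 else 0)) ∈ Q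

lemma sum_moved_mass (q u : S → ℝ) (ε : ℝ) (y₀ y : S) :
    ∑ z, (q z + ε * ((if z = y₀ then 1 else 0) - if z = y then 1 else 0)) * u z =
      ∑ z, q z * u z + ε * (u y₀ - u y) := by
  have : ∀ z, (q z + ε * ((if z = y₀ then 1 else 0) - if z = y then 1 else 0)) * u z =
      q z * u z + ((if z = y₀ then ε * u z else 0) - if z = y then ε * u z else 0) := by
    intro z; split_ifs <;> ring
  simp only [this, Finset.sum_add_distrib, Finset.sum_sub_distrib, Finset.sum_ite_eq',
    Finset.mem_univ, if_true]
  ring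

lemma canMoveMass_transBall {phat : S → ℝ} {β : ℝ} (h0 : ∀ y, 0 ≤ phat y)
    (h1 : ∑ y, phat y ≤ 1) (hβ : 0 < β) : CanMoveMass (transBall phat β) := by
  intro q hq y₀ hy₀
  obtain ⟨hqs, hqb⟩ := hq
  -- It suffices to move mass that is available at `y` without increasing the distance too much.
  have key : ∀ y ε, 0 < ε → y ≠ y₀ → ε ≤ q y →
      ∑ z, |q z + ε * ((if z = y₀ then 1 else 0) - if z = y then 1 else 0) - phat z| ≤ β →
      ∃ y, ∃ ε > 0, y ≠ y₀ ∧
        (fun z => q z + ε * ((if z = y₀ then 1 else 0) - if z = y then 1 else 0)) ∈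
          transBall phat β := by
    intro y ε hε hy hεq hb
    refine ⟨y, ε, hε, hy, ⟨fun z => ?_, ?_⟩, hb⟩
    · have := hqs.1 z
      dsimp only
      split_ifs with h2 h3 h3
      · exact absurd (h3.symm.trans h2) hy
      · linarith
      · subst h3; linarith
      · linarith
    · have := sum_moved_mass q (fun _ => 1) ε y₀ y
      simp only [mul_one, sub_self, mul_zero, add_zero] at this
      rw [this, hqs.2]
  have split : ∀ y ε, y ≠ y₀ →
      ∑ z, |q z + ε * ((if z = y₀ then 1 else 0) - if z = y then 1 else 0) - phat z| =
        ∑ z, |q z - phat z| + (|ε - phat y₀| - |phat y₀|) +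
          (|q y - ε - phat y| - |q y - phat y|) := by
    intro y ε hy
    have : ∀ z, |q z + ε * ((if z = y₀ then 1 else 0) - if z = y then 1 else 0) - phat z| =
        |q z - phat z| + (if z = y₀ then |ε - phat y₀| - |phat y₀| else 0) +
          if z = y then |q y - ε - phat y| - |q y - phat y| else 0 := by
      intro z
      split_ifs with h2 h3 h3
      · exact absurd (h3.symm.trans h2) hy
      · subst h2; simp [hy₀]
      · subst h3; simp [sub_eq_add_neg]
      · simp
    simp only [this, Finset.sum_add_distrib, Finset.sum_ite_eq', Finset.mem_univ, if_true]
  have hpos : ∃ y, 0 < q y := by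
    by_contra! hc
    have : ∑ y, q y ≤ 0 := Finset.sum_nonpos fun y _ => hc y
    linarith [hqs.2]
  rcases (h0 y₀).lt_or_eq with hp | hp
  · obtain ⟨y, hy⟩ := hpos
    have hne : y ≠ y₀ := by rintro rfl; linarith
    refine key y (min (q y) (phat y₀)) (lt_min hy hp) hne (min_le_left _ _) ?_
    rw [split y _ hne]
    set ε := min (q y) (phat y₀)
    have hε : 0 < ε := lt_min hy hp
    have h3 : |ε - phat y₀| = phat y₀ - ε := by
      rw [abs_sub_comm, abs_of_nonneg (sub_nonneg.2 (min_le_right _ _))]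
    have h4 : |q y - ε - phat y| ≤ |q y - phat y| + ε := by
      have := abs_add_le (q y - phat y) (-ε)
      rw [abs_neg, abs_of_pos hε] at this
      rwa [show q y - ε - phat y = q y - phat y + -ε by ring]
    rw [h3, abs_of_pos hp]; linarith
  · by_cases hex : ∃ y, phat y < q y
    · obtain ⟨y, hy⟩ := hex
      have hne : y ≠ y₀ := by rintro rfl; linarith
      refine key y (q y - phat y) (by linarith) hne (by linarith [h0 y]) ?_
      rw [split y _ hne, ← hp]
      simp only [sub_zero, abs_zero, sub_sub_cancel, sub_self]
      linarith
    · push Not at hex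
      have heq : ∀ y, q y = phat y := by
        have h5 : ∑ y, (phat y - q y) = 0 := by
          apply le_antisymm
          · rw [Finset.sum_sub_distrib, hqs.2]; linarith
          · exact Finset.sum_nonneg fun y _ => sub_nonneg.2 (hex y)
        intro y
        have := (Finset.sum_eq_zero_iff_of_nonneg (fun y _ => sub_nonneg.2 (hex y))).1 h5 y
          (Finset.mem_univ y)
        linarith
      obtain ⟨y, hy⟩ := hpos
      have hne : y ≠ y₀ := by rintro rfl; linarith
      refine key y (min (q y) (β / 2)) (lt_min hy (by linarith)) hne (min_le_left _ _) ?_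
      set ε := min (q y) (β / 2)
      have hε : 0 < ε := lt_min hy (by linarith)
      rw [split y _ hne, ← hp]
      simp only [heq, sub_self, abs_zero, Finset.sum_const_zero, sub_zero]
      have h7 : |phat y - ε - phat y| = ε := by
        rw [show phat y - ε - phat y = -ε by ring, abs_neg, abs_of_pos hε]
      rw [h7, abs_of_pos hε]
      linarith [min_le_right (q y) (β / 2)]

/-- If two consecutive increments of value iteration attain the same maximum `a` and the same
minimum `b`, then `a = b`: both extremes are attained at a maximizer of `v`. -/
lemma increments_eq_of_stationary [Nonempty A] [Nonempty S]
    (hP : ∀ s a, P s a ⊆ stdSimplex ℝ S) (hc : ∀ s a, IsCompact (P s a))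
    (hne : ∀ s a, (P s a).Nonempty) (hm : ∀ s a, CanMoveMass (P s a)) {v : S → ℝ} {a b : ℝ}
    (h0a : ∀ y, bellman R P v y - v y ≤ a) (h0b : ∀ y, b ≤ bellman R P v y - v y)
    (h1a : ∃ y, bellman R P (bellman R P v) y - bellman R P v y = a)
    (h1b : ∃ y, bellman R P (bellman R P v) y - bellman R P v y = b) : a = b := by
  set T := bellman R P
  -- An optimal transition vector can be chosen with mass at a given maximizer of `v`.
  have move : ∀ s α q y₀, q ∈ P s α → eviQ R P v s α = R s α + ∑ y, q y * v y →
      (∀ y, v y ≤ v y₀) → ∃ q' ∈ P s α, eviQ R P v s α = R s α + ∑ y, q' y * v y ∧ 0 < q' y₀ := by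
    intro s α q y₀ hq hopt hmax
    rcases ((hP s α hq).1 y₀).lt_or_eq with h | h
    · exact ⟨q, hq, hopt, h⟩
    · obtain ⟨y, ε, hε, hy, hq'⟩ := hm s α q hq y₀ h.symm
      refine ⟨_, hq', ?_, ?_⟩
      · apply le_antisymm _ (le_eviQ hP v s α hq')
        rw [sum_moved_mass, hopt]
        have := mul_nonneg hε.le (sub_nonneg.2 (hmax y))
        linarith
      · simp [← h, hy.symm, hε]
  have argmax : ∀ s α q, q ∈ P s α → eviQ R P v s α = R s α + ∑ y, q y * v y →
      ∃ y₀, (∀ y, v y ≤ v y₀) ∧ 0 < q y₀ := by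
    intro s α q hq hopt
    by_contra! hcon
    obtain ⟨y₀, hy₀⟩ := Finite.exists_max v
    have hz : ∀ z, v z = v y₀ → q z = 0 := fun z hz =>
      le_antisymm (hcon z fun y => hz ▸ hy₀ y) ((hP s α hq).1 z)
    obtain ⟨y, ε, hε, hy, hq'⟩ := hm s α q hq y₀ (hz y₀ rfl)
    have hq0 : 0 < q y := by
      have := (hP s α hq').1 y
      simp only [hy, if_false, if_true] at this
      linarith
    have hlt : v y < v y₀ := lt_of_le_of_ne (hy₀ y) fun h => by
      have := hz y h
      linarith
    have := le_eviQ (R := R) hP v s α hq'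
    rw [sum_moved_mass, hopt] at this
    have := mul_pos hε (sub_pos.2 hlt)
    linarith
  obtain ⟨y₁, hy₁⟩ := h1a
  obtain ⟨y₂, hy₂⟩ := h1b
  obtain ⟨α₁, hα₁⟩ := exists_bellman_eq (R := R) (P := P) (T v) y₁
  obtain ⟨q₁, hq₁, hq₁e⟩ := exists_eviQ_eq (R := R) hc hne (T v) y₁ α₁
  have e1 : ∑ y, q₁ y * (T v y - v y) ≤ a := sum_mul_le_of_mem_stdSimplex (hP _ _ hq₁) h0a
  have e2 := le_eviQ (R := R) hP v y₁ α₁ hq₁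
  have e3 : eviQ R P v y₁ α₁ ≤ T v y₁ := eviQ_le_bellman v y₁ α₁
  have e4 : ∑ y, q₁ y * (T v y - v y) = ∑ y, q₁ y * T v y - ∑ y, q₁ y * v y := by
    simp only [mul_sub, Finset.sum_sub_distrib]
  have hα₁' : T (T v) y₁ = R y₁ α₁ + ∑ y, q₁ y * T v y := hα₁.trans hq₁e
  obtain ⟨y₀, hmax, hpos⟩ := argmax y₁ α₁ q₁ hq₁ (by linarith)
  have ha : T v y₀ - v y₀ = a :=
    eq_of_sum_mul_eq (u := fun y => T v y - v y) (hP _ _ hq₁) h0a (by linarith) hpos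
  obtain ⟨α₂, hα₂⟩ := exists_bellman_eq (R := R) (P := P) v y₂
  obtain ⟨q₂', hq₂', hq₂e'⟩ := exists_eviQ_eq (R := R) hc hne v y₂ α₂
  obtain ⟨q₂, hq₂, hq₂e, hpos₂⟩ := move y₂ α₂ q₂' y₀ hq₂' hq₂e' hmax
  have f2 := le_eviQ (R := R) hP (T v) y₂ α₂ hq₂
  have f3 : eviQ R P (T v) y₂ α₂ ≤ T (T v) y₂ := eviQ_le_bellman (T v) y₂ α₂
  have f1 : b ≤ ∑ y, q₂ y * (T v y - v y) := le_sum_mul_of_mem_stdSimplex (hP _ _ hq₂) h0b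
  have f4 : ∑ y, q₂ y * (T v y - v y) = ∑ y, q₂ y * T v y - ∑ y, q₂ y * v y := by
    simp only [mul_sub, Finset.sum_sub_distrib]
  have hα₂' : T v y₂ = R y₂ α₂ + ∑ y, q₂ y * v y := hα₂.trans hq₂e
  have hb : -(T v y₀ - v y₀) = -b := by
    refine eq_of_sum_mul_eq (u := fun y => -(T v y - v y)) (hP _ _ hq₂)
      (fun y => neg_le_neg (h0b y)) ?_ hpos₂
    simp only [mul_neg, Finset.sum_neg_distrib]
    linarith
  linarith

/-- Extended value iteration stops as soon as the spans of the iterates are bounded. -/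
lemma exists_eviError_lt [Nonempty A] [Nonempty S]
    (hP : ∀ s a, P s a ⊆ stdSimplex ℝ S) (hc : ∀ s a, IsCompact (P s a))
    (hne : ∀ s a, (P s a).Nonempty) (hm : ∀ s a, CanMoveMass (P s a)) {B : ℝ}
    (hB : ∀ i s s', eviU R P i s - eviU R P i s' ≤ B) {ε : ℝ} (hε : 0 < ε) :
    ∃ i, eviError R P i < ε := by
  set T := bellman R P with hT
  set u := eviU R P with hu
  set hi : ℕ → ℝ := fun i => ⨆ s, (u (i + 1) s - u i s) with hhi
  set lo : ℕ → ℝ := fun i => ⨅ s, (u (i + 1) s - u i s) with hlo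
  have le_hi : ∀ i s, u (i + 1) s - u i s ≤ hi i := fun i s =>
    le_ciSup_fintype (fun s => u (i + 1) s - u i s) s
  have lo_le : ∀ i s, lo i ≤ u (i + 1) s - u i s := fun i s =>
    ciInf_fintype_le (fun s => u (i + 1) s - u i s) s
  have hi_anti : Antitone hi := antitone_nat_of_succ_le fun i => ciSup_le fun s => by
    have := bellman_le_add (R := R) hP hne (u := u (i + 1)) (v := u i) (c := hi i)
      (fun y => by linarith [le_hi i y]) s
    rw [← eviU_succ, ← eviU_succ] at this
    linarith
  have lo_mono : Monotone lo := monotone_nat_of_le_succ fun i => le_ciInf fun s => by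
    have := bellman_le_add (R := R) hP hne (u := u i) (v := u (i + 1)) (c := -lo i)
      (fun y => by linarith [lo_le i y]) s
    rw [← eviU_succ, ← eviU_succ] at this
    linarith
  obtain ⟨s₀⟩ := ‹Nonempty S›
  have lo_le_hi : ∀ i, lo i ≤ hi i := fun i => (lo_le i s₀).trans (le_hi i s₀)
  have hi_lim : Tendsto hi atTop (nhds (⨅ i, hi i)) :=
    tendsto_atTop_ciInf hi_anti ⟨lo 0, by
      rintro _ ⟨i, rfl⟩; exact (lo_mono (Nat.zero_le i)).trans (lo_le_hi i)⟩
  have lo_lim : Tendsto lo atTop (nhds (⨆ i, lo i)) :=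
    tendsto_atTop_ciSup lo_mono ⟨hi 0, by
      rintro _ ⟨i, rfl⟩; exact (lo_le_hi i).trans (hi_anti (Nat.zero_le i))⟩
  set a := ⨅ i, hi i
  set b := ⨆ i, lo i
  suffices hab : a = b by
    have : Tendsto (fun i => hi i - lo i) atTop (nhds 0) := by
      have := hi_lim.sub lo_lim
      rwa [hab, sub_self] at this
    exact (this.eventually (gt_mem_nhds hε)).exists
  -- Extract a limit point of the iterates, normalized at one state.
  set w : ℕ → S → ℝ := fun i s => u i s - u i s₀ with hw
  have hbdd : ∀ i, w i ∈ Metric.closedBall (0 : S → ℝ) |B| := fun i => by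
    rw [mem_closedBall_zero_iff, pi_norm_le_iff_of_nonneg (abs_nonneg _)]
    intro s
    rw [Real.norm_eq_abs, abs_le]
    have h1 := hB i s s₀
    have h2 := hB i s₀ s
    have h3 := le_abs_self B
    simp only [hw]
    constructor <;> linarith
  obtain ⟨v, -, φ, hφ, hv⟩ := tendsto_subseq_of_bounded Metric.isBounded_closedBall hbdd
  have hTc : Continuous T := continuous_bellman hP hne
  have Tw : ∀ i s, T (w i) s = u (i + 1) s - u i s₀ := fun i s =>
    bellman_sub_const hP hne (u i) (u i s₀) s
  have TTw : ∀ i s, T (T (w i)) s = u (i + 2) s - u i s₀ := fun i s => by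
    have : T (w i) = fun s => u (i + 1) s - u i s₀ := funext (Tw i)
    rw [this]
    exact bellman_sub_const hP hne (u (i + 1)) (u i s₀) s
  have hi_φ := hi_lim.comp hφ.tendsto_atTop
  have lo_φ := lo_lim.comp hφ.tendsto_atTop
  have hi_φ1 := (hi_lim.comp (tendsto_add_atTop_nat 1)).comp hφ.tendsto_atTop
  have lo_φ1 := (lo_lim.comp (tendsto_add_atTop_nat 1)).comp hφ.tendsto_atTop
  have h1 : ∀ y, Tendsto (fun n => T (w (φ n)) y - w (φ n) y) atTop (nhds (T v y - v y)) :=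
    fun y => (((continuous_apply y).comp hTc).tendsto v |>.comp hv).sub
      (((continuous_apply y).tendsto v).comp hv)
  have hd1c : Continuous fun x : S → ℝ => fun y => T (T x) y - T x y := by
    refine continuous_pi fun y => ?_
    exact ((continuous_apply y).comp (hTc.comp hTc)).sub ((continuous_apply y).comp hTc)
  have hsupc : Continuous fun x : S → ℝ => ⨆ y, x y := by
    have : (fun x : S → ℝ => ⨆ y, x y) =
        fun x => Finset.univ.sup' ⟨s₀, Finset.mem_univ s₀⟩ fun y => x y := by
      funext x
      have : Nonempty S := ⟨s₀⟩
      exact (Finset.sup'_univ_eq_ciSup x).symm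
    rw [this]
    exact Continuous.finset_sup'_apply _ fun y _ => continuous_apply y
  have hinfc : Continuous fun x : S → ℝ => ⨅ y, x y := by
    have : (fun x : S → ℝ => ⨅ y, x y) =
        fun x => Finset.univ.inf' ⟨s₀, Finset.mem_univ s₀⟩ fun y => x y := by
      funext x
      have : Nonempty S := ⟨s₀⟩
      exact (Finset.inf'_univ_eq_ciInf x).symm
    rw [this]
    exact Continuous.finset_inf'_apply _ fun y _ => continuous_apply y
  have : Nonempty S := ⟨s₀⟩
  have sup1 : ⨆ y, (T (T v) y - T v y) = a := by
    refine tendsto_nhds_unique (((hsupc.comp hd1c).tendsto v).comp hv) ?_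
    refine hi_φ1.congr fun n => ?_
    simp only [Function.comp_apply, Tw, TTw, hhi]
    refine iSup_congr fun y => ?_
    ring
  have inf1 : ⨅ y, (T (T v) y - T v y) = b := by
    refine tendsto_nhds_unique (((hinfc.comp hd1c).tendsto v).comp hv) ?_
    refine lo_φ1.congr fun n => ?_
    simp only [Function.comp_apply, Tw, TTw, hlo]
    refine iInf_congr fun y => ?_
    ring
  refine increments_eq_of_stationary (v := v) hP hc hne hm
    (fun y => le_of_tendsto_of_tendsto' (h1 y) hi_φ fun n => ?_)
    (fun y => le_of_tendsto_of_tendsto' lo_φ (h1 y) fun n => ?_) ?_ ?_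
  · rw [Tw]; simp only [hw, Function.comp_apply]; linarith [le_hi (φ n) y]
  · rw [Tw]; simp only [hw, Function.comp_apply]; linarith [lo_le (φ n) y]
  · obtain ⟨y, hy⟩ := exists_eq_ciSup_of_finite (f := fun y => T (T v) y - T v y)
    exact ⟨y, hy.trans sup1⟩
  · obtain ⟨y, hy⟩ := exists_eq_ciInf_of_finite (f := fun y => T (T v) y - T v y)
    exact ⟨y, hy.trans inf1⟩

end ValueIteration

section Optimism

variable {S A : Type*} [Fintype S] [Fintype A]

/-! ### Bounds on the optimal gain and on hitting times -/

lemma MDP.sum_p_add_const (M : MDP S A) (s : S) (a : A) (u : S → ℝ) (c : ℝ) :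
    ∑ y, M.p s a y * (u y + c) = ∑ y, M.p s a y * u y + c := by
  simp only [mul_add, Finset.sum_add_distrib, ← Finset.sum_mul, (M.p_mem s a).2, one_mul]

lemma MDP.value_nonneg (M : MDP S A) (σ : Protocol S A) (n : ℕ) (h : List (S × A)) (s : S) :
    0 ≤ M.value σ n h s := by
  induction n generalizing h s with
  | zero => exact le_rfl
  | succ n ih =>
    exact Finset.sum_nonneg fun a _ => mul_nonneg ((σ.prob_mem h s).1 a)
      (add_nonneg (M.r_mem s a).1
        (Finset.sum_nonneg fun y _ => mul_nonneg ((M.p_mem s a).1 y) (ih _ _)))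

lemma MDP.value_le (M : MDP S A) {u : S → ℝ} {c m : ℝ}
    (hu : ∀ s a, M.r s a + ∑ y, M.p s a y * u y ≤ u s + c) (hm : ∀ s, m ≤ u s)
    (σ : Protocol S A) (n : ℕ) (h : List (S × A)) (s : S) :
    M.value σ n h s ≤ n * c + (u s - m) := by
  induction n generalizing h s with
  | zero => simpa [MDP.value] using hm s
  | succ n ih =>
    refine sum_mul_le_of_mem_stdSimplex (σ.prob_mem h s) fun a => ?_
    have h1 : ∑ y, M.p s a y * M.value σ n (h ++ [(s, a)]) y ≤
        ∑ y, M.p s a y * (u y + (n * c - m)) :=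
      Finset.sum_le_sum fun y _ => mul_le_mul_of_nonneg_left
        ((ih (h ++ [(s, a)]) y).trans (by linarith)) ((M.p_mem s a).1 y)
    rw [M.sum_p_add_const] at h1
    push_cast
    linarith [hu s a]

/-- A solution of the optimality inequality with gain `c` bounds the average reward of every
protocol. -/
lemma MDP.avgReward_le [Nonempty S] (M : MDP S A) {u : S → ℝ} {c : ℝ}
    (hu : ∀ s a, M.r s a + ∑ y, M.p s a y * u y ≤ u s + c) (σ : Protocol S A) (s : S) :
    M.avgReward σ s ≤ c := by
  have hlim : Tendsto (fun n : ℕ => c + (u s - ⨅ y, u y) / n) atTop (nhds c) := by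
    simpa using tendsto_const_nhds.add (tendsto_const_div_atTop_nhds_zero_nat (u s - ⨅ y, u y))
  have hle : (fun n : ℕ => M.value σ n [] s / n) ≤ᶠ[atTop]
      fun n : ℕ => c + (u s - ⨅ y, u y) / n := by
    filter_upwards [eventually_gt_atTop 0] with n hn
    have hn' : (0 : ℝ) < n := by exact_mod_cast hn
    rw [div_le_iff₀ hn', add_mul, div_mul_cancel₀ _ hn'.ne']
    have := M.value_le hu (fun y => ciInf_fintype_le u y) σ n [] s
    linarith
  have hb : IsBoundedUnder (· ≥ ·) atTop fun n : ℕ => M.value σ n [] s / n :=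
    isBoundedUnder_of ⟨0, fun n => div_nonneg (M.value_nonneg σ n [] s) n.cast_nonneg⟩
  exact (limsup_le_limsup hle hb.isCoboundedUnder_le hlim.isBoundedUnder_le).trans_eq
    hlim.limsup_eq

lemma MDP.optGain_le [Nonempty S] [Nonempty A] (M : MDP S A) {u : S → ℝ} {c : ℝ}
    (hu : ∀ s a, M.r s a + ∑ y, M.p s a y * u y ≤ u s + c) : M.optGain ≤ c := by
  classical
  have : Nonempty (Protocol S A) := by
    obtain ⟨a⟩ := ‹Nonempty A›
    exact ⟨⟨fun _ _ => Pi.single a 1, fun _ _ => single_mem_stdSimplex ℝ a⟩⟩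
  exact ciSup_le fun q => M.avgReward_le hu q.1 q.2

lemma MDP.optGain_le_one [Nonempty S] [Nonempty A] (M : MDP S A) : M.optGain ≤ 1 :=
  M.optGain_le (u := 0) (c := 1) fun s a => by simpa using (M.r_mem s a).2

variable [DecidableEq S]

lemma MDP.notReached_nonneg (M : MDP S A) (π : S → A) (goal : S) (n : ℕ) (s : S) :
    0 ≤ M.notReached π goal n s := by
  induction n generalizing s with
  | zero => simp only [MDP.notReached]; split_ifs <;> norm_num
  | succ n ih =>
    simp only [MDP.notReached]
    split_ifs
    · exact le_rfl
    · exact Finset.sum_nonneg fun y _ => mul_nonneg ((M.p_mem _ _).1 y) (ih y)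

/-- Unrolling `p u ≤ u + c` along the policy `π` until the goal is reached. -/
lemma MDP.sub_le_sum_notReached (M : MDP S A) (π : S → A) (goal : S) {u : S → ℝ} {c B : ℝ}
    (hu : ∀ s a, ∑ y, M.p s a y * u y ≤ u s + c) (hB : ∀ s, u goal - u s ≤ B) (n : ℕ) (s : S) :
    u goal - u s ≤ c * ∑ j ∈ range n, M.notReached π goal j s + B * M.notReached π goal n s := by
  induction n generalizing s with
  | zero =>
    simp only [Finset.range_zero, Finset.sum_empty, mul_zero, zero_add, MDP.notReached]
    split_ifs with h
    · simp [h]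
    · simpa using hB s
  | succ n ih =>
    by_cases h : s = goal
    · have h0 : ∀ j, M.notReached π goal j s = 0 := fun j => by
        cases j <;> simp [MDP.notReached, h]
      subst h
      simp [h0]
    · have h1 : ∑ y, M.p s (π s) y * (u goal - u y) ≤
          ∑ y, M.p s (π s) y * (c * ∑ j ∈ range n, M.notReached π goal j y +
            B * M.notReached π goal n y) :=
        Finset.sum_le_sum fun y _ => mul_le_mul_of_nonneg_left (ih y) ((M.p_mem _ _).1 y)
      have h2 : ∑ y, M.p s (π s) y * (u goal - u y) = u goal - ∑ y, M.p s (π s) y * u y := by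
        simp only [mul_sub, Finset.sum_sub_distrib, ← Finset.sum_mul, (M.p_mem _ _).2, one_mul]
      have h3 : ∑ y, M.p s (π s) y * (c * ∑ j ∈ range n, M.notReached π goal j y +
            B * M.notReached π goal n y) =
          c * ∑ j ∈ range n, M.notReached π goal (j + 1) s +
            B * M.notReached π goal (n + 1) s := by
        simp only [MDP.notReached, h, if_false, mul_add, Finset.sum_add_distrib, Finset.mul_sum]
        rw [Finset.sum_comm]
        congr 1
        · exact Finset.sum_congr rfl fun j _ => Finset.sum_congr rfl fun y _ => by ring
        · exact Finset.sum_congr rfl fun y _ => by ring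
      have h4 : M.notReached π goal 0 s = 1 := by simp [MDP.notReached, h]
      rw [Finset.sum_range_succ', mul_add, h4]
      linarith [hu s (π s)]

/-- If `p u ≤ u + c` for all transitions of the MDP, then the span of `u` is at most `c` times
the diameter. -/
lemma MDP.sub_le_mul_diameter [Nonempty A] (M : MDP S A) (hD : M.diameter < ⊤) {u : S → ℝ}
    {c : ℝ} (hc : 0 ≤ c) (hu : ∀ s a, ∑ y, M.p s a y * u y ≤ u s + c) (goal s : S) :
    u goal - u s ≤ c * M.diameter.toReal := by
  rcases eq_or_ne s goal with rfl | hs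
  · simpa using mul_nonneg hc ENNReal.toReal_nonneg
  obtain ⟨π, hπ⟩ := exists_eq_ciInf_of_finite (f := fun π : S → A => M.expectedTime π s goal)
  have hπD : M.expectedTime π s goal ≤ M.diameter := by
    rw [hπ]
    exact le_iSup_of_le s (le_iSup_of_le goal (le_iSup_of_le hs le_rfl))
  set f : ℕ → ℝ := fun n => M.notReached π goal n s
  have hf : ∀ n, 0 ≤ f n := fun n => M.notReached_nonneg π goal n s
  have hsum : Summable f := by
    have h1 : ∑' n, ENNReal.ofReal (f n) ≠ ⊤ := (hπD.trans_lt hD).ne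
    have := ENNReal.summable_toReal h1
    simpa only [ENNReal.toReal_ofReal (hf _)] using this
  have htime : ∑' n, f n ≤ M.diameter.toReal := by
    have h2 : ENNReal.ofReal (∑' n, f n) ≤ M.diameter := by
      rw [ENNReal.ofReal_tsum_of_nonneg hf hsum]
      exact hπD
    exact (ENNReal.ofReal_le_iff_le_toReal hD.ne).1 h2
  have hlim : Tendsto (fun n => c * ∑ j ∈ range n, f j + (⨆ y, (u goal - u y)) * f n) atTop
      (nhds (c * ∑' n, f n + (⨆ y, (u goal - u y)) * 0)) :=
    (hsum.hasSum.tendsto_sum_nat.const_mul c).add (hsum.tendsto_atTop_zero.const_mul _)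
  have := ge_of_tendsto' hlim fun n => M.sub_le_sum_notReached π goal hu
    (fun y => le_ciSup_fintype (fun y => u goal - u y) y) n s
  rw [mul_zero, add_zero] at this
  exact this.trans (mul_le_mul_of_nonneg_left htime hc)

lemma MDP.one_le_diameter [Nontrivial S] (M : MDP S A) : 1 ≤ M.diameter := by
  obtain ⟨s, s', h⟩ := exists_pair_ne S
  refine le_iSup_of_le s (le_iSup_of_le s' (le_iSup_of_le h (le_iInf fun π => ?_)))
  refine le_trans ?_ (ENNReal.le_tsum 0)
  simp [MDP.notReached, h]

lemma MDP.one_le_diameter_toReal [Nontrivial S] (M : MDP S A) (hD : M.diameter < ⊤) :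
    1 ≤ M.diameter.toReal := by
  have := (ENNReal.toReal_le_toReal ENNReal.one_ne_top hD.ne).2 M.one_le_diameter
  simpa using this

/-! ### The optimistic step inequality -/

/-- The terminal utility vector of extended value iteration, shifted to have minimum `0` and divided
by `max 1 g`, where `g` is the last maximal increment. The reward bonuses are not truncated, so `g`
may exceed `1`; the division makes up for that. -/
noncomputable def eviBias (R : S → A → ℝ) (P : S → A → Set (S → ℝ)) (ε : ℝ) (s : S) : ℝ :=
  (eviU R P (eviStop R P ε) s - ⨅ y, eviU R P (eviStop R P ε) y) /
    max 1 (⨆ y, (eviU R P (eviStop R P ε + 1) y - eviU R P (eviStop R P ε) y))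

variable {R : S → A → ℝ} {P : S → A → Set (S → ℝ)}

lemma le_bellman_of_mem (hP : ∀ s a, P s a ⊆ stdSimplex ℝ S) (u : S → ℝ) (s : S) (a : A)
    {q : S → ℝ} (hq : q ∈ P s a) : R s a + ∑ y, q y * u y ≤ bellman R P u s :=
  (le_eviQ hP u s a hq).trans (eviQ_le_bellman u s a)

/-- The span of the iterates is controlled by the last increment. -/
lemma eviU_sub_le [Nonempty A] (M : MDP S A) (hD : M.diameter < ⊤)
    (hP : ∀ s a, P s a ⊆ stdSimplex ℝ S) (hMP : ∀ s a, M.p s a ∈ P s a)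
    (hR0 : ∀ s a, 0 ≤ R s a) (i : ℕ) {c : ℝ} (hc : 0 ≤ c)
    (hic : ∀ y, eviU R P (i + 1) y - eviU R P i y ≤ c) (s s' : S) :
    eviU R P i s - eviU R P i s' ≤ c * M.diameter.toReal := by
  refine M.sub_le_mul_diameter hD hc (fun s a => ?_) s s'
  have h1 := le_bellman_of_mem (R := R) hP (eviU R P i) s a (hMP s a)
  rw [← eviU_succ] at h1
  linarith [hR0 s a, hic s]

lemma eviStop_spec [Nonempty S] [Nonempty A] (M : MDP S A) (hD : M.diameter < ⊤)
    (hP : ∀ s a, P s a ⊆ stdSimplex ℝ S) (hc : ∀ s a, IsCompact (P s a))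
    (hm : ∀ s a, CanMoveMass (P s a)) (hMP : ∀ s a, M.p s a ∈ P s a)
    (hR0 : ∀ s a, 0 ≤ R s a) {ε : ℝ} (hε : 0 < ε) : eviError R P (eviStop R P ε) < ε := by
  have hne : ∀ s a, (P s a).Nonempty := fun s a => ⟨_, hMP s a⟩
  set c := max 0 (⨆ y, (eviU R P 1 y - eviU R P 0 y)) with hcdef
  have hinc : ∀ i y, eviU R P (i + 1) y - eviU R P i y ≤ c := by
    intro i
    induction i with
    | zero =>
      exact fun y => (le_ciSup_fintype (fun y => eviU R P 1 y - eviU R P 0 y) y).trans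
        (le_max_right _ _)
    | succ i ih =>
      intro y
      have := bellman_le_add (R := R) hP hne (u := eviU R P (i + 1)) (v := eviU R P i) (c := c)
        (fun y => by linarith [ih y]) y
      rw [← eviU_succ, ← eviU_succ] at this
      linarith
  exact Nat.sInf_mem (s := {i | eviError R P i < ε}) <| exists_eviError_lt hP hc hne hm
    (fun i s s' => eviU_sub_le M hD hP hMP hR0 i (le_max_left _ _) (hinc i) s s') hε

lemma eviBias_nonneg (ε : ℝ) (s : S) : 0 ≤ eviBias R P ε s :=
  div_nonneg (sub_nonneg.2 (ciInf_fintype_le _ s)) (le_max_of_le_left zero_le_one)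

lemma eviBias_le [Nonempty S] [Nonempty A] (M : MDP S A) (hD : M.diameter < ⊤)
    (hP : ∀ s a, P s a ⊆ stdSimplex ℝ S) (hMP : ∀ s a, M.p s a ∈ P s a)
    (hR0 : ∀ s a, 0 ≤ R s a) (ε : ℝ) (s : S) : eviBias R P ε s ≤ M.diameter.toReal := by
  unfold eviBias
  set i := eviStop R P ε
  rw [div_le_iff₀ (lt_max_of_lt_left zero_lt_one), mul_comm]
  obtain ⟨s', hs'⟩ := exists_eq_ciInf_of_finite (f := eviU R P i)
  rw [← hs']
  exact eviU_sub_le M hD hP hMP hR0 i (le_max_of_le_left zero_le_one)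
    (fun y => (le_ciSup_fintype (fun y => eviU R P (i + 1) y - eviU R P i y) y).trans
      (le_max_right _ _)) s s'

lemma sum_sub_mul_le {q p w : S → ℝ} {D : ℝ} (hq : q ∈ stdSimplex ℝ S) (hp : p ∈ stdSimplex ℝ S)
    (hw : ∀ y, w y ∈ Set.Icc 0 D) :
    ∑ y, q y * w y - ∑ y, p y * w y ≤ D / 2 * ∑ y, |q y - p y| := by
  have h1 : ∑ y, q y * w y - ∑ y, p y * w y = ∑ y, (q y - p y) * (w y - D / 2) := by
    have : ∀ y, (q y - p y) * (w y - D / 2) =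
        q y * w y - p y * w y - (q y * (D / 2) - p y * (D / 2)) := fun y => by ring
    simp only [this, Finset.sum_sub_distrib, ← Finset.sum_mul, hq.2, hp.2]
    ring
  rw [h1, Finset.mul_sum]
  refine Finset.sum_le_sum fun y _ => ?_
  have h2 : |w y - D / 2| ≤ D / 2 := by
    rw [abs_le]; constructor <;> linarith [(hw y).1, (hw y).2]
  calc (q y - p y) * (w y - D / 2) ≤ |(q y - p y) * (w y - D / 2)| := le_abs_self _
    _ = |w y - D / 2| * |q y - p y| := by rw [abs_mul, mul_comm]
    _ ≤ D / 2 * |q y - p y| := mul_le_mul_of_nonneg_right h2 (abs_nonneg _)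

/-- The per-step regret of the optimistic policy. The reward bonus enters through
`min (D + 1) (R - r)`: a large bonus raises the optimistic gain as well, and after the normalization
in `eviBias` it counts for at most `D + 1`. -/
lemma optGain_sub_le [DecidableEq A] [Nonempty S] [Nonempty A] (M : MDP S A)
    (hD : M.diameter < ⊤) (hP : ∀ s a, P s a ⊆ stdSimplex ℝ S) (hc : ∀ s a, IsCompact (P s a))
    (hm : ∀ s a, CanMoveMass (P s a)) (hMP : ∀ s a, M.p s a ∈ P s a)
    (hMR : ∀ s a, M.r s a ≤ R s a) {ε : ℝ} (hε : 0 < ε) (tie : S → Finset A → A)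
    (htie : ∀ s F, F.Nonempty → tie s F ∈ F) (s : S) {a : A} (ha : a = eviPolicy tie R P ε s)
    {β : ℝ} (hβ : ∀ q ∈ P s a, ∑ y, |q y - M.p s a y| ≤ 2 * β) :
    M.optGain - M.r s a ≤ ε + min (M.diameter.toReal + 1) (R s a - M.r s a) +
      M.diameter.toReal * β + (∑ y, M.p s a y * eviBias R P ε y - eviBias R P ε s) := by
  have hR0 : ∀ s a, 0 ≤ R s a := fun s a => (M.r_mem s a).1.trans (hMR s a)
  have hne : ∀ s a, (P s a).Nonempty := fun s a => ⟨_, hMP s a⟩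
  have hhalt := eviStop_spec M hD hP hc hm hMP hR0 hε
  set D := M.diameter.toReal
  have hbias : ∀ y, eviBias R P ε y ∈ Set.Icc 0 D := fun y =>
    ⟨eviBias_nonneg ε y, eviBias_le M hD hP hMP hR0 ε y⟩
  set i := eviStop R P ε with hi
  set u := eviU R P i with hu
  set g := ⨆ y, (eviU R P (i + 1) y - u y) with hg
  set c := max 1 g with hcdef
  have hc1 : 1 ≤ c := le_max_left _ _
  have hc0 : 0 < c := zero_lt_one.trans_le hc1
  have hw : ∀ y, eviBias R P ε y = (u y - ⨅ y, u y) / c := fun y => rfl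
  have hge : ∀ y, g - ε ≤ eviU R P (i + 1) y - u y := fun y => by
    have := ciInf_fintype_le (fun s => eviU R P (i + 1) s - u s) y
    unfold eviError at hhalt
    linarith
  have hle : ∀ y, eviU R P (i + 1) y - u y ≤ g :=
    le_ciSup_fintype fun y => eviU R P (i + 1) y - u y
  have hgain : M.optGain ≤ g := M.optGain_le (u := u) fun s a => by
    have h1 := le_bellman_of_mem (R := R) hP u s a (hMP s a)
    rw [← eviU_succ] at h1
    linarith [hMR s a, hle s]
  have hgain' : M.optGain ≤ g / c := by
    rcases le_total g 1 with h | h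
    · rwa [hcdef, max_eq_left h, div_one]
    · rw [hcdef, max_eq_right h, div_self (zero_lt_one.trans_le h).ne']
      exact M.optGain_le_one
  -- `a` maximizes `eviQ` at `s`.
  have hau : eviU R P (i + 1) s = eviQ R P u s a := by
    obtain ⟨a', ha'⟩ := exists_bellman_eq (R := R) (P := P) u s
    have hmem := htie s {a | ∀ b, eviQ R P u s b ≤ eviQ R P u s a}
      ⟨a', by simp only [mem_filter, mem_univ, true_and, ← ha']; exact eviQ_le_bellman u s⟩
    have ha2 : a = tie s {a | ∀ b, eviQ R P u s b ≤ eviQ R P u s a} := ha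
    rw [← ha2, mem_filter] at hmem
    apply le_antisymm _ (eviQ_le_bellman u s a)
    exact ha'.trans_le (hmem.2 a')
  obtain ⟨q, hq, hqe⟩ := exists_eviQ_eq (R := R) hc hne u s a
  have hqw : ∑ y, q y * eviBias R P ε y = (∑ y, q y * u y - ⨅ y, u y) / c := by
    simp only [hw, ← mul_div_assoc, ← Finset.sum_div, mul_sub, Finset.sum_sub_distrib,
      ← Finset.sum_mul, (hP s a hq).2, one_mul]
  have hdiff := sum_sub_mul_le (hP s a hq) (M.p_mem s a) hbias
  have hβ' := mul_le_mul_of_nonneg_left (hβ q hq) (show 0 ≤ D / 2 by positivity)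
  -- the optimality equation at `s`, divided by `c`
  have hmain : g / c ≤ ε / c + R s a / c + (∑ y, q y * eviBias R P ε y - eviBias R P ε s) := by
    rw [hqw, hw s, ← add_div, ← sub_div, ← add_div]
    gcongr
    linarith [hge s]
  have hεc : ε / c ≤ ε := div_le_self hε.le hc1
  have hbon1 : R s a / c - M.r s a ≤ D + 1 := by
    have h2 : R s a ≤ g + (u s - ∑ y, q y * u y) := by linarith [hle s]
    have h3 : R s a / c ≤ g / c + (eviBias R P ε s - ∑ y, q y * eviBias R P ε y) := by
      rw [hqw, hw s, ← sub_div, ← add_div]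
      gcongr
      linarith
    have h4 : g / c ≤ 1 := (div_le_one hc0).2 (le_max_right _ _)
    have h5 : 0 ≤ ∑ y, q y * eviBias R P ε y :=
      Finset.sum_nonneg fun y _ => mul_nonneg ((hP s a hq).1 y) (hbias y).1
    linarith [(hbias s).2, (M.r_mem s a).1]
  have hbon2 : R s a / c - M.r s a ≤ R s a - M.r s a :=
    sub_le_sub_right (div_le_self (hR0 s a) hc1) _
  have := le_min hbon1 hbon2
  linarith

end Optimism

section Epochs

variable {S A : Type*} [Fintype S] [DecidableEq S] [Fintype A] [DecidableEq A]
variable {st st' : ℕ → S} {act act' : ℕ → A}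

/-! ### Epochs as functions of the trajectory -/

/-- The start of the epoch that contains the time `t ≥ 1`, computed from the states up to time `t`
and the actions before `t` alone: a new epoch starts as soon as some pair `(s_t, a)` has occurred
`max 1 N` times in the epoch. Actions that the policy of the epoch does not select at `s_t` have not
occurred, so that quantifying over all `a` is harmless. -/
def epochStart (st : ℕ → S) (act : ℕ → A) : ℕ → ℕ
  | 0 => 1
  | t + 1 =>
    if ∃ a, max 1 (visits st act 1 (epochStart st act t) (st (t + 1)) a) ≤
        visits st act (epochStart st act t) (t + 1) (st (t + 1)) a
    then t + 1 else epochStart st act t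

/-- The index `k` of the epoch that contains the time `t ≥ 1`. -/
def epochIdx (st : ℕ → S) (act : ℕ → A) (t : ℕ) : ℕ :=
  #{τ ∈ Icc 1 t | epochStart st act τ = τ}

/-- The start of the `k`-th epoch. -/
noncomputable def epochBegin (st : ℕ → S) (act : ℕ → A) (k : ℕ) : ℕ :=
  sInf {t | 1 ≤ t ∧ k ≤ epochIdx st act t}

/-- The end (exclusive) of the epoch that contains `τ`, truncated at the time `n > τ`. -/
def epochEnd (st : ℕ → S) (act : ℕ → A) : ℕ → ℕ → ℕ
  | 0, _ => 0
  | n + 1, τ =>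
    if epochStart st act n = epochStart st act τ then n + 1 else epochEnd st act n τ

/-- Two trajectories have the same states up to time `n` and the same actions before time `n`. -/
def AgreeUpTo (n : ℕ) (st : ℕ → S) (act : ℕ → A) (st' : ℕ → S) (act' : ℕ → A) : Prop :=
  (∀ τ ∈ Icc 1 n, st τ = st' τ) ∧ ∀ τ ∈ Ico 1 n, act τ = act' τ

lemma AgreeUpTo.mono {m n : ℕ} (h : AgreeUpTo n st act st' act') (hmn : m ≤ n) :
    AgreeUpTo m st act st' act' :=
  ⟨fun τ hτ => h.1 τ (Icc_subset_Icc_right hmn hτ),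
    fun τ hτ => h.2 τ (Ico_subset_Ico_right hmn hτ)⟩

lemma visits_add (t₀ t₁ t₂ : ℕ) (h01 : t₀ ≤ t₁) (h12 : t₁ ≤ t₂) (s : S) (a : A) :
    visits st act t₀ t₂ s a = visits st act t₀ t₁ s a + visits st act t₁ t₂ s a := by
  unfold visits
  rw [← Ico_union_Ico_eq_Ico h01 h12, filter_union, card_union_of_disjoint]
  exact disjoint_filter_filter (Ico_disjoint_Ico_consecutive t₀ t₁ t₂)

lemma visits_self (t : ℕ) (s : S) (a : A) : visits st act t t s a = 0 := by simp [visits]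

lemma visits_succ {t₀ t : ℕ} (h : t₀ ≤ t) (s : S) (a : A) :
    visits st act t₀ (t + 1) s a =
      visits st act t₀ t s a + if st t = s ∧ act t = a then 1 else 0 := by
  rw [visits_add t₀ t (t + 1) h t.le_succ]
  congr 1
  simp only [visits, Nat.Ico_succ_singleton, filter_singleton]
  split_ifs <;> simp

lemma visits_le (t₀ t : ℕ) (s : S) (a : A) : visits st act t₀ t s a ≤ t - t₀ := by
  simpa [visits] using card_filter_le (Ico t₀ t) fun τ => st τ = s ∧ act τ = a

lemma visits_congr {n : ℕ} (h : AgreeUpTo n st act st' act') {t₀ t : ℕ} (h0 : 1 ≤ t₀)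
    (ht : t ≤ n) (s : S) (a : A) : visits st act t₀ t s a = visits st' act' t₀ t s a := by
  unfold visits
  congr 1
  refine filter_congr fun τ hτ => ?_
  rw [mem_Ico] at hτ
  rw [h.1 τ (by rw [mem_Icc]; omega), h.2 τ (by rw [mem_Ico]; omega)]

lemma one_le_epochStart (t : ℕ) : 1 ≤ epochStart st act t := by
  induction t with
  | zero => exact le_rfl
  | succ t ih => rw [epochStart]; split_ifs <;> omega

lemma epochStart_le {t : ℕ} (ht : 1 ≤ t) : epochStart st act t ≤ t := by
  induction t with
  | zero => omega
  | succ t ih =>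
    rw [epochStart]
    split_ifs
    · exact le_rfl
    · rcases Nat.eq_zero_or_pos t with rfl | h
      · exact le_rfl
      · have := ih h; omega

lemma epochStart_one : epochStart st act 1 = 1 :=
  le_antisymm (epochStart_le le_rfl) (one_le_epochStart 1)

lemma epochStart_succ_eq_or (t : ℕ) :
    epochStart st act (t + 1) = t + 1 ∨ epochStart st act (t + 1) = epochStart st act t := by
  rw [epochStart]; split_ifs <;> simp

lemma epochStart_eq_of_le {t τ : ℕ} (h1 : epochStart st act t ≤ τ) (h2 : τ ≤ t) :
    epochStart st act τ = epochStart st act t := by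
  induction t with
  | zero => rw [Nat.le_zero.1 h2]
  | succ t ih =>
    rcases Nat.lt_or_ge t τ with h | h
    · rw [show τ = t + 1 by omega]
    · rcases epochStart_succ_eq_or (st := st) (act := act) t with h' | h'
      · omega
      · rw [h'] at h1 ⊢
        exact ih h1 h

lemma epochStart_congr {n : ℕ} (h : AgreeUpTo n st act st' act') {t : ℕ} (ht : t ≤ n) :
    epochStart st act t = epochStart st' act' t := by
  induction t with
  | zero => rfl
  | succ t ih =>
    have ih' := ih (by omega)
    have hle : epochStart st' act' t ≤ t + 1 := by
      rcases Nat.eq_zero_or_pos t with rfl | h'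
      · exact le_rfl
      · exact (epochStart_le h').trans t.le_succ
    rw [epochStart, epochStart, ih', h.1 (t + 1) (by rw [mem_Icc]; omega)]
    simp only [visits_congr h le_rfl (hle.trans ht),
      visits_congr h (one_le_epochStart (st := st') (act := act') t) ht]

lemma epochIdx_congr {n : ℕ} (h : AgreeUpTo n st act st' act') {t : ℕ} (ht : t ≤ n) :
    epochIdx st act t = epochIdx st' act' t := by
  unfold epochIdx
  congr 1
  refine filter_congr fun τ hτ => ?_
  rw [mem_Icc] at hτ
  rw [epochStart_congr h (hτ.2.trans ht)]

lemma epochIdx_mono : Monotone (epochIdx st act) := fun _ _ h =>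
  card_le_card (filter_subset_filter _ (Icc_subset_Icc_right h))

lemma epochIdx_one : epochIdx st act 1 = 1 := by
  simp [epochIdx, filter_singleton, epochStart_one]

lemma one_le_epochIdx {t : ℕ} (ht : 1 ≤ t) : 1 ≤ epochIdx st act t :=
  epochIdx_one.symm.le.trans (epochIdx_mono ht)

lemma epochIdx_succ (t : ℕ) : epochIdx st act (t + 1) =
    epochIdx st act t + if epochStart st act (t + 1) = t + 1 then 1 else 0 := by
  unfold epochIdx
  rw [← Finset.insert_Icc_right_eq_Icc_add_one (by omega), filter_insert]
  split_ifs
  · rw [card_insert_of_notMem (by simp)]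
  · rfl

lemma epochBegin_congr {n : ℕ} (h : AgreeUpTo n st act st' act') {k : ℕ} (hn : 1 ≤ n)
    (hk : k ≤ epochIdx st act n) : epochBegin st act k = epochBegin st' act' k := by
  have key : ∀ {σ σ' : ℕ → S} {α α' : ℕ → A}, AgreeUpTo n σ α σ' α' → k ≤ epochIdx σ α n →
      epochBegin σ' α' k ≤ epochBegin σ α k := by
    intro σ σ' α α' h hk
    have hmem := Nat.sInf_mem (s := {t | 1 ≤ t ∧ k ≤ epochIdx σ α t}) ⟨n, hn, hk⟩
    have hle : epochBegin σ α k ≤ n := Nat.sInf_le ⟨hn, hk⟩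
    refine Nat.sInf_le ⟨hmem.1, ?_⟩
    rw [← epochIdx_congr h hle]
    exact hmem.2
  have h' : AgreeUpTo n st' act' st act :=
    ⟨fun τ hτ => (h.1 τ hτ).symm, fun τ hτ => (h.2 τ hτ).symm⟩
  exact le_antisymm (key h' (by rwa [← epochIdx_congr h le_rfl])) (key h hk)

lemma epochEnd_congr {n : ℕ} (h : AgreeUpTo n st act st' act') {m τ : ℕ} (hm : m ≤ n + 1)
    (hτ : τ ≤ n) : epochEnd st act m τ = epochEnd st' act' m τ := by
  induction m with
  | zero => rfl
  | succ m ih =>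
    rw [epochEnd, epochEnd, ih (by omega), epochStart_congr h (by omega : m ≤ n),
      epochStart_congr h hτ]

/-- Truncating at a time of the last epoch does not change the ends of earlier epochs. -/
lemma epochEnd_eq_of_lt {n τ : ℕ} (hτ1 : 1 ≤ τ) (hτ : τ < epochStart st act n) {m : ℕ}
    (h1 : epochStart st act n ≤ m) (h2 : m ≤ n + 1) :
    epochEnd st act m τ = epochEnd st act (epochStart st act n) τ := by
  induction m with
  | zero => rw [Nat.le_zero.1 h1]
  | succ m ih =>
    rcases Nat.eq_or_lt_of_le h1 with h | h
    · rw [h]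
    · have hm : epochStart st act m = epochStart st act n := epochStart_eq_of_le (by omega) (by omega)
      have hne : epochStart st act m ≠ epochStart st act τ := by
        have := epochStart_le (st := st) (act := act) hτ1
        omega
      rw [epochEnd, if_neg hne]
      exact ih (by omega) (by omega)

lemma epochEnd_succ_of_ge {n τ : ℕ} (hτ : epochStart st act n ≤ τ) (h : τ ≤ n) :
    epochEnd st act (n + 1) τ = n + 1 := by
  rw [epochEnd, if_pos (epochStart_eq_of_le hτ h).symm]

/-! ### Epochs of a run -/

section Run

variable {δ d : ℝ} {tie : S → Finset A → A} {x : ℕ → S → ℝ} {tk : ℕ → ℕ}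
  (hrun : IsDUCRL2Run δ d tie st act x tk)

include hrun

lemma IsDUCRL2Run.le_tk {k : ℕ} (hk : 1 ≤ k) : k ≤ tk k := by
  induction k, hk using Nat.le_induction with
  | base => rw [hrun.first]
  | succ k hk ih => have := hrun.lt_next k hk; omega

lemma IsDUCRL2Run.tk_mono {j k : ℕ} (hj : 1 ≤ j) (hjk : j ≤ k) : tk j ≤ tk k := by
  induction k, hjk using Nat.le_induction with
  | base => exact le_rfl
  | succ k hjk ih => exact ih.trans (hrun.lt_next k (hj.trans hjk)).le

lemma IsDUCRL2Run.exists_epoch {t : ℕ} (ht : 1 ≤ t) : ∃ k, 1 ≤ k ∧ tk k ≤ t ∧ t < tk (k + 1) := by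
  induction t, ht using Nat.le_induction with
  | base =>
    have := hrun.lt_next 1 le_rfl
    exact ⟨1, le_rfl, hrun.first.le, by rwa [hrun.first] at this⟩
  | succ t ht ih =>
    obtain ⟨k, hk, h1, h2⟩ := ih
    rcases Nat.lt_or_ge (t + 1) (tk (k + 1)) with h | h
    · exact ⟨k, hk, by omega, h⟩
    · have := hrun.lt_next (k + 1) (by omega)
      exact ⟨k + 1, by omega, h, by omega⟩

/-- In the epoch `k` before time `t`, only the action of the policy occurs at a state. -/
lemma IsDUCRL2Run.visits_eq_zero {k : ℕ} (hk : 1 ≤ k) {t : ℕ} (ht : t ≤ tk (k + 1)) {s : S}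
    {a : A} (ha : a ≠ epochPolicy δ d tie st act x tk k s) : visits st act (tk k) t s a = 0 := by
  unfold visits
  rw [card_eq_zero, filter_eq_empty_iff]
  rintro τ hτ ⟨rfl, rfl⟩
  rw [mem_Ico] at hτ
  exact ha (hrun.act_eq k hk τ hτ.1 (by omega))

lemma IsDUCRL2Run.epochStart_eq {k t : ℕ} (hk : 1 ≤ k) (h1 : tk k ≤ t) (h2 : t < tk (k + 1)) :
    epochStart st act t = tk k := by
  have ht : 1 ≤ t := (hk.trans (hrun.le_tk hk)).trans h1
  induction t, ht using Nat.le_induction generalizing k with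
  | base =>
    have := hrun.le_tk hk
    rw [epochStart_one]; omega
  | succ t ht ih =>
    rcases Nat.lt_or_ge t (tk k) with h | h
    · -- a new epoch starts at `t + 1`
      have hk1 : k ≠ 1 := by rintro rfl; rw [hrun.first] at h; omega
      obtain ⟨j, rfl⟩ : ∃ j, k = j + 1 := ⟨k - 1, by omega⟩
      have hj : 1 ≤ j := by omega
      have hlt := hrun.lt_next j hj
      have hst := ih hj (by omega) h
      have hhalt := hrun.stops j hj
      have htk : tk (j + 1) = t + 1 := by omega
      unfold epochContinues at hhalt
      rw [htk, not_lt] at hhalt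
      rw [epochStart, if_pos, htk]
      rw [hst]
      exact ⟨_, hhalt⟩
    · have hst := ih hk h (by omega)
      rw [epochStart, if_neg, hst]
      rw [hst]
      rintro ⟨a, ha⟩
      by_cases hp : a = epochPolicy δ d tie st act x tk k (st (t + 1))
      · have hcont := hrun.continues k hk (t + 1) h1 h2
        unfold epochContinues at hcont
        rw [hp] at ha
        exact absurd hcont (not_lt.2 ha)
      · rw [hrun.visits_eq_zero hk h2.le hp] at ha
        have := le_max_left 1 (visits st act 1 (tk k) (st (t + 1)) a)
        omega

lemma IsDUCRL2Run.epochIdx_eq {k t : ℕ} (hk : 1 ≤ k) (h1 : tk k ≤ t) (h2 : t < tk (k + 1)) :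
    epochIdx st act t = k := by
  have ht : 1 ≤ t := (hk.trans (hrun.le_tk hk)).trans h1
  induction t, ht using Nat.le_induction generalizing k with
  | base =>
    have := hrun.le_tk hk
    rw [epochIdx_one]; omega
  | succ t ht ih =>
    rw [epochIdx_succ, hrun.epochStart_eq hk h1 h2]
    rcases Nat.lt_or_ge t (tk k) with h | h
    · have hk1 : k ≠ 1 := by rintro rfl; rw [hrun.first] at h; omega
      obtain ⟨j, rfl⟩ : ∃ j, k = j + 1 := ⟨k - 1, by omega⟩
      have hlt := hrun.lt_next j (by omega)
      rw [ih (k := j) (by omega) (by omega) h, if_pos (by omega)]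
    · rw [if_neg (by omega), ih hk h (by omega), add_zero]

lemma IsDUCRL2Run.epochBegin_eq {k : ℕ} (hk : 1 ≤ k) : epochBegin st act k = tk k := by
  have h1 : 1 ≤ tk k := hk.trans (hrun.le_tk hk)
  have hidx := hrun.epochIdx_eq hk le_rfl (hrun.lt_next k hk)
  apply le_antisymm (Nat.sInf_le (show _ ∧ _ from ⟨h1, hidx.symm.le⟩))
  refine le_csInf ⟨tk k, h1, hidx.symm.le⟩ ?_
  rintro t ⟨ht, hkt⟩
  by_contra! hlt
  obtain ⟨j, hj, h2, h3⟩ := hrun.exists_epoch ht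
  rw [hrun.epochIdx_eq hj h2 h3] at hkt
  have := hrun.tk_mono hk hkt
  omega

lemma IsDUCRL2Run.tk_epochIdx {t : ℕ} (ht : 1 ≤ t) :
    tk (epochIdx st act t) = epochStart st act t := by
  obtain ⟨k, hk, h1, h2⟩ := hrun.exists_epoch ht
  rw [hrun.epochIdx_eq hk h1 h2, hrun.epochStart_eq hk h1 h2]

lemma IsDUCRL2Run.lt_tk_epochIdx_succ {t : ℕ} (ht : 1 ≤ t) : t < tk (epochIdx st act t + 1) := by
  obtain ⟨k, hk, h1, h2⟩ := hrun.exists_epoch ht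
  rwa [hrun.epochIdx_eq hk h1 h2]

lemma IsDUCRL2Run.epochEnd_eq {k n τ : ℕ} (hk : 1 ≤ k) (h1 : tk k ≤ τ) (h2 : τ < tk (k + 1))
    (hn : tk (k + 1) ≤ n) : epochEnd st act n τ = tk (k + 1) := by
  have hτ := hrun.epochStart_eq hk h1 h2
  have h1k : 1 ≤ tk k := hk.trans (hrun.le_tk hk)
  induction n, hn using Nat.le_induction with
  | base =>
    obtain ⟨m, hm⟩ : ∃ m, tk (k + 1) = m + 1 := ⟨tk (k + 1) - 1, by omega⟩
    rw [hm, epochEnd, if_pos]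
    rw [hτ]
    exact hrun.epochStart_eq hk (by omega) (by omega)
  | succ n hn ih =>
    rw [epochEnd, if_neg, ih]
    obtain ⟨j, hj, h3, h4⟩ := hrun.exists_epoch (t := n) (by omega)
    have hkj : k + 1 ≤ j := by
      by_contra! hc
      have := hrun.tk_mono (j := j + 1) (k := k + 1) (by omega) (by omega)
      omega
    have := hrun.tk_mono (j := k + 1) (by omega) hkj
    rw [hrun.epochStart_eq hj h3 h4, hτ]
    omega

lemma IsDUCRL2Run.visits_lt {t : ℕ} (ht : 1 ≤ t) :
    visits st act (epochStart st act t) t (st t) (act t) <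
      max 1 (visits st act 1 (epochStart st act t) (st t) (act t)) := by
  obtain ⟨k, hk, h1, h2⟩ := hrun.exists_epoch ht
  rw [hrun.epochStart_eq hk h1 h2, hrun.act_eq k hk t h1 h2]
  exact hrun.continues k hk t h1 h2

end Run

end Epochs

section EpochSums

variable {S A : Type*} [Fintype S] [DecidableEq S] [Fintype A] [DecidableEq A]
variable {st : ℕ → S} {act : ℕ → A}

/-! ### Number of epochs, and sums over the steps of a run -/

lemma sum_visits (t : ℕ) : ∑ c : S × A, visits st act 1 (t + 1) c.1 c.2 = t := by
  induction t with
  | zero => simp [visits]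
  | succ t ih =>
    simp only [visits_succ (st := st) (act := act) (show 1 ≤ t + 1 by omega),
      Finset.sum_add_distrib, ih]
    congr 1
    rw [Finset.sum_eq_single (st (t + 1), act (t + 1))]
    · simp
    · rintro ⟨s, a⟩ - hne
      rw [if_neg]
      rintro ⟨rfl, rfl⟩
      exact hne rfl
    · simp

/-- Each epoch but the last doubles the count of some pair. -/
lemma IsDUCRL2Run.sum_doublings {δ d : ℝ} {tie : S → Finset A → A} {x : ℕ → S → ℝ} {tk : ℕ → ℕ}
    (hrun : IsDUCRL2Run δ d tie st act x tk) {k : ℕ} (hk : 1 ≤ k) :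
    ∃ n : S × A → ℕ, (k - 1 ≤ ∑ c, n c) ∧
      ∀ c, 2 ^ n c ≤ max 1 (2 * visits st act 1 (tk k) c.1 c.2) := by
  induction k, hk using Nat.le_induction with
  | base => exact ⟨0, by simp, fun c => by simp⟩
  | succ k hk ih =>
    obtain ⟨n, hn, hn2⟩ := ih
    have h1k : 1 ≤ tk k := hk.trans (hrun.le_tk hk)
    have hlt := hrun.lt_next k hk
    have hhalt := hrun.stops k hk
    unfold epochContinues at hhalt
    simp only [not_lt] at hhalt
    set c₀ : S × A := (st (tk (k + 1)), epochPolicy δ d tie st act x tk k (st (tk (k + 1))))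
    refine ⟨fun c => n c + if c = c₀ then 1 else 0, ?_, fun c => ?_⟩
    · rw [Finset.sum_add_distrib, Finset.sum_ite_eq' univ c₀]
      simp only [mem_univ, if_true]
      omega
    · have hadd := visits_add (st := st) (act := act) 1 (tk k) (tk (k + 1)) h1k hlt.le c.1 c.2
      have h2 := hn2 c
      by_cases hc : c = c₀
      · have h3 : max 1 (visits st act 1 (tk k) c.1 c.2) ≤
            visits st act (tk k) (tk (k + 1)) c.1 c.2 := by rw [hc]; exact hhalt
        simp only [hc, if_true, pow_succ]
        rw [← hc]
        rcases Nat.eq_zero_or_pos (visits st act 1 (tk k) c.1 c.2) with h0 | h0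
        · rw [h0] at h2 h3
          simp only [mul_zero] at h2
          omega
        · omega
      · simp only [hc, if_false, add_zero]
        omega

/-- The number of epochs that start up to time `T` is at most `SA log₂ (8T / SA)`. -/
lemma IsDUCRL2Run.epochIdx_le [Nonempty S] [Nonempty A] {δ d : ℝ} {tie : S → Finset A → A}
    {x : ℕ → S → ℝ} {tk : ℕ → ℕ} (hrun : IsDUCRL2Run δ d tie st act x tk) {T : ℕ} (hT : 1 ≤ T)
    (hSA : (Fintype.card S : ℝ) * Fintype.card A ≤ T) :
    (epochIdx st act T : ℝ) ≤ Fintype.card S * Fintype.card A *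
      Real.logb 2 (8 * T / ((Fintype.card S : ℝ) * Fintype.card A)) := by
  set k := epochIdx st act T with hkdef
  have hk : 1 ≤ k := one_le_epochIdx hT
  obtain ⟨n, hn, hn2⟩ := hrun.sum_doublings hk
  set m : ℝ := (Fintype.card S : ℝ) * Fintype.card A with hm
  have hm1 : (1 : ℝ) ≤ m := by
    have h1 : (1 : ℝ) ≤ Fintype.card S := by exact_mod_cast Fintype.card_pos
    have h2 : (1 : ℝ) ≤ Fintype.card A := by exact_mod_cast Fintype.card_pos
    nlinarith
  have hmc : ((Fintype.card (S × A) : ℕ) : ℝ) = m := by rw [Fintype.card_prod]; push_cast; rfl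
  have htk : tk k ≤ T := by rw [hrun.tk_epochIdx hT]; exact epochStart_le hT
  have h1k : 1 ≤ tk k := hk.trans (hrun.le_tk hk)
  set y : S × A → ℝ := fun c => 2 * visits st act 1 (tk k) c.1 c.2 + 1 with hy
  have hy0 : ∀ c, 0 < y c := fun c => by positivity
  have hysum : ∑ c, y c ≤ 3 * T := by
    have h1 : ∑ c : S × A, visits st act 1 (tk k) c.1 c.2 ≤ T := by
      obtain ⟨j, hj⟩ : ∃ j, tk k = j + 1 := ⟨tk k - 1, by omega⟩
      rw [hj, sum_visits]; omega
    have h2 : (∑ c : S × A, (visits st act 1 (tk k) c.1 c.2 : ℝ)) ≤ T := by exact_mod_cast h1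
    simp only [hy, Finset.sum_add_distrib, ← Finset.mul_sum, Finset.sum_const, card_univ,
      nsmul_eq_mul, hmc]
    linarith
  have hT0 : (0 : ℝ) < T := by exact_mod_cast hT
  have hl2 : 0 < Real.log 2 := Real.log_pos (by norm_num)
  -- tangent line of the logarithm at the average bound `3T / m`
  have hlog : ∀ c, n c * Real.log 2 ≤ Real.log (3 * T / m) + (y c * m / (3 * T) - 1) := by
    intro c
    have h1 : (2 : ℝ) ^ n c ≤ y c := by
      have h2 : 2 ^ n c ≤ 2 * visits st act 1 (tk k) c.1 c.2 + 1 := (hn2 c).trans (by omega)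
      simp only [hy]
      exact_mod_cast h2
    have h3 := Real.log_le_log (by positivity) h1
    rw [Real.log_pow] at h3
    have h4 : Real.log (y c) = Real.log (3 * T / m) + Real.log (y c * m / (3 * T)) := by
      rw [← Real.log_mul (by positivity) (by have := hy0 c; positivity)]
      congr 1; field_simp
    have h5 := Real.log_le_sub_one_of_pos (x := y c * m / (3 * T)) (by have := hy0 c; positivity)
    linarith
  have hsum : ((k : ℝ) - 1) * Real.log 2 ≤ m * Real.log (3 * T / m) := by
    have h1 : ((k : ℝ) - 1) ≤ ∑ c, (n c : ℝ) := by
      have : (k : ℝ) ≤ (∑ c, n c : ℕ) + 1 := by exact_mod_cast (by omega : k ≤ ∑ c, n c + 1)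
      push_cast at this; linarith
    have h2 : (∑ c, (n c : ℝ)) * Real.log 2 ≤
        ∑ c : S × A, (Real.log (3 * T / m) + (y c * m / (3 * T) - 1)) := by
      rw [Finset.sum_mul]; exact Finset.sum_le_sum fun c _ => hlog c
    have h3 : ∑ c : S × A, (Real.log (3 * T / m) + (y c * m / (3 * T) - 1)) =
        m * Real.log (3 * T / m) + ((∑ c, y c) * m / (3 * T) - m) := by
      simp only [Finset.sum_add_distrib, Finset.sum_sub_distrib, Finset.sum_const, card_univ,
        nsmul_eq_mul, hmc, mul_one, ← Finset.sum_div, ← Finset.sum_mul]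
    have h4 : (∑ c, y c) * m / (3 * T) ≤ m := by
      rw [div_le_iff₀ (by positivity)]
      nlinarith
    have := mul_le_mul_of_nonneg_right h1 hl2.le
    linarith
  have hfin : (k : ℝ) * Real.log 2 ≤ m * Real.log (8 * T / m) := by
    have h1 : Real.log (3 * T / m) + Real.log 2 = Real.log (6 * T / m) := by
      rw [← Real.log_mul (by positivity) (by norm_num)]
      congr 1; ring
    have h2 : Real.log (6 * T / m) ≤ Real.log (8 * T / m) :=
      Real.log_le_log (by positivity) (by gcongr; norm_num)
    nlinarith
  rw [Real.logb, ← mul_div_assoc, le_div_iff₀ hl2]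
  exact hfin

/-- The normalization `max 1 N_k` of the pair that occurs at time `t`, at the start of the epoch
`k` of `t`. -/
noncomputable def startCount (st : ℕ → S) (act : ℕ → A) (t : ℕ) : ℝ :=
  max 1 (visits st act 1 (epochStart st act t) (st t) (act t) : ℝ)

lemma one_le_startCount (t : ℕ) : 1 ≤ startCount st act t := le_max_left _ _

lemma startCount_le {t : ℕ} : startCount st act t ≤ epochStart st act t := by
  have h1 := one_le_epochStart (st := st) (act := act) t
  have h2 := visits_le (st := st) (act := act) 1 (epochStart st act t) (st t) (act t)
  refine max_le (by exact_mod_cast h1) ?_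
  exact_mod_cast (h2.trans (Nat.sub_le _ _))

lemma sum_comp_visits (f : ℕ → ℝ) (T : ℕ) :
    ∑ t ∈ Icc 1 T, f (visits st act 1 t (st t) (act t)) =
      ∑ c : S × A, ∑ i ∈ range (visits st act 1 (T + 1) c.1 c.2), f i := by
  induction T with
  | zero => simp [visits]
  | succ T ih =>
    rw [Finset.sum_Icc_succ_top (by omega), ih]
    have h : ∀ c : S × A, ∑ i ∈ range (visits st act 1 (T + 1 + 1) c.1 c.2), f i =
        ∑ i ∈ range (visits st act 1 (T + 1) c.1 c.2), f i +
          if c = (st (T + 1), act (T + 1)) then f (visits st act 1 (T + 1) c.1 c.2) else 0 := by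
      intro c
      rw [visits_succ (by omega)]
      by_cases hc : c = (st (T + 1), act (T + 1))
      · rw [if_pos ⟨by rw [hc], by rw [hc]⟩, if_pos hc, Finset.sum_range_succ]
      · rw [if_neg, if_neg hc, add_zero, add_zero]
        rintro ⟨h1, h2⟩
        exact hc (Prod.ext h1.symm h2.symm)
    simp only [h, Finset.sum_add_distrib, Finset.sum_ite_eq', mem_univ, if_true]

section

variable (hvis : ∀ t, 1 ≤ t → visits st act (epochStart st act t) t (st t) (act t) <
  max 1 (visits st act 1 (epochStart st act t) (st t) (act t)))

include hvis

lemma visits_succ_le_two_mul_startCount {t : ℕ} (ht : 1 ≤ t) :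
    (visits st act 1 t (st t) (act t) : ℝ) + 1 ≤ 2 * startCount st act t := by
  have h1 := visits_add (st := st) (act := act) 1 (epochStart st act t) t
    (one_le_epochStart t) (epochStart_le ht) (st t) (act t)
  have h2 := hvis t ht
  have h3 : visits st act 1 t (st t) (act t) + 1 ≤
      2 * max 1 (visits st act 1 (epochStart st act t) (st t) (act t)) := by omega
  unfold startCount
  exact_mod_cast h3

omit hvis in
lemma sum_inv_sqrt_range (n : ℕ) : ∑ i ∈ range n, 1 / √((i : ℝ) + 1) ≤ 2 * √n := by
  induction n with
  | zero => simp
  | succ n ih =>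
    rw [Finset.sum_range_succ]
    have h1 : 0 < √((n : ℝ) + 1) := Real.sqrt_pos.2 (by positivity)
    have h2 : 1 / √((n : ℝ) + 1) ≤ 2 * √((n : ℝ) + 1) - 2 * √n := by
      rw [div_le_iff₀ h1]
      have h3 := Real.mul_self_sqrt (show (0 : ℝ) ≤ (n : ℝ) + 1 by positivity)
      have h4 := Real.mul_self_sqrt (show (0 : ℝ) ≤ (n : ℝ) by positivity)
      nlinarith [sq_nonneg (√((n : ℝ) + 1) - √n)]
    push_cast
    linarith

lemma sum_inv_sqrt_startCount_le (T : ℕ) :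
    ∑ t ∈ Icc 1 T, 1 / √(startCount st act t) ≤
      2 * √2 * √((Fintype.card S : ℝ) * Fintype.card A * T) := by
  have h1 : ∀ t ∈ Icc 1 T, 1 / √(startCount st act t) ≤
      √2 * (1 / √((visits st act 1 t (st t) (act t) : ℝ) + 1)) := by
    intro t ht
    have h2 := visits_succ_le_two_mul_startCount hvis (mem_Icc.1 ht).1
    have h3 := Real.sqrt_le_sqrt h2
    rw [Real.sqrt_mul (by norm_num)] at h3
    have h4 : 0 < √(startCount st act t) :=
      Real.sqrt_pos.2 (zero_lt_one.trans_le (one_le_startCount t))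
    have h5 : 0 < √((visits st act 1 t (st t) (act t) : ℝ) + 1) := Real.sqrt_pos.2 (by positivity)
    rw [mul_one_div, div_le_div_iff₀ h4 h5]
    linarith
  refine (Finset.sum_le_sum h1).trans ?_
  rw [← Finset.mul_sum, sum_comp_visits (fun i => 1 / √((i : ℝ) + 1)) T]
  have h6 : ∑ c : S × A, ∑ i ∈ range (visits st act 1 (T + 1) c.1 c.2), 1 / √((i : ℝ) + 1) ≤
      ∑ c : S × A, 2 * √(visits st act 1 (T + 1) c.1 c.2) :=
    Finset.sum_le_sum fun c _ => sum_inv_sqrt_range _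
  have h7 : ∑ c : S × A, √(visits st act 1 (T + 1) c.1 c.2 : ℝ) ≤
      √((Fintype.card S : ℝ) * Fintype.card A * T) := by
    refine Real.le_sqrt_of_sq_le ?_
    refine (sq_sum_le_card_mul_sum_sq (s := univ)).trans ?_
    simp only [Real.sq_sqrt (Nat.cast_nonneg _), card_univ, Fintype.card_prod]
    have : (∑ c : S × A, (visits st act 1 (T + 1) c.1 c.2 : ℝ)) = T := by
      exact_mod_cast sum_visits (st := st) (act := act) T
    rw [this]; push_cast; exact le_rfl
  rw [← Finset.mul_sum] at h6
  have h8 : 0 ≤ √2 := Real.sqrt_nonneg 2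
  calc _ ≤ √2 * (2 * √((Fintype.card S : ℝ) * Fintype.card A * T)) := by gcongr; linarith
    _ = _ := by ring

/-- The number of steps whose pair has `max 1 N_k < z`. -/
lemma sum_startCount_lt_le (T : ℕ) {z : ℝ} (hz : 0 ≤ z) :
    ∑ t ∈ Icc 1 T, (if startCount st act t < z then (1 : ℝ) else 0) ≤
      (Fintype.card S : ℝ) * Fintype.card A * (2 * z) := by
  have h1 : ∀ t ∈ Icc 1 T, (if startCount st act t < z then (1 : ℝ) else 0) ≤
      (fun i : ℕ => if (i : ℝ) + 1 < 2 * z then (1 : ℝ) else 0)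
        (visits st act 1 t (st t) (act t)) := by
    intro t ht
    have h2 := visits_succ_le_two_mul_startCount hvis (mem_Icc.1 ht).1
    dsimp only
    split_ifs with h3 h4 <;> linarith
  refine (Finset.sum_le_sum h1).trans ?_
  rw [sum_comp_visits (fun i : ℕ => if (i : ℝ) + 1 < 2 * z then (1 : ℝ) else 0) T]
  have h3 : ∀ n : ℕ, ∑ i ∈ range n, (if (i : ℝ) + 1 < 2 * z then (1 : ℝ) else 0) ≤ 2 * z := by
    intro n
    rw [Finset.sum_boole]
    have h4 : #(filter (fun i : ℕ => (i : ℝ) + 1 < 2 * z) (range n)) ≤ #(range ⌊2 * z⌋₊) := by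
      refine card_le_card fun i hi => ?_
      rw [mem_filter] at hi
      rw [mem_range, Nat.lt_iff_add_one_le, Nat.le_floor_iff (by positivity)]
      push_cast
      exact hi.2.le
    rw [card_range] at h4
    exact (Nat.cast_le.2 h4).trans (Nat.floor_le (by positivity))
  refine (Finset.sum_le_sum fun c _ => h3 _).trans ?_
  simp [Fintype.card_prod]

lemma visits_epoch_le {T : ℕ} (hT : 1 ≤ T) (s : S) (a : A) :
    visits st act (epochStart st act T) (T + 1) s a ≤
      max 1 (visits st act 1 (epochStart st act T) s a) := by
  induction T, hT using Nat.le_induction with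
  | base =>
    rw [epochStart_one, visits_succ le_rfl, visits_self]
    split_ifs <;> simp
  | succ T hT ih =>
    have hle : epochStart st act (T + 1) ≤ T + 1 := epochStart_le (by omega)
    rw [visits_succ hle]
    split_ifs with h
    · have := hvis (T + 1) (by omega)
      rw [h.1, h.2] at this
      omega
    · rcases epochStart_succ_eq_or (st := st) (act := act) T with h' | h'
      · rw [h', visits_self]; exact Nat.zero_le _
      · rw [h']; exact ih

/-- Weighting each step by the number of completed epochs over `max 1 N_k`: a pair occurs at most
`max 1 N_k` times in an epoch. -/
lemma sum_epochIdx_div_startCount_le {T : ℕ} (hT : 1 ≤ T) :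
    ∑ t ∈ Icc 1 T, ((epochIdx st act t : ℝ) - 1) / startCount st act t ≤
      (Fintype.card S : ℝ) * Fintype.card A * ((epochIdx st act T : ℝ) ^ 2 / 2) := by
  have key : ∀ T, 1 ≤ T → ∀ s a, ∑ t ∈ Icc 1 T, (if st t = s ∧ act t = a then
      ((epochIdx st act t : ℝ) - 1) / startCount st act t else 0) ≤
      ((epochIdx st act T : ℝ) - 1) * ((epochIdx st act T : ℝ) - 2) / 2 +
        ((epochIdx st act T : ℝ) - 1) * ((visits st act (epochStart st act T) (T + 1) s a : ℝ) /
          max 1 (visits st act 1 (epochStart st act T) s a : ℝ)) := by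
    intro T hT s a
    induction T, hT using Nat.le_induction with
    | base => simp [epochIdx_one]
    | succ T hT ih =>
      rw [Finset.sum_Icc_succ_top (by omega)]
      have hle : epochStart st act (T + 1) ≤ T + 1 := epochStart_le (by omega)
      have hadd : (visits st act (epochStart st act (T + 1)) (T + 1 + 1) s a : ℝ) =
          visits st act (epochStart st act (T + 1)) (T + 1) s a +
            if st (T + 1) = s ∧ act (T + 1) = a then 1 else 0 := by
        rw [visits_succ hle]; push_cast; rfl
      have hnew : (if st (T + 1) = s ∧ act (T + 1) = a then
          ((epochIdx st act (T + 1) : ℝ) - 1) / startCount st act (T + 1) else 0) =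
          ((epochIdx st act (T + 1) : ℝ) - 1) * ((if st (T + 1) = s ∧ act (T + 1) = a then 1 else 0) /
            max 1 (visits st act 1 (epochStart st act (T + 1)) s a : ℝ)) := by
        split_ifs with h
        · rw [startCount, h.1, h.2]; ring
        · simp
      rw [hnew, hadd, add_div, mul_add, ← add_assoc]
      refine add_le_add_left (ih.trans ?_) _
      have hK : (1 : ℝ) ≤ epochIdx st act T := by exact_mod_cast one_le_epochIdx hT
      rcases epochStart_succ_eq_or (st := st) (act := act) T with h' | h'
      · have hidx : (epochIdx st act (T + 1) : ℝ) = epochIdx st act T + 1 := by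
          rw [epochIdx_succ, if_pos h']; push_cast; rfl
        rw [hidx, h', visits_self]
        have hratio : (visits st act (epochStart st act T) (T + 1) s a : ℝ) /
            max 1 (visits st act 1 (epochStart st act T) s a : ℝ) ≤ 1 := by
          rw [div_le_one (by positivity)]
          exact_mod_cast visits_epoch_le hvis hT s a
        have := mul_le_mul_of_nonneg_left hratio (sub_nonneg.2 hK)
        simp only [Nat.cast_zero, zero_div, mul_zero, add_zero]
        nlinarith
      · have hne : epochStart st act (T + 1) ≠ T + 1 := by
          have := epochStart_le (st := st) (act := act) hT
          omega
        rw [epochIdx_succ, if_neg hne, h', add_zero]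
  have hK : (1 : ℝ) ≤ epochIdx st act T := by exact_mod_cast one_le_epochIdx hT
  have hpair : ∀ c : S × A, ∑ t ∈ Icc 1 T, (if st t = c.1 ∧ act t = c.2 then
      ((epochIdx st act t : ℝ) - 1) / startCount st act t else 0) ≤
        (epochIdx st act T : ℝ) ^ 2 / 2 := by
    intro c
    refine (key T hT c.1 c.2).trans ?_
    have hratio : (visits st act (epochStart st act T) (T + 1) c.1 c.2 : ℝ) /
        max 1 (visits st act 1 (epochStart st act T) c.1 c.2 : ℝ) ≤ 1 := by
      rw [div_le_one (by positivity)]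
      exact_mod_cast visits_epoch_le hvis hT c.1 c.2
    have := mul_le_mul_of_nonneg_left hratio (sub_nonneg.2 hK)
    nlinarith
  calc ∑ t ∈ Icc 1 T, ((epochIdx st act t : ℝ) - 1) / startCount st act t
      = ∑ t ∈ Icc 1 T, ∑ c : S × A, (if st t = c.1 ∧ act t = c.2 then
          ((epochIdx st act t : ℝ) - 1) / startCount st act t else 0) := by
        refine Finset.sum_congr rfl fun t _ => ?_
        rw [Finset.sum_eq_single (st t, act t)]
        · simp
        · rintro ⟨s, a⟩ - hne
          rw [if_neg]
          rintro ⟨rfl, rfl⟩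
          exact hne rfl
        · simp
    _ = ∑ c : S × A, ∑ t ∈ Icc 1 T, (if st t = c.1 ∧ act t = c.2 then
          ((epochIdx st act t : ℝ) - 1) / startCount st act t else 0) := Finset.sum_comm
    _ ≤ ∑ _c : S × A, (epochIdx st act T : ℝ) ^ 2 / 2 := Finset.sum_le_sum fun c _ => hpair c
    _ = _ := by simp [Fintype.card_prod]

end

/-- Increments of a bias function that only changes at the start of an epoch. -/
lemma sum_bias_increments_le {W : ℕ → S → ℝ} {D : ℝ} (hW : ∀ t, 1 ≤ t → ∀ y, W t y ∈ Set.Icc 0 D)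
    (hconst : ∀ t, 1 ≤ t → epochStart st act (t + 1) = epochStart st act t → W (t + 1) = W t)
    {T : ℕ} (hT : 1 ≤ T) :
    ∑ t ∈ Icc 1 T, (W t (st (t + 1)) - W t (st t)) ≤ D * epochIdx st act T := by
  have key : ∑ t ∈ Icc 1 T, (W t (st (t + 1)) - W t (st t)) ≤
      D * (epochIdx st act T - 1) + W T (st (T + 1)) := by
    induction T, hT using Nat.le_induction with
    | base =>
      have := (hW 1 le_rfl (st 1)).1
      simp [epochIdx_one, this]
    | succ T hT ih =>
      rw [Finset.sum_Icc_succ_top (by omega)]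
      rcases epochStart_succ_eq_or (st := st) (act := act) T with h' | h'
      · have hidx : (epochIdx st act (T + 1) : ℝ) = epochIdx st act T + 1 := by
          rw [epochIdx_succ, if_pos h']; push_cast; rfl
        have h1 := (hW T hT (st (T + 1))).2
        have h2 := (hW (T + 1) (by omega) (st (T + 1))).1
        rw [hidx]
        linarith
      · have hne : epochStart st act (T + 1) ≠ T + 1 := by
          have := epochStart_le (st := st) (act := act) hT
          omega
        rw [epochIdx_succ, if_neg hne, add_zero, hconst T hT h']
        linarith
  have := (hW T hT (st (T + 1))).2
  linarith

end EpochSums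

/-! ### Decomposition of the reward estimate -/

/-- The total reward of a sequence, as a real number. -/
noncomputable def total (v : ℕ → ℝ≥0) : ℝ := (norm1 v).toReal

/-- The part of a reward sequence that is realized with delay less than `m`. -/
def headSum (m : ℕ) (v : ℕ → ℝ≥0) : ℝ := ∑ i ∈ range m, (v i : ℝ)

/-- The part of a reward sequence that is realized with delay at least `m`. -/
noncomputable def tailSum (m : ℕ) (v : ℕ → ℝ≥0) : ℝ := total v - headSum m v

lemma headSum_nonneg (m : ℕ) (v : ℕ → ℝ≥0) : 0 ≤ headSum m v :=
  Finset.sum_nonneg fun i _ => (v i).2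

lemma total_nonneg (v : ℕ → ℝ≥0) : 0 ≤ total v := ENNReal.toReal_nonneg

lemma headSum_le_total {v : ℕ → ℝ≥0} (hv : norm1 v ≤ 1) (m : ℕ) : headSum m v ≤ total v := by
  have h1 : ((∑ i ∈ range m, v i : ℝ≥0) : ℝ≥0∞) ≤ norm1 v := by
    push_cast
    exact ENNReal.sum_le_tsum _
  have h2 := ENNReal.toReal_mono (hv.trans_lt ENNReal.one_lt_top).ne h1
  rw [ENNReal.coe_toReal] at h2
  simpa only [headSum, total, NNReal.coe_sum] using h2

lemma total_le_one {v : ℕ → ℝ≥0} (hv : norm1 v ≤ 1) : total v ≤ 1 := by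
  simpa [total] using ENNReal.toReal_mono ENNReal.one_ne_top hv

lemma tailSum_nonneg {v : ℕ → ℝ≥0} (hv : norm1 v ≤ 1) (m : ℕ) : 0 ≤ tailSum m v :=
  sub_nonneg.2 (headSum_le_total hv m)

lemma tailSum_le_one {v : ℕ → ℝ≥0} (hv : norm1 v ≤ 1) (m : ℕ) : tailSum m v ≤ 1 := by
  have := headSum_nonneg m v
  have := total_le_one hv
  unfold tailSum
  linarith

lemma sum_Ico_shift (v : ℕ → ℝ≥0) (τ n : ℕ) :
    ∑ σ ∈ Ico τ n, (v (σ - τ) : ℝ) = headSum (n - τ) v := by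
  rw [Finset.sum_Ico_eq_sum_range]
  exact Finset.sum_congr rfl fun i _ => by rw [Nat.add_sub_cancel_left]

section Decomposition

variable {S A : Type*} [Fintype S] [DecidableEq S] [Fintype A] [DecidableEq A]
variable {st : ℕ → S} {act : ℕ → A} {δ d : ℝ} {tie : S → Finset A → A} {x : ℕ → S → ℝ}
  {tk : ℕ → ℕ} (hrun : IsDUCRL2Run δ d tie st act x tk)

include hrun

/-- Splitting a sum over all times before `tk k` into the epochs before `k`. -/
lemma IsDUCRL2Run.sum_epochs (f : ℕ → ℕ → ℝ) {k : ℕ} (hk : 1 ≤ k) :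
    ∑ j ∈ Ico 1 k, ∑ τ ∈ Ico (tk j) (tk (j + 1)), f j τ =
      ∑ τ ∈ Ico 1 (tk k), f (epochIdx st act τ) τ := by
  induction k, hk using Nat.le_induction with
  | base => simp [hrun.first]
  | succ k hk ih =>
    rw [Finset.sum_Ico_succ_top hk, ih,
      ← Finset.sum_Ico_consecutive (fun τ => f (epochIdx st act τ) τ)
        (hk.trans (hrun.le_tk hk)) (hrun.lt_next k hk).le]
    congr 1
    refine Finset.sum_congr rfl fun τ hτ => ?_
    rw [mem_Ico] at hτ
    rw [hrun.epochIdx_eq hk hτ.1 hτ.2]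

/-- The numerator of `rhat`, reorganized by the time at which the rewards are generated. -/
lemma IsDUCRL2Run.rhat_numerator_eq {ρ : ℕ → S → A → ℕ → ℝ≥0}
    (hx : ∀ τ s, x τ s = ∑ τ' ∈ Icc 1 τ, if st τ' = s then (ρ τ' s (act τ') (τ - τ') : ℝ) else 0)
    {k : ℕ} (hk : 1 ≤ k) (s : S) (a : A) :
    ∑ j ∈ Ico 1 k with 0 < visits st act (tk j) (tk (j + 1)) s a,
        ∑ τ ∈ Ico (tk j) (tk (j + 1)), x τ s =
      ∑ τ' ∈ Ico 1 (tk k), if st τ' = s then ∑ τ ∈ Ico τ' (tk k),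
        (if 0 < visits st act (tk (epochIdx st act τ)) (tk (epochIdx st act τ + 1)) s a
          then (ρ τ' s (act τ') (τ - τ') : ℝ) else 0) else 0 := by
  rw [Finset.sum_filter]
  have h1 := hrun.sum_epochs (fun j τ =>
    if 0 < visits st act (tk j) (tk (j + 1)) s a then x τ s else 0) hk
  have h2 : ∀ j, (∑ τ ∈ Ico (tk j) (tk (j + 1)),
      if 0 < visits st act (tk j) (tk (j + 1)) s a then x τ s else 0) =
      if 0 < visits st act (tk j) (tk (j + 1)) s a then
        ∑ τ ∈ Ico (tk j) (tk (j + 1)), x τ s else 0 := fun j => by split_ifs <;> simp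
  simp only [h2] at h1
  rw [h1]
  have h3 := Finset.sum_Ico_Ico_comm 1 (tk k) (fun τ' τ => if st τ' = s then
    (if 0 < visits st act (tk (epochIdx st act τ)) (tk (epochIdx st act τ + 1)) s a
          then (ρ τ' s (act τ') (τ - τ') : ℝ) else 0) else 0)
  have h4 : ∀ τ', (∑ τ ∈ Ico τ' (tk k), if st τ' = s then
    (if 0 < visits st act (tk (epochIdx st act τ)) (tk (epochIdx st act τ + 1)) s a
          then (ρ τ' s (act τ') (τ - τ') : ℝ) else 0) else 0) =
      if st τ' = s then ∑ τ ∈ Ico τ' (tk k),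
        (if 0 < visits st act (tk (epochIdx st act τ)) (tk (epochIdx st act τ + 1)) s a
          then (ρ τ' s (act τ') (τ - τ') : ℝ) else 0) else 0 := fun τ' => by
    split_ifs <;> simp
  simp only [h4] at h3
  rw [h3]
  refine Finset.sum_congr rfl fun τ _ => ?_
  rw [hx, show Ico 1 (τ + 1) = Icc 1 τ by ext i; simp only [mem_Ico, mem_Icc]; omega]
  split_ifs with h5
  · rfl
  · simp

/-- All components that are realized within the epoch of an occurrence of `(s, a)` are counted. -/
lemma IsDUCRL2Run.head_le_numerator {ρ : ℕ → S → A → ℕ → ℝ≥0}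
    (hx : ∀ τ s, x τ s = ∑ τ' ∈ Icc 1 τ, if st τ' = s then (ρ τ' s (act τ') (τ - τ') : ℝ) else 0)
    {k : ℕ} (hk : 1 ≤ k) (s : S) (a : A) :
    (∑ τ ∈ Ico 1 (tk k), if st τ = s ∧ act τ = a then
        headSum (epochEnd st act (tk k) τ - τ) (ρ τ s a) else 0) ≤
      ∑ j ∈ Ico 1 k with 0 < visits st act (tk j) (tk (j + 1)) s a,
        ∑ τ ∈ Ico (tk j) (tk (j + 1)), x τ s := by
  rw [hrun.rhat_numerator_eq hx hk]
  refine Finset.sum_le_sum fun τ hτ => ?_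
  rw [mem_Ico] at hτ
  by_cases h : st τ = s ∧ act τ = a
  · rw [if_pos h, if_pos h.1]
    obtain ⟨j, hj, h1, h2⟩ := hrun.exists_epoch hτ.1
    have hjk : j + 1 ≤ k := by
      by_contra! hc
      have := hrun.tk_mono hk (show k ≤ j by omega)
      omega
    have h3 := hrun.tk_mono (show 1 ≤ j + 1 by omega) hjk
    rw [hrun.epochEnd_eq hj h1 h2 h3, ← sum_Ico_shift]
    refine le_trans (Finset.sum_le_sum fun σ hσ => ?_)
      (Finset.sum_le_sum_of_subset_of_nonneg (Ico_subset_Ico_right h3)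
        fun σ _ _ => by split_ifs <;> simp)
    rw [mem_Ico] at hσ
    rw [hrun.epochIdx_eq hj (h1.trans hσ.1) hσ.2, if_pos, h.2]
    unfold visits
    exact card_pos.2 ⟨τ, by simp only [mem_filter, mem_Ico]; exact ⟨⟨h1, h2⟩, h⟩⟩
  · rw [if_neg h]
    split_ifs
    · exact Finset.sum_nonneg fun σ _ => by split_ifs <;> simp
    · exact le_rfl

/-- Apart from the rewards of `(s, a)` itself, only components that are realized after the epoch in
which they were generated can be counted for `(s, a)`. -/
lemma IsDUCRL2Run.numerator_le {ρ : ℕ → S → A → ℕ → ℝ≥0}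
    (hx : ∀ τ s, x τ s = ∑ τ' ∈ Icc 1 τ, if st τ' = s then (ρ τ' s (act τ') (τ - τ') : ℝ) else 0)
    (hρ : ∀ τ, 1 ≤ τ → ∀ s a, norm1 (ρ τ s a) ≤ 1) {k : ℕ} (hk : 1 ≤ k) (s : S) (a : A) :
    (∑ j ∈ Ico 1 k with 0 < visits st act (tk j) (tk (j + 1)) s a,
        ∑ τ ∈ Ico (tk j) (tk (j + 1)), x τ s) ≤
      (∑ τ ∈ Ico 1 (tk k), if st τ = s ∧ act τ = a then total (ρ τ s a) else 0) +
        ∑ τ ∈ Ico 1 (tk k), if st τ = s then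
          tailSum (epochEnd st act (tk k) τ - τ) (ρ τ s (act τ)) else 0 := by
  rw [hrun.rhat_numerator_eq hx hk, ← Finset.sum_add_distrib]
  refine Finset.sum_le_sum fun τ hτ => ?_
  rw [mem_Ico] at hτ
  by_cases hs : st τ = s
  swap
  · simp [hs]
  have hv := hρ τ hτ.1 s (act τ)
  have htail := tailSum_nonneg hv (epochEnd st act (tk k) τ - τ)
  rw [if_pos hs, if_pos hs]
  by_cases ha : act τ = a
  · rw [if_pos ⟨hs, ha⟩]
    have h1 : (∑ σ ∈ Ico τ (tk k), if 0 < visits st act (tk (epochIdx st act σ))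
        (tk (epochIdx st act σ + 1)) s a then (ρ τ s (act τ) (σ - τ) : ℝ) else 0) ≤
        ∑ σ ∈ Ico τ (tk k), (ρ τ s (act τ) (σ - τ) : ℝ) :=
      Finset.sum_le_sum fun σ _ => by split_ifs <;> simp
    rw [sum_Ico_shift] at h1
    have h2 := headSum_le_total hv (tk k - τ)
    rw [ha] at h1 h2 htail ⊢
    linarith
  · rw [if_neg (fun h => ha h.2), zero_add]
    obtain ⟨j, hj, h1, h2⟩ := hrun.exists_epoch hτ.1
    have hjk : j + 1 ≤ k := by
      by_contra! hc
      have := hrun.tk_mono hk (show k ≤ j by omega)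
      omega
    have h3 := hrun.tk_mono (show 1 ≤ j + 1 by omega) hjk
    rw [hrun.epochEnd_eq hj h1 h2 h3]
    have hzero : visits st act (tk j) (tk (j + 1)) s a = 0 := by
      refine hrun.visits_eq_zero hj le_rfl fun h => ha ?_
      rw [hrun.act_eq j hj τ h1 h2, hs, h]
    rw [← Finset.sum_Ico_consecutive _ h2.le h3]
    have h4 : (∑ σ ∈ Ico τ (tk (j + 1)), if 0 < visits st act (tk (epochIdx st act σ))
        (tk (epochIdx st act σ + 1)) s a then (ρ τ s (act τ) (σ - τ) : ℝ) else 0) = 0 := by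
      refine Finset.sum_eq_zero fun σ hσ => ?_
      rw [mem_Ico] at hσ
      rw [hrun.epochIdx_eq hj (h1.trans hσ.1) hσ.2, hzero, if_neg (lt_irrefl 0)]
    have h5 : (∑ σ ∈ Ico (tk (j + 1)) (tk k), if 0 < visits st act (tk (epochIdx st act σ))
        (tk (epochIdx st act σ + 1)) s a then (ρ τ s (act τ) (σ - τ) : ℝ) else 0) ≤
        ∑ σ ∈ Ico (tk (j + 1)) (tk k), (ρ τ s (act τ) (σ - τ) : ℝ) :=
      Finset.sum_le_sum fun σ _ => by split_ifs <;> simp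
    have h6 := Finset.sum_Ico_consecutive (fun σ => (ρ τ s (act τ) (σ - τ) : ℝ)) h2.le h3
    rw [sum_Ico_shift, sum_Ico_shift] at h6
    have h7 := headSum_le_total hv (tk k - τ)
    rw [h4, zero_add, tailSum]
    linarith

/-- A sequence of weights whose sums are at most `d` for every choice of the pairs, evaluated at the
delays until the end of the epoch, adds up to at most `d` per epoch. -/
lemma IsDUCRL2Run.sum_spill_le {w : ℕ → S → A → ℝ} (hw0 : ∀ m s a, 0 ≤ w m s a)
    (hw : ∀ (c : ℕ → S × A) n, ∑ m ∈ Icc 1 n, w m (c m).1 (c m).2 ≤ d) {k : ℕ} (hk : 1 ≤ k)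
    (s : S) (p : A → Prop) [DecidablePred p] (e : Finset ℕ)
    (he : ∀ j ∈ Ico 1 k, (∃ τ ∈ Ico (tk j) (tk (j + 1)), st τ = s ∧ p (act τ)) → j ∈ e) :
    (∑ τ ∈ Ico 1 (tk k), if st τ = s ∧ p (act τ) then
        w (epochEnd st act (tk k) τ - τ) s (act τ) else 0) ≤
      d * #e := by
  have h1 := hrun.sum_epochs (fun _ τ => if st τ = s ∧ p (act τ) then
        w (epochEnd st act (tk k) τ - τ) s (act τ) else 0) hk
  have hd : 0 ≤ d := by
    have ⟨a⟩ : Nonempty A := ⟨act 0⟩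
    simpa using hw (fun _ => (s, a)) 0
  have h2 : ∑ j ∈ Ico 1 k, (if j ∈ e then d else 0) ≤ d * #e := by
    rw [Finset.sum_ite_mem, Finset.sum_const, nsmul_eq_mul, mul_comm]
    exact mul_le_mul_of_nonneg_left (by exact_mod_cast card_le_card inter_subset_right) hd
  rw [← h1]
  refine le_trans (Finset.sum_le_sum fun j hj => ?_) h2
  have hej := he j hj
  rw [mem_Ico] at hj
  have h3 := hrun.tk_mono (show 1 ≤ j + 1 by omega) (show j + 1 ≤ k by omega)
  by_cases hex : ∃ τ ∈ Ico (tk j) (tk (j + 1)), st τ = s ∧ p (act τ)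
  · rw [if_pos (hej hex)]
    have h4 : (∑ τ ∈ Ico (tk j) (tk (j + 1)), if st τ = s ∧ p (act τ) then
        w (epochEnd st act (tk k) τ - τ) s (act τ) else 0) ≤
        ∑ τ ∈ Ico (tk j) (tk (j + 1)), w (tk (j + 1) - τ) s (act τ) := by
      refine Finset.sum_le_sum fun τ hτ => ?_
      rw [mem_Ico] at hτ
      rw [hrun.epochEnd_eq hj.1 hτ.1 hτ.2 h3]
      split_ifs
      · exact le_rfl
      · exact hw0 _ _ _
    have h5 : ∑ τ ∈ Ico (tk j) (tk (j + 1)), w (tk (j + 1) - τ) s (act τ) =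
        ∑ m ∈ Icc 1 (tk (j + 1) - tk j), w m s (act (tk (j + 1) - m)) := by
      have := hrun.lt_next j hj.1
      refine Finset.sum_nbij' (fun τ => tk (j + 1) - τ) (fun m => tk (j + 1) - m) ?_ ?_ ?_ ?_ ?_
      · intro τ hτ; rw [mem_Ico] at hτ; rw [mem_Icc]; omega
      · intro m hm; rw [mem_Icc] at hm; rw [mem_Ico]; omega
      · intro τ hτ; rw [mem_Ico] at hτ; omega
      · intro m hm; rw [mem_Icc] at hm; omega
      · intro τ hτ
        rw [mem_Ico] at hτ
        rw [show tk (j + 1) - (tk (j + 1) - τ) = τ by omega]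
    rw [h5] at h4
    have h6 := hw (fun m => (s, act (tk (j + 1) - m))) (tk (j + 1) - tk j)
    linarith
  · rw [Finset.sum_eq_zero]
    · split_ifs
      · exact hd
      · exact le_rfl
    · intro τ hτ
      rw [if_neg fun h => hex ⟨τ, hτ, h⟩]

lemma IsDUCRL2Run.sum_own_spill_le {w : ℕ → S → A → ℝ} (hw0 : ∀ m s a, 0 ≤ w m s a)
    (hw : ∀ (c : ℕ → S × A) n, ∑ m ∈ Icc 1 n, w m (c m).1 (c m).2 ≤ d) {k : ℕ} (hk : 1 ≤ k)
    (s : S) (a : A) :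
    (∑ τ ∈ Ico 1 (tk k), if st τ = s ∧ act τ = a then
        w (epochEnd st act (tk k) τ - τ) s a else 0) ≤ d * countE st act tk k s a := by
  refine le_trans (le_of_eq (Finset.sum_congr rfl fun τ _ => ?_))
    (hrun.sum_spill_le hw0 hw hk s (fun b => b = a)
      {j ∈ Ico 1 k | 0 < visits st act (tk j) (tk (j + 1)) s a} fun j hj hex => ?_)
  · split_ifs with h3
    · rw [h3.2]
    · rfl
  · obtain ⟨τ, hτ, h⟩ := hex
    rw [mem_filter]
    exact ⟨hj, card_pos.2 ⟨τ, mem_filter.2 ⟨hτ, h⟩⟩⟩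

lemma IsDUCRL2Run.sum_all_spill_le {w : ℕ → S → A → ℝ} (hw0 : ∀ m s a, 0 ≤ w m s a)
    (hw : ∀ (c : ℕ → S × A) n, ∑ m ∈ Icc 1 n, w m (c m).1 (c m).2 ≤ d) {k : ℕ} (hk : 1 ≤ k)
    (s : S) :
    (∑ τ ∈ Ico 1 (tk k), if st τ = s then
        w (epochEnd st act (tk k) τ - τ) s (act τ) else 0) ≤ d * (k - 1) := by
  have h := hrun.sum_spill_le hw0 hw hk s (fun _ => True) (Ico 1 k) fun j hj _ => hj
  simp only [and_true] at h
  rw [Nat.card_Ico, Nat.cast_sub hk, Nat.cast_one] at h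
  exact h

lemma IsDUCRL2Run.countE_le {k : ℕ} (hk : 1 ≤ k) (s : S) (a : A) :
    (countE st act tk k s a : ℝ) ≤ k - 1 := by
  have h2 := card_filter_le (Ico 1 k) fun j => 0 < visits st act (tk j) (tk (j + 1)) s a
  rw [Nat.card_Ico] at h2
  have h3 : ((k - 1 : ℕ) : ℝ) = k - 1 := by rw [Nat.cast_sub hk]; simp
  rw [← h3]
  exact_mod_cast h2

end Decomposition

/-! ### Histories -/

section Histories

variable {S A : Type*} [Fintype S] [DecidableEq S] [Fintype A] [DecidableEq A]
variable {Ω : Type*} {st : ℕ → Ω → S} {act : ℕ → Ω → A}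

/-- The event that the trajectory up to time `n` (without the action at time `n`) is that of the
given sequences. -/
def histSet (st : ℕ → Ω → S) (act : ℕ → Ω → A) (σ : ℕ → S) (α : ℕ → A) (n : ℕ) : Set Ω :=
  {ω | AgreeUpTo n (fun t => st t ω) (fun t => act t ω) σ α}

/-- The trajectory up to time `n`, as an element of a finite type. -/
def histMap (st : ℕ → Ω → S) (act : ℕ → Ω → A) (n : ℕ) (ω : Ω) :
    (Icc 1 n → S) × (Ico 1 n → A) :=
  (fun τ => st τ ω, fun τ => act τ ω)

lemma preimage_histMap (n : ℕ) (ω₀ : Ω) :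
    histMap st act n ⁻¹' {histMap st act n ω₀} =
      histSet st act (fun t => st t ω₀) (fun t => act t ω₀) n := by
  ext ω
  simp only [Set.mem_preimage, Set.mem_singleton_iff, histMap, histSet, Prod.mk.injEq,
    funext_iff, Subtype.forall, AgreeUpTo, Set.mem_ofPred_eq]

lemma histSet_succ (σ : ℕ → S) (α : ℕ → A) {n : ℕ} (hn : 1 ≤ n) :
    histSet st act σ α (n + 1) =
      histSet st act σ α n ∩ {ω | act n ω = α n} ∩ {ω | st (n + 1) ω = σ (n + 1)} := by
  ext ω
  simp only [histSet, AgreeUpTo, Set.mem_ofPred_eq, Set.mem_inter_iff, mem_Icc, mem_Ico]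
  constructor
  · rintro ⟨h1, h2⟩
    exact ⟨⟨⟨fun τ hτ => h1 τ ⟨hτ.1, by omega⟩, fun τ hτ => h2 τ ⟨hτ.1, by omega⟩⟩,
      h2 n ⟨hn, by omega⟩⟩, h1 (n + 1) ⟨by omega, le_rfl⟩⟩
  · rintro ⟨⟨⟨h1, h2⟩, h3⟩, h4⟩
    refine ⟨fun τ hτ => ?_, fun τ hτ => ?_⟩
    · rcases Nat.eq_or_lt_of_le hτ.2 with rfl | h
      · exact h4
      · exact h1 τ ⟨hτ.1, by omega⟩
    · rcases Nat.eq_or_lt_of_le (Nat.le_of_lt_succ hτ.2) with rfl | h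
      · exact h3
      · exact h2 τ ⟨hτ.1, h⟩

lemma measurableSet_histSet {m : MeasurableSpace Ω} {n : ℕ}
    (hst : ∀ τ ∈ Icc 1 n, ∀ s, MeasurableSet[m] {ω | st τ ω = s})
    (hact : ∀ τ ∈ Ico 1 n, ∀ a, MeasurableSet[m] {ω | act τ ω = a}) (σ : ℕ → S) (α : ℕ → A) :
    MeasurableSet[m] (histSet st act σ α n) := by
  have : histSet st act σ α n =
      (⋂ τ ∈ Icc 1 n, {ω | st τ ω = σ τ}) ∩ ⋂ τ ∈ Ico 1 n, {ω | act τ ω = α τ} := by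
    ext ω
    simp only [histSet, AgreeUpTo, Set.mem_ofPred_eq, Set.mem_inter_iff, Set.mem_iInter]
  rw [this]
  exact (Finset.measurableSet_biInter _ fun τ hτ => hst τ hτ _).inter
    (Finset.measurableSet_biInter _ fun τ hτ => hact τ hτ _)

/-- A function is measurable if it is so on each history. -/
lemma measurable_of_histSet {γ : Type*} [MeasurableSpace γ] {m : MeasurableSpace Ω} {n : ℕ}
    (hst : ∀ τ ∈ Icc 1 n, ∀ s, MeasurableSet[m] {ω | st τ ω = s})
    (hact : ∀ τ ∈ Ico 1 n, ∀ a, MeasurableSet[m] {ω | act τ ω = a}) {f : Ω → γ}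
    (hf : ∀ σ α, ∃ g : Ω → γ, Measurable[m] g ∧ ∀ ω ∈ histSet st act σ α n, f ω = g ω) :
    Measurable[m] f := by
  intro B hB
  have : f ⁻¹' B = ⋃ y, histMap st act n ⁻¹' {y} ∩ f ⁻¹' B := by
    ext ω; simp
  rw [this]
  refine MeasurableSet.iUnion fun y => ?_
  by_cases hy : ∃ ω₀, histMap st act n ω₀ = y
  · obtain ⟨ω₀, rfl⟩ := hy
    rw [preimage_histMap]
    obtain ⟨g, hg, hfg⟩ := hf (fun t => st t ω₀) (fun t => act t ω₀)
    have h2 : histSet st act (fun t => st t ω₀) (fun t => act t ω₀) n ∩ f ⁻¹' B =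
        histSet st act (fun t => st t ω₀) (fun t => act t ω₀) n ∩ g ⁻¹' B := by
      ext ω
      simp only [Set.mem_inter_iff, Set.mem_preimage]
      exact and_congr_right fun h => by rw [hfg ω h]
    rw [h2]
    exact (measurableSet_histSet hst hact _ _).inter (hg hB)
  · have h2 : histMap st act n ⁻¹' {y} = ∅ := by
      ext ω
      simp only [Set.mem_preimage, Set.mem_singleton_iff, Set.mem_empty_iff_false, iff_false]
      exact fun h => hy ⟨ω, h⟩
    rw [h2, Set.empty_inter]
    exact MeasurableSet.empty

/-- Integrals may be compared history by history. -/
lemma lintegral_le_of_histSet {mΩ : MeasurableSpace Ω} {μ : Measure Ω} {n : ℕ}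
    (hst : ∀ τ s, MeasurableSet {ω | st τ ω = s}) (hact : ∀ τ a, MeasurableSet {ω | act τ ω = a})
    {f g : Ω → ℝ≥0∞}
    (h : ∀ σ α, ∫⁻ ω in histSet st act σ α n, f ω ∂μ ≤ ∫⁻ ω in histSet st act σ α n, g ω ∂μ) :
    ∫⁻ ω, f ω ∂μ ≤ ∫⁻ ω, g ω ∂μ := by
  have hmeas : ∀ y, MeasurableSet (histMap st act n ⁻¹' {y}) := by
    intro y
    by_cases hy : ∃ ω₀, histMap st act n ω₀ = y
    · obtain ⟨ω₀, rfl⟩ := hy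
      rw [preimage_histMap]
      exact measurableSet_histSet (fun τ _ => hst τ) (fun τ _ => hact τ) _ _
    · have h2 : histMap st act n ⁻¹' {y} = ∅ := by
        ext ω
        simp only [Set.mem_preimage, Set.mem_singleton_iff, Set.mem_empty_iff_false, iff_false]
        exact fun h => hy ⟨ω, h⟩
      rw [h2]
      exact MeasurableSet.empty
  have hdisj : Pairwise (Function.onFun Disjoint fun y => histMap st act n ⁻¹' {y}) := by
    intro y y' hyy'
    exact Disjoint.preimage _ (by simpa using hyy')
  have hsplit : ∀ f : Ω → ℝ≥0∞,
      ∫⁻ ω, f ω ∂μ = ∑' y, ∫⁻ ω in histMap st act n ⁻¹' {y}, f ω ∂μ := by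
    intro f
    rw [← lintegral_iUnion hmeas hdisj, show (⋃ y, histMap st act n ⁻¹' {y}) = Set.univ by
      ext ω; simp, Measure.restrict_univ]
  rw [hsplit f, hsplit g]
  refine ENNReal.tsum_le_tsum fun y => ?_
  by_cases hy : ∃ ω₀, histMap st act n ω₀ = y
  · obtain ⟨ω₀, rfl⟩ := hy
    rw [preimage_histMap]
    exact h _ _
  · have h2 : histMap st act n ⁻¹' {y} = ∅ := by
      ext ω
      simp only [Set.mem_preimage, Set.mem_singleton_iff, Set.mem_empty_iff_false, iff_false]
      exact fun h => hy ⟨ω, h⟩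
    rw [h2]
    simp

/-- Evaluating a family of measurable functions at a random state and action. -/
lemma measurable_at_pair {γ : Type*} [MeasurableSpace γ] {m : MeasurableSpace Ω} {X : Ω → S}
    {Y : Ω → A} (hX : ∀ s, MeasurableSet[m] {ω | X ω = s}) (hY : ∀ a, MeasurableSet[m] {ω | Y ω = a})
    {G : S → A → Ω → γ} (hG : ∀ s a, Measurable[m] (G s a)) :
    Measurable[m] fun ω => G (X ω) (Y ω) ω := by
  intro B hB
  have : (fun ω => G (X ω) (Y ω) ω) ⁻¹' B =
      ⋃ s, ⋃ a, {ω | X ω = s} ∩ {ω | Y ω = a} ∩ G s a ⁻¹' B := by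
    ext ω; simp
  rw [this]
  exact MeasurableSet.iUnion fun s => MeasurableSet.iUnion fun a =>
    ((hX s).inter (hY a)).inter (hG s a hB)

end Histories

/-! ### The interaction as a stochastic process -/

section Interaction

variable {S A : Type*} [Fintype S] [DecidableEq S] [Fintype A] [DecidableEq A]
variable {Ω : Type*} [mΩ : MeasurableSpace Ω] {M : MDP S A} {s₁ : S} {μ : Measure Ω}
  {r : ℕ → S → A → Ω → ℕ → ℝ≥0} {st : ℕ → Ω → S} {act : ℕ → Ω → A}

/-- The information in the reward sequences generated before time `n`. -/
abbrev rewardsBefore (r : ℕ → S → A → Ω → ℕ → ℝ≥0) (n : ℕ) : MeasurableSpace Ω :=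
  ⨆ τ ∈ Ico 1 n, rewardSigma r τ

lemma measurable_rewardSigma (t : ℕ) (s : S) (a : A) :
    @Measurable _ _ (rewardSigma r t) _ (r t s a) :=
  (comap_measurable (r t s a)).mono (le_iSup₂_of_le s a le_rfl) le_rfl

lemma rewardSigma_le (hm : ∀ t s a, Measurable (r t s a)) (t : ℕ) : rewardSigma r t ≤ mΩ :=
  iSup₂_le fun s a => (hm t s a).comap_le

lemma rewardSigma_le_rewardsBefore {τ n : ℕ} (h1 : 1 ≤ τ) (h2 : τ < n) :
    rewardSigma r τ ≤ rewardsBefore r n :=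
  le_iSup₂_of_le τ (mem_Ico.2 ⟨h1, h2⟩) le_rfl

lemma rewardsBefore_mono {m n : ℕ} (h : m ≤ n) : rewardsBefore r m ≤ rewardsBefore r n :=
  iSup₂_le fun τ hτ => by
    rw [mem_Ico] at hτ
    exact rewardSigma_le_rewardsBefore hτ.1 (hτ.2.trans_le h)

lemma rewardsBefore_le_pastSigma {m n : ℕ} (h : m ≤ n) :
    rewardsBefore r m ≤ pastSigma r st act n :=
  (rewardsBefore_mono h).trans le_sup_right

lemma measurableSet_st_pastSigma {τ n : ℕ} (h1 : 1 ≤ τ) (h2 : τ ≤ n) (s : S) :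
    MeasurableSet[pastSigma r st act n] {ω | st τ ω = s} := by
  have h : MeasurableSpace.comap (st τ) ⊤ ≤ pastSigma r st act n :=
    le_sup_of_le_left (le_iSup₂_of_le τ (mem_Icc.2 ⟨h1, h2⟩) le_sup_left)
  exact h _ ⟨{s}, trivial, rfl⟩

lemma measurableSet_act_pastSigma {τ n : ℕ} (h1 : 1 ≤ τ) (h2 : τ ≤ n) (a : A) :
    MeasurableSet[pastSigma r st act n] {ω | act τ ω = a} := by
  have h : MeasurableSpace.comap (act τ) ⊤ ≤ pastSigma r st act n :=
    le_sup_of_le_left (le_iSup₂_of_le τ (mem_Icc.2 ⟨h1, h2⟩) le_sup_right)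
  exact h _ ⟨{a}, trivial, rfl⟩

lemma measurableSet_histSet_pastSigma (σ : ℕ → S) (α : ℕ → A) (n : ℕ) :
    MeasurableSet[pastSigma r st act n] (histSet st act σ α n) :=
  measurableSet_histSet
    (fun _ hτ s => measurableSet_st_pastSigma (mem_Icc.1 hτ).1 (mem_Icc.1 hτ).2 s)
    (fun _ hτ a => measurableSet_act_pastSigma (mem_Ico.1 hτ).1 (mem_Ico.1 hτ).2.le a) σ α

lemma comap_top_le {γ : Type*} [Finite γ] {X : Ω → γ} (h : ∀ y, MeasurableSet {ω | X ω = y}) :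
    MeasurableSpace.comap X ⊤ ≤ mΩ := by
  rintro _ ⟨B, -, rfl⟩
  have : X ⁻¹' B = ⋃ y ∈ B, {ω | X ω = y} := by ext ω; simp
  rw [this]
  exact MeasurableSet.biUnion (Set.to_countable B) fun y _ => h y

section

variable (hint : IsInteraction M s₁ μ r st act) (hm : ∀ t s a, Measurable (r t s a))

include hint hm

lemma IsInteraction.pastSigma_le (n : ℕ) : pastSigma r st act n ≤ mΩ :=
  sup_le (iSup₂_le fun _ _ => sup_le (comap_top_le (hint.meas_st _))
    (comap_top_le (hint.meas_act _)))
    (iSup₂_le fun _ _ => rewardSigma_le hm _)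

/-- Integrating out the next state. -/
lemma IsInteraction.lintegral_next_state [IsProbabilityMeasure μ] {t : ℕ} (ht : 1 ≤ t) (s' : S)
    {f : Ω → ℝ≥0∞} (hf : Measurable[pastSigma r st act t ⊔ rewardSigma r t] f) :
    ∫⁻ ω in {ω | st (t + 1) ω = s'}, f ω ∂μ =
      ∫⁻ ω, ENNReal.ofReal (M.p (st t ω) (act t ω) s') * f ω ∂μ := by
  have hle : pastSigma r st act t ⊔ rewardSigma r t ≤ mΩ :=
    sup_le (hint.pastSigma_le hm t) (rewardSigma_le hm t)
  set p : Ω → ℝ≥0∞ := fun ω => ENNReal.ofReal (M.p (st t ω) (act t ω) s') with hp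
  have hpm' : Measurable fun ω => M.p (st t ω) (act t ω) s' :=
    measurable_at_pair (G := fun s a _ => M.p s a s') (hint.meas_st t) (hint.meas_act t)
      fun s a => measurable_const
  have hpm : Measurable p := hpm'.ennreal_ofReal
  have hp1 : ∀ ω, M.p (st t ω) (act t ω) s' ∈ Set.Icc (0 : ℝ) 1 := fun ω =>
    ⟨(M.p_mem _ _).1 _, by
      rw [← (M.p_mem (st t ω) (act t ω)).2]
      exact Finset.single_le_sum (fun y _ => (M.p_mem _ _).1 y) (mem_univ s')⟩
  have hpint : Integrable (fun ω => M.p (st t ω) (act t ω) s') μ :=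
    Integrable.of_bound hpm'.aestronglyMeasurable 1 (Eventually.of_forall fun ω => by
      rw [Real.norm_eq_abs, abs_of_nonneg (hp1 ω).1]; exact (hp1 ω).2)
  have hmeq : (μ.restrict {ω | st (t + 1) ω = s'}).trim hle = (μ.withDensity p).trim hle := by
    refine @Measure.ext _ (pastSigma r st act t ⊔ rewardSigma r t) _ _ fun G hG => ?_
    have hG' := hle G hG
    rw [trim_measurableSet_eq hle hG, trim_measurableSet_eq hle hG, withDensity_apply _ hG',
      Measure.restrict_apply hG']
    have hB := hint.meas_st (t + 1) s'
    have h1 := setIntegral_condExp (μ := μ) hle (f := Set.indicator {ω | st (t + 1) ω = s'}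
      (fun _ => (1 : ℝ))) ((integrable_const 1).indicator hB) hG
    rw [setIntegral_congr_ae (g := fun ω => M.p (st t ω) (act t ω) s') hG'
      ((hint.trans t ht s').mono fun ω h _ => h), integral_indicator hB,
      Measure.restrict_restrict hB, setIntegral_const, smul_eq_mul, mul_one] at h1
    have h2 : ENNReal.ofReal (∫ ω in G, M.p (st t ω) (act t ω) s' ∂μ) = ∫⁻ ω in G, p ω ∂μ :=
      ofReal_integral_eq_lintegral_ofReal hpint.restrict (Eventually.of_forall fun ω => (hp1 ω).1)
    rw [← h2, h1, Measure.real, ENNReal.ofReal_toReal (measure_ne_top _ _), Set.inter_comm]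
  rw [← lintegral_trim hle hf, hmeq, lintegral_trim hle hf,
    lintegral_withDensity_eq_lintegral_mul _ hpm (hf.mono hle le_rfl)]
  rfl

/-- The rewards generated at time `t` are independent of the past. -/
lemma IsInteraction.lintegral_fresh {t : ℕ} (ht : 1 ≤ t) {f g : Ω → ℝ≥0∞}
    (hf : Measurable[pastSigma r st act t] f) (hg : Measurable[rewardSigma r t] g) :
    ∫⁻ ω, f ω * g ω ∂μ = (∫⁻ ω, f ω ∂μ) * ∫⁻ ω, g ω ∂μ :=
  lintegral_mul_eq_lintegral_mul_lintegral_of_independent_measurableSpace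
    (hint.pastSigma_le hm t) (rewardSigma_le hm t) (hint.fresh t ht).symm hf hg

end

/-- Up to null sets, on each history the action is a function of the rewards that were generated
before the present epoch. -/
def PolicyPredictable (μ : Measure Ω) (r : ℕ → S → A → Ω → ℕ → ℝ≥0) (st : ℕ → Ω → S)
    (act : ℕ → Ω → A) : Prop :=
  ∀ (σ : ℕ → S) (α : ℕ → A) (n : ℕ), 1 ≤ n → ∀ b, ∃ E,
    MeasurableSet[rewardsBefore r (epochStart σ α n)] E ∧
      ∀ᵐ ω ∂μ, ω ∈ histSet st act σ α n → (act n ω = b ↔ ω ∈ E)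

section

variable [IsProbabilityMeasure μ] (hint : IsInteraction M s₁ μ r st act)
  (hm : ∀ t s a, Measurable (r t s a)) (hpol : PolicyPredictable μ r st act)

include hint hm hpol

/-- One step of the decoupling: the next state and action contribute a constant factor and an event
that is determined by the rewards before the epoch. -/
lemma IsInteraction.lintegral_histSet_succ {σ : ℕ → S} {α : ℕ → A} {n : ℕ} (hn : 1 ≤ n) :
    ∃ E, MeasurableSet[rewardsBefore r (epochStart σ α n)] E ∧
      ∀ f : Ω → ℝ≥0∞, Measurable[pastSigma r st act n ⊔ rewardSigma r n] f →
        ∫⁻ ω in histSet st act σ α (n + 1), f ω ∂μ =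
          ENNReal.ofReal (M.p (σ n) (α n) (σ (n + 1))) *
            ∫⁻ ω in histSet st act σ α n, E.indicator f ω ∂μ := by
  obtain ⟨E, hE, hEact⟩ := hpol σ α n hn (α n)
  refine ⟨E, hE, fun f hf => ?_⟩
  have hle : pastSigma r st act n ⊔ rewardSigma r n ≤ mΩ :=
    sup_le (hint.pastSigma_le hm n) (rewardSigma_le hm n)
  have hEP : MeasurableSet E :=
    hint.pastSigma_le hm n _ (rewardsBefore_le_pastSigma (epochStart_le hn) _ hE)
  have hH : MeasurableSet[pastSigma r st act n] (histSet st act σ α n) :=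
    measurableSet_histSet_pastSigma σ α n
  have hA : MeasurableSet[pastSigma r st act n] {ω | act n ω = α n} :=
    measurableSet_act_pastSigma hn le_rfl _
  have hHA : MeasurableSet[pastSigma r st act n ⊔ rewardSigma r n]
      (histSet st act σ α n ∩ {ω | act n ω = α n}) :=
    (le_sup_left : pastSigma r st act n ≤ _) _
      (MeasurableSet.inter (m := pastSigma r st act n) hH hA)
  have hH' := hint.pastSigma_le hm n _ hH
  have hHA' := hle _ hHA
  rw [histSet_succ σ α hn, ← Measure.restrict_restrict hHA', ← lintegral_indicator hHA',
    hint.lintegral_next_state hm hn _ (hf.indicator hHA), ← lintegral_indicator hH',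
    ← lintegral_const_mul' _ _ ENNReal.ofReal_ne_top]
  refine lintegral_congr_ae ?_
  filter_upwards [hEact] with ω hω
  by_cases h1 : ω ∈ histSet st act σ α n
  · have hst : st n ω = σ n := h1.1 n (mem_Icc.2 ⟨hn, le_rfl⟩)
    by_cases h2 : act n ω = α n
    · rw [Set.indicator_of_mem h1, Set.indicator_of_mem ((hω h1).1 h2),
        Set.indicator_of_mem (show ω ∈ histSet st act σ α n ∩ {ω | act n ω = α n} from ⟨h1, h2⟩),
        hst, h2]
    · rw [Set.indicator_of_mem h1, Set.indicator_of_notMem (fun h => h2 ((hω h1).2 h)),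
        Set.indicator_of_notMem (fun h => h2 h.2), mul_zero, mul_zero]
  · rw [Set.indicator_of_notMem h1, Set.indicator_of_notMem (fun h => h1 h.1), mul_zero, mul_zero]

/-- Within an epoch, the trajectory is independent of the rewards that the epoch generates: on a
history, functions `ψ τ` of the rewards generated at the times `τ` of the current epoch are
independent, with their original laws, of each other and of `φ`, a function of the rewards generated
before the epoch. The reason is that the policy of the epoch is fixed at its start. -/
lemma IsInteraction.lintegral_histSet_prod {σ : ℕ → S} {α : ℕ → A} {t₀ n : ℕ} (ht₀ : 1 ≤ t₀)
    (hn : t₀ ≤ n) (hepoch : ∀ m, t₀ ≤ m → m < n → epochStart σ α m = t₀) {φ : Ω → ℝ≥0∞}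
    (hφ : Measurable[rewardsBefore r t₀] φ) {ψ : ℕ → Ω → ℝ≥0∞}
    (hψ : ∀ τ, Measurable[rewardSigma r τ] (ψ τ)) :
    ∫⁻ ω in histSet st act σ α n, φ ω * ∏ τ ∈ Ico t₀ n, ψ τ ω ∂μ =
      (∫⁻ ω in histSet st act σ α n, φ ω ∂μ) * ∏ τ ∈ Ico t₀ n, ∫⁻ ω, ψ τ ω ∂μ := by
  induction n, hn using Nat.le_induction generalizing φ with
  | base => simp
  | succ n hn ih =>
    have h1n : 1 ≤ n := ht₀.trans hn
    obtain ⟨E, hE, hstep⟩ := hint.lintegral_histSet_succ hm hpol (σ := σ) (α := α) h1n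
    rw [hepoch n hn (Nat.lt_succ_self n)] at hE
    have hφP : Measurable[pastSigma r st act n] φ :=
      hφ.mono (rewardsBefore_le_pastSigma hn) le_rfl
    have hψP : ∀ τ ∈ Ico t₀ n, Measurable[pastSigma r st act n] (ψ τ) := fun τ hτ => by
      rw [mem_Ico] at hτ
      exact (hψ τ).mono ((rewardSigma_le_rewardsBefore (ht₀.trans hτ.1) hτ.2).trans
        (rewardsBefore_le_pastSigma le_rfl)) le_rfl
    have hEP : MeasurableSet[pastSigma r st act n] E := rewardsBefore_le_pastSigma hn _ hE
    have hH : MeasurableSet[pastSigma r st act n] (histSet st act σ α n) :=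
      measurableSet_histSet_pastSigma σ α n
    have hprodP : Measurable[pastSigma r st act n] fun ω => ∏ τ ∈ Ico t₀ n, ψ τ ω :=
      Finset.measurable_prod _ hψP
    have hEφ : Measurable[rewardsBefore r t₀] (E.indicator φ) := hφ.indicator hE
    have hfull : Measurable[pastSigma r st act n ⊔ rewardSigma r n]
        fun ω => φ ω * ∏ τ ∈ Ico t₀ (n + 1), ψ τ ω := by
      simp only [Finset.prod_Ico_succ_top hn]
      exact (hφP.mono le_sup_left le_rfl).mul
        ((hprodP.mono le_sup_left le_rfl).mul ((hψ n).mono le_sup_right le_rfl))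
    rw [hstep _ hfull, hstep _ (hφP.mono le_sup_left le_rfl), Finset.prod_Ico_succ_top hn, mul_assoc,
      ← mul_assoc (∫⁻ ω in histSet st act σ α n, E.indicator φ ω ∂μ),
      ← ih (fun m h1 h2 => hepoch m h1 (by omega)) hEφ]
    congr 1
    have hH' := hint.pastSigma_le hm n _ hH
    have hmeas : Measurable[pastSigma r st act n] ((histSet st act σ α n).indicator
        fun ω => E.indicator φ ω * ∏ τ ∈ Ico t₀ n, ψ τ ω) :=
      ((hEφ.mono (rewardsBefore_le_pastSigma hn) le_rfl).mul hprodP).indicator hH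
    rw [← lintegral_indicator hH', ← lintegral_indicator hH',
      ← hint.lintegral_fresh hm h1n hmeas (hψ n)]
    refine lintegral_congr fun ω => ?_
    simp only [Set.indicator, Finset.prod_Ico_succ_top hn]
    split_ifs <;> simp [mul_assoc]

end

end Interaction

section EpochProducts

variable {S A : Type*} [Fintype S] [DecidableEq S] [Fintype A] [DecidableEq A]
variable {Ω : Type*} [mΩ : MeasurableSpace Ω] {M : MDP S A} {s₁ : S} {μ : Measure Ω}
  {r : ℕ → S → A → Ω → ℕ → ℝ≥0} {st : ℕ → Ω → S} {act : ℕ → Ω → A}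

/-! ### Exponential processes of the rewards -/

/-- A product over the times before `n`, whose factor at time `τ` may depend on the time left until
the end of the epoch of `τ`, and on the reward sequence that is generated at time `τ`. -/
noncomputable def epochProd (g : ℕ → ℕ → S → A → (ℕ → ℝ≥0) → ℝ≥0∞) (r : ℕ → S → A → Ω → ℕ → ℝ≥0)
    (st : ℕ → Ω → S) (act : ℕ → Ω → A) (n : ℕ) (ω : Ω) : ℝ≥0∞ :=
  ∏ τ ∈ Ico 1 n, g τ (epochEnd (fun t => st t ω) (fun t => act t ω) n τ - τ) (st τ ω) (act τ ω)
    (r τ (st τ ω) (act τ ω) ω)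

variable {g : ℕ → ℕ → S → A → (ℕ → ℝ≥0) → ℝ≥0∞}

lemma epochProd_eq_of_mem_histSet {σ : ℕ → S} {α : ℕ → A} {n m : ℕ} (hmn : m ≤ n) {ω : Ω}
    (hω : ω ∈ histSet st act σ α n) :
    epochProd g r st act m ω =
      ∏ τ ∈ Ico 1 m, g τ (epochEnd σ α m τ - τ) (σ τ) (α τ) (r τ (σ τ) (α τ) ω) := by
  refine Finset.prod_congr rfl fun τ hτ => ?_
  rw [mem_Ico] at hτ
  have h1 : st τ ω = σ τ := hω.1 τ (mem_Icc.2 ⟨hτ.1, by omega⟩)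
  have h2 : act τ ω = α τ := hω.2 τ (mem_Ico.2 ⟨hτ.1, by omega⟩)
  rw [epochEnd_congr hω (by omega) (by omega), h1, h2]

lemma measurable_epochProd (hst : ∀ τ s, MeasurableSet {ω | st τ ω = s})
    (hact : ∀ τ a, MeasurableSet {ω | act τ ω = a}) (hm : ∀ t s a, Measurable (r t s a))
    (hg : ∀ τ m s a, Measurable (g τ m s a)) (n : ℕ) : Measurable (epochProd g r st act n) :=
  measurable_of_histSet (n := n) (fun τ _ => hst τ) (fun τ _ => hact τ) fun σ α =>
    ⟨_, Finset.measurable_prod (Ico 1 n) fun τ _ => (hg τ (epochEnd σ α n τ - τ) (σ τ) (α τ)).comp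
      (hm τ (σ τ) (α τ)), fun ω hω => by
        rw [epochProd_eq_of_mem_histSet le_rfl hω]; rfl⟩

variable [IsProbabilityMeasure μ] (hint : IsInteraction M s₁ μ r st act)
  (hm : ∀ t s a, Measurable (r t s a)) (hpol : PolicyPredictable μ r st act)
  (hg : ∀ τ m s a, Measurable (g τ m s a))
  (hg1 : ∀ τ, 1 ≤ τ → ∀ m s a, ∫⁻ ω, g τ m s a (r τ s a ω) ∂μ ≤ 1)

include hint hm hpol hg hg1

/-- The factors of the last epoch have mean at most one, given the history. -/
lemma IsInteraction.lintegral_histSet_epochProd_le (σ : ℕ → S) (α : ℕ → A) {n : ℕ} (hn : 1 ≤ n) :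
    ∫⁻ ω in histSet st act σ α (n + 1), epochProd g r st act (n + 1) ω ∂μ ≤
      ∫⁻ ω in histSet st act σ α (n + 1),
        epochProd g r st act (epochStart (fun t => st t ω) (fun t => act t ω) n) ω ∂μ := by
  set t₀ := epochStart σ α n with ht₀
  have h1 : 1 ≤ t₀ := one_le_epochStart n
  have h2 : t₀ ≤ n := epochStart_le hn
  have hH : MeasurableSet (histSet st act σ α (n + 1)) :=
    measurableSet_histSet (fun τ _ => hint.meas_st τ) (fun τ _ => hint.meas_act τ) σ α
  set φ : Ω → ℝ≥0∞ := fun ω =>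
    ∏ τ ∈ Ico 1 t₀, g τ (epochEnd σ α t₀ τ - τ) (σ τ) (α τ) (r τ (σ τ) (α τ) ω) with hφdef
  set ψ : ℕ → Ω → ℝ≥0∞ := fun τ ω => g τ (n + 1 - τ) (σ τ) (α τ) (r τ (σ τ) (α τ) ω) with hψdef
  have hψ : ∀ τ, Measurable[rewardSigma r τ] (ψ τ) := fun τ =>
    (hg τ _ _ _).comp (measurable_rewardSigma τ _ _)
  have hφ : Measurable[rewardsBefore r t₀] φ := by
    refine Finset.measurable_prod _ fun τ hτ => ?_
    rw [mem_Ico] at hτ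
    exact (hg τ _ _ _).comp ((measurable_rewardSigma τ _ _).mono
      (rewardSigma_le_rewardsBefore hτ.1 hτ.2) le_rfl)
  have hL : ∀ ω ∈ histSet st act σ α (n + 1),
      epochProd g r st act (n + 1) ω = φ ω * ∏ τ ∈ Ico t₀ (n + 1), ψ τ ω := by
    intro ω hω
    rw [epochProd_eq_of_mem_histSet le_rfl hω,
      ← Finset.prod_Ico_consecutive _ h1 (show t₀ ≤ n + 1 by omega)]
    congr 1
    · refine Finset.prod_congr rfl fun τ hτ => ?_
      rw [mem_Ico] at hτ
      rw [epochEnd_eq_of_lt hτ.1 hτ.2 (show epochStart σ α n ≤ n + 1 by omega) le_rfl]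
    · refine Finset.prod_congr rfl fun τ hτ => ?_
      rw [mem_Ico] at hτ
      rw [epochEnd_succ_of_ge hτ.1 (by omega)]
  have hR : ∀ ω ∈ histSet st act σ α (n + 1),
      epochProd g r st act (epochStart (fun t => st t ω) (fun t => act t ω) n) ω = φ ω := by
    intro ω hω
    rw [epochStart_congr hω (Nat.le_succ n), epochProd_eq_of_mem_histSet (by omega) hω]
  rw [setLIntegral_congr_fun hH hL, setLIntegral_congr_fun hH hR,
    hint.lintegral_histSet_prod hm hpol h1 (show t₀ ≤ n + 1 by omega)
      (fun m h3 h4 => (epochStart_eq_of_le h3 (by omega)).trans ht₀.symm) hφ hψ]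
  refine mul_le_of_le_one_right zero_le (Finset.prod_le_one' fun τ hτ => ?_)
  rw [mem_Ico] at hτ
  exact hg1 τ (h1.trans hτ.1) _ _ _

/-- Products of factors with mean at most one have mean at most one, even though the factors look
ahead to the ends of the epochs. -/
lemma IsInteraction.lintegral_epochProd_le_one {n : ℕ} (hn : 1 ≤ n) :
    ∫⁻ ω, epochProd g r st act n ω ∂μ ≤ 1 := by
  -- At the start of an epoch, all factors belong to complete epochs; induction over these starts.
  have hstopped : ∀ n, 1 ≤ n → ∫⁻ ω, epochProd g r st act
      (epochStart (fun t => st t ω) (fun t => act t ω) n) ω ∂μ ≤ 1 := by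
    intro n hn
    induction n, hn using Nat.le_induction with
    | base => simp [epochStart_one, epochProd]
    | succ n hn ih =>
      refine le_trans (lintegral_le_of_histSet (n := n + 1) hint.meas_st hint.meas_act
        fun σ α => ?_) ih
      have hH : MeasurableSet (histSet st act σ α (n + 1)) :=
        measurableSet_histSet (fun τ _ => hint.meas_st τ) (fun τ _ => hint.meas_act τ) σ α
      have hes : ∀ ω ∈ histSet st act σ α (n + 1),
          epochStart (fun t => st t ω) (fun t => act t ω) (n + 1) = epochStart σ α (n + 1) ∧
          epochStart (fun t => st t ω) (fun t => act t ω) n = epochStart σ α n := fun ω hω =>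
        ⟨epochStart_congr hω le_rfl, epochStart_congr hω n.le_succ⟩
      rcases epochStart_succ_eq_or (st := σ) (act := α) n with h | h
      · refine le_trans (le_of_eq (setLIntegral_congr_fun hH fun ω hω => ?_))
          (hint.lintegral_histSet_epochProd_le hm hpol hg hg1 σ α hn)
        rw [(hes ω hω).1, h]
      · refine le_of_eq (setLIntegral_congr_fun hH fun ω hω => ?_)
        rw [(hes ω hω).1, (hes ω hω).2, h]
  rcases Nat.eq_or_lt_of_le hn with rfl | h
  · simp [epochProd]
  · obtain ⟨k, rfl⟩ : ∃ k, n = k + 1 := ⟨n - 1, by omega⟩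
    exact (lintegral_le_of_histSet (n := k + 1) hint.meas_st hint.meas_act
      fun σ α => hint.lintegral_histSet_epochProd_le hm hpol hg hg1 σ α (by omega)).trans
        (hstopped k (by omega))

end EpochProducts

/-! ### Exponential processes of the transitions -/

section Transitions

variable {S A : Type*} [Fintype S] [DecidableEq S] [Fintype A] [DecidableEq A]

/-- Hoeffding's lemma in exponential form. -/
lemma lintegral_exp_sub_le_one {Ω' : Type*} {m : MeasurableSpace Ω'} {ν : Measure Ω'}
    [IsProbabilityMeasure ν] {X : Ω' → ℝ} {a b : ℝ} (hX : Measurable X)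
    (hab : ∀ᵐ ω ∂ν, X ω ∈ Set.Icc a b) (l : ℝ) :
    ∫⁻ ω, ENNReal.ofReal (Real.exp (l * (X ω - ∫ ω, X ω ∂ν) - l ^ 2 * (b - a) ^ 2 / 8)) ∂ν ≤ 1 := by
  have hsub := hasSubgaussianMGF_of_mem_Icc hX.aemeasurable hab
  have h1 := hsub.mgf_le l
  have hint := hsub.integrable_exp_mul l
  have h2 : ∀ ω, Real.exp (l * (X ω - ∫ ω, X ω ∂ν) - l ^ 2 * (b - a) ^ 2 / 8) =
      Real.exp (-(l ^ 2 * (b - a) ^ 2 / 8)) * Real.exp (l * (X ω - ∫ ω, X ω ∂ν)) := fun ω => by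
    rw [← Real.exp_add]; ring_nf
  simp only [h2]
  rw [← ofReal_integral_eq_lintegral_ofReal (hint.const_mul _)
    (Eventually.of_forall fun ω => by positivity), ENNReal.ofReal_le_one, integral_const_mul]
  have h3 : (((‖b - a‖₊ / 2) ^ 2 : ℝ≥0) : ℝ) * l ^ 2 / 2 = l ^ 2 * (b - a) ^ 2 / 8 := by
    push_cast
    rw [Real.norm_eq_abs, div_pow, sq_abs]
    ring
  rw [h3] at h1
  calc _ ≤ Real.exp (-(l ^ 2 * (b - a) ^ 2 / 8)) * Real.exp (l ^ 2 * (b - a) ^ 2 / 8) := by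
        gcongr; exact h1
    _ = 1 := by rw [← Real.exp_add]; simp

/-- A multiplicative bound on the exponential moment of a variable in `[0, 1]`. -/
lemma lintegral_exp_sub_mul_le_one {Ω' : Type*} {m : MeasurableSpace Ω'} {ν : Measure Ω'}
    [IsProbabilityMeasure ν] {X : Ω' → ℝ} (hX : Measurable X)
    (h01 : ∀ᵐ ω ∂ν, X ω ∈ Set.Icc 0 1) :
    ∫⁻ ω, ENNReal.ofReal (Real.exp (X ω - (Real.exp 1 - 1) * ∫ ω, X ω ∂ν)) ∂ν ≤ 1 := by
  have hint : Integrable X ν := Integrable.of_mem_Icc 0 1 hX.aemeasurable h01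
  set c := Real.exp (-((Real.exp 1 - 1) * ∫ ω, X ω ∂ν)) with hc
  have hpt : ∀ᵐ ω ∂ν, ENNReal.ofReal (Real.exp (X ω - (Real.exp 1 - 1) * ∫ ω, X ω ∂ν)) ≤
      ENNReal.ofReal (c * (1 + (Real.exp 1 - 1) * X ω)) := by
    filter_upwards [h01] with ω hω
    refine ENNReal.ofReal_le_ofReal ?_
    have hconv := convexOn_exp.2 (Set.mem_univ (0 : ℝ)) (Set.mem_univ (1 : ℝ))
      (sub_nonneg.2 hω.2) hω.1 (by ring)
    simp only [smul_eq_mul, mul_zero, zero_add, mul_one, Real.exp_zero] at hconv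
    rw [sub_eq_add_neg, Real.exp_add, mul_comm, ← hc]
    have hc0 : 0 < c := Real.exp_pos _
    exact mul_le_mul_of_nonneg_left (by linarith) hc0.le
  refine (lintegral_mono_ae hpt).trans ?_
  have hint2 : Integrable (fun ω => c * (1 + (Real.exp 1 - 1) * X ω)) ν :=
    ((integrable_const 1).add (hint.const_mul _)).const_mul _
  have he : 0 ≤ Real.exp 1 - 1 := by linarith [Real.add_one_le_exp (1 : ℝ)]
  rw [← ofReal_integral_eq_lintegral_ofReal hint2 (h01.mono fun ω hω =>
      mul_nonneg (Real.exp_pos _).le (by have := mul_nonneg he hω.1; linarith)),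
    ENNReal.ofReal_le_one, integral_const_mul, integral_add (integrable_const 1) (hint.const_mul _),
    integral_const_mul]
  simp only [integral_const, probReal_univ, smul_eq_mul, mul_one]
  calc c * (1 + (Real.exp 1 - 1) * ∫ ω, X ω ∂ν)
      ≤ c * Real.exp ((Real.exp 1 - 1) * ∫ ω, X ω ∂ν) := by
        gcongr
        linarith [Real.add_one_le_exp ((Real.exp 1 - 1) * ∫ ω, X ω ∂ν)]
    _ = 1 := by rw [hc, ← Real.exp_add]; simp

/-- Hoeffding's lemma for a probability vector. -/
lemma sum_exp_le_one [Nonempty S] {p w : S → ℝ} {C : ℝ} (hp : p ∈ stdSimplex ℝ S)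
    (hw : ∀ y y', w y - w y' ≤ C) :
    ∑ y, ENNReal.ofReal (p y) *
      ENNReal.ofReal (Real.exp (∑ y', p y' * w y' - w y - C ^ 2 / 8)) ≤ 1 := by
  let _ : MeasurableSpace S := ⊤
  set ν : Measure S := ∑ y, ENNReal.ofReal (p y) • Measure.dirac y with hν
  have hν1 : IsProbabilityMeasure ν := ⟨by
    simp only [hν, Measure.coe_finsetSum, Finset.sum_apply, Measure.smul_apply, measure_univ,
      smul_eq_mul, mul_one]
    rw [← ENNReal.ofReal_sum_of_nonneg fun y _ => hp.1 y, hp.2, ENNReal.ofReal_one]⟩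
  have hlint : ∀ f : S → ℝ≥0∞, ∫⁻ y, f y ∂ν = ∑ y, ENNReal.ofReal (p y) * f y := fun f => by
    rw [hν, lintegral_finsetSum_measure]
    simp [lintegral_smul_measure]
  have hintg : ∫ y, w y ∂ν = ∑ y, p y * w y := by
    rw [hν, integral_finsetSum_measure fun y _ => by
      exact (Integrable.of_finite).smul_measure ENNReal.ofReal_ne_top]
    simp [integral_smul_measure, ENNReal.toReal_ofReal (hp.1 _)]
  have hC : 0 ≤ C := by
    obtain ⟨s⟩ := ‹Nonempty S›
    simpa using hw s s
  have hab : ∀ᵐ y ∂ν, w y ∈ Set.Icc (⨅ y, w y) (⨆ y, w y) :=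
    Eventually.of_forall fun y => ⟨ciInf_fintype_le w y, le_ciSup_fintype w y⟩
  have h := lintegral_exp_sub_le_one (ν := ν) (X := w) measurable_from_top hab (-1)
  rw [hintg, hlint] at h
  refine le_trans (Finset.sum_le_sum fun y _ => ?_) h
  have hspan : (⨆ y, w y) - ⨅ y, w y ≤ C := by
    obtain ⟨y1, h1⟩ := exists_eq_ciSup_of_finite (f := w)
    obtain ⟨y2, h2⟩ := exists_eq_ciInf_of_finite (f := w)
    rw [← h1, ← h2]; exact hw y1 y2
  have hspan0 : 0 ≤ (⨆ y, w y) - ⨅ y, w y := by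
    linarith [ciInf_fintype_le w y, le_ciSup_fintype w y]
  gcongr
  · linarith
  · nlinarith

variable {Ω : Type*} [mΩ : MeasurableSpace Ω] {M : MDP S A} {s₁ : S} {μ : Measure Ω}
  {r : ℕ → S → A → Ω → ℕ → ℝ≥0} {st : ℕ → Ω → S} {act : ℕ → Ω → A}

/-- The exponential process of the martingale differences `p(· | s_t, a_t) W_t - W_t(s_{t+1})`,
where `C t` bounds the span of `W t`. -/
noncomputable def transProd (M : MDP S A) (st : ℕ → Ω → S) (act : ℕ → Ω → A) (W : ℕ → Ω → S → ℝ)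
    (C : ℕ → Ω → ℝ) (n : ℕ) (ω : Ω) : ℝ≥0∞ :=
  ∏ t ∈ Ico 1 n, ENNReal.ofReal (Real.exp
    (∑ y, M.p (st t ω) (act t ω) y * W t ω y - W t ω (st (t + 1) ω) - C t ω ^ 2 / 8))

lemma transProd_eq (W : ℕ → Ω → S → ℝ) (C : ℕ → Ω → ℝ) (n : ℕ) (ω : Ω) :
    transProd M st act W C n ω = ENNReal.ofReal (Real.exp (∑ t ∈ Ico 1 n,
      (∑ y, M.p (st t ω) (act t ω) y * W t ω y - W t ω (st (t + 1) ω) - C t ω ^ 2 / 8))) := by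
  rw [transProd, Real.exp_sum, ENNReal.ofReal_prod_of_nonneg fun t _ => (Real.exp_pos _).le]

variable {W : ℕ → Ω → S → ℝ} {C : ℕ → Ω → ℝ}

lemma measurable_transProd (hW : ∀ t, 1 ≤ t → ∀ y, Measurable[pastSigma r st act t] fun ω => W t ω y)
    (hC : ∀ t, 1 ≤ t → Measurable[pastSigma r st act t] (C t)) (n : ℕ) :
    Measurable[pastSigma r st act n] (transProd M st act W C n) := by
  refine Finset.measurable_prod _ fun t ht => ?_
  rw [mem_Ico] at ht
  have hle : pastSigma r st act t ≤ pastSigma r st act n :=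
    sup_le_sup (biSup_mono fun τ hτ => Icc_subset_Icc_right ht.2.le hτ) (rewardsBefore_mono ht.2.le)
  have hW' : ∀ y, Measurable[pastSigma r st act n] fun ω => W t ω y :=
    fun y => (hW t ht.1 y).mono hle le_rfl
  have h1 : Measurable[pastSigma r st act n] fun ω => ∑ y, M.p (st t ω) (act t ω) y * W t ω y :=
    measurable_at_pair (G := fun s a ω => ∑ y, M.p s a y * W t ω y)
      (fun s => measurableSet_st_pastSigma ht.1 ht.2.le s)
      (fun a => measurableSet_act_pastSigma ht.1 ht.2.le a)
      fun s a => Finset.measurable_sum _ fun y _ => (hW' y).const_mul _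
  have h2 : Measurable[pastSigma r st act n] fun ω => W t ω (st (t + 1) ω) :=
    measurable_at_pair (G := fun s _ ω => W t ω s) (Y := act t)
      (fun s => measurableSet_st_pastSigma (by omega) ht.2 s)
      (fun a => measurableSet_act_pastSigma ht.1 ht.2.le a) fun s _ => hW' s
  have h3 : Measurable[pastSigma r st act n] (C t) := (hC t ht.1).mono hle le_rfl
  exact (Real.measurable_exp.comp ((h1.sub h2).sub ((h3.pow_const 2).div_const 8))).ennreal_ofReal

lemma IsInteraction.lintegral_transProd_le_one [Nonempty S] [IsProbabilityMeasure μ]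
    (hint : IsInteraction M s₁ μ r st act) (hm : ∀ t s a, Measurable (r t s a))
    (hW : ∀ t, 1 ≤ t → ∀ y, Measurable[pastSigma r st act t] fun ω => W t ω y)
    (hC : ∀ t, 1 ≤ t → Measurable[pastSigma r st act t] (C t))
    (hWC : ∀ t, 1 ≤ t → ∀ ω y y', W t ω y - W t ω y' ≤ C t ω) {n : ℕ} (hn : 1 ≤ n) :
    ∫⁻ ω, transProd M st act W C n ω ∂μ ≤ 1 := by
  induction n, hn using Nat.le_induction with
  | base => simp [transProd]
  | succ n hn ih =>
    refine le_trans ?_ ih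
    set e : S → Ω → ℝ≥0∞ := fun s' ω => ENNReal.ofReal (Real.exp
      (∑ y, M.p (st n ω) (act n ω) y * W n ω y - W n ω s' - C n ω ^ 2 / 8)) with he
    have hmp : Measurable[pastSigma r st act n] (transProd M st act W C n) :=
      measurable_transProd hW hC n
    have hem : ∀ s', Measurable[pastSigma r st act n] (e s') := fun s' => by
      have h1 : Measurable[pastSigma r st act n]
          fun ω => ∑ y, M.p (st n ω) (act n ω) y * W n ω y :=
        measurable_at_pair (G := fun s a ω => ∑ y, M.p s a y * W n ω y)
          (fun s => measurableSet_st_pastSigma hn le_rfl s)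
          (fun a => measurableSet_act_pastSigma hn le_rfl a)
          fun s a => Finset.measurable_sum _ fun y _ => (hW n hn y).const_mul _
      exact (Real.measurable_exp.comp ((h1.sub (hW n hn s')).sub
        (((hC n hn).pow_const 2).div_const 8))).ennreal_ofReal
    have hsplit : ∀ f : Ω → ℝ≥0∞,
        ∫⁻ ω, f ω ∂μ = ∑ s', ∫⁻ ω in {ω | st (n + 1) ω = s'}, f ω ∂μ := by
      intro f
      rw [← tsum_fintype (L := .unconditional _), ← lintegral_iUnion (hint.meas_st (n + 1)),
        show (⋃ s', {ω | st (n + 1) ω = s'}) = Set.univ by ext ω; simp, Measure.restrict_univ]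
      intro s s' hss'
      rw [Function.onFun, Set.disjoint_left]
      rintro ω rfl h
      exact hss' h
    rw [hsplit]
    have hpiece : ∀ s', ∫⁻ ω in {ω | st (n + 1) ω = s'}, transProd M st act W C (n + 1) ω ∂μ =
        ∫⁻ ω, ENNReal.ofReal (M.p (st n ω) (act n ω) s') *
          (transProd M st act W C n ω * e s' ω) ∂μ := by
      intro s'
      have hmul : Measurable[pastSigma r st act n] fun ω => transProd M st act W C n ω * e s' ω :=
        hmp.mul (hem s')
      rw [← hint.lintegral_next_state hm hn s' (hmul.mono le_sup_left le_rfl)]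
      refine setLIntegral_congr_fun (hint.meas_st (n + 1) s') fun ω hω => ?_
      have hω' : st (n + 1) ω = s' := hω
      rw [transProd, Finset.prod_Ico_succ_top hn, hω']
      rfl
    have hpm : ∀ s', Measurable fun ω => ENNReal.ofReal (M.p (st n ω) (act n ω) s') := fun s' =>
      (measurable_at_pair (G := fun s a _ => M.p s a s') (hint.meas_st n) (hint.meas_act n)
        fun s a => measurable_const).ennreal_ofReal
    have hle := hint.pastSigma_le hm n
    simp only [hpiece]
    have hmul : ∀ s', Measurable fun ω => ENNReal.ofReal (M.p (st n ω) (act n ω) s') *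
        (transProd M st act W C n ω * e s' ω) := fun s' =>
      (hpm s').mul ((hmp.mono hle le_rfl).mul ((hem s').mono hle le_rfl))
    rw [← lintegral_finsetSum _ fun s' _ => hmul s']
    refine lintegral_mono fun ω => ?_
    have hsum := sum_exp_le_one (M.p_mem (st n ω) (act n ω)) (hWC n hn ω)
    calc _ = transProd M st act W C n ω * ∑ s', ENNReal.ofReal (M.p (st n ω) (act n ω) s') *
          e s' ω := by
          rw [Finset.mul_sum]; exact Finset.sum_congr rfl fun s' _ => by ring
      _ ≤ transProd M st act W C n ω * 1 := by gcongr
      _ = _ := mul_one _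

end Transitions

/-! ### Measurability of extended value iteration -/

section EviMeasurable

variable {S A : Type*} [Fintype S] [Fintype A]

lemma continuous_sSup_expectation {P : Set (S → ℝ)} (hP : P ⊆ stdSimplex ℝ S) :
    Continuous fun u : S → ℝ => sSup ((fun q : S → ℝ => ∑ y, q y * u y) '' P) := by
  rcases P.eq_empty_or_nonempty with rfl | hne
  · simp only [Set.image_empty]; exact continuous_const
  · rcases isEmpty_or_nonempty S with hS | ⟨⟨s₀⟩⟩
    · exact continuous_of_const fun u v => by rw [Subsingleton.elim u v]
    · have h := (continuous_apply s₀).comp (continuous_bellman (R := fun _ (_ : Unit) => 0)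
        (P := fun (_ : S) _ => P) (fun _ _ => hP) fun _ _ => hne)
      refine h.congr fun u => ?_
      simp [bellman, eviQ]

variable {Ω : Type*} [mΩ : MeasurableSpace Ω] {R : Ω → S → A → ℝ} {P : S → A → Set (S → ℝ)}
  (hR : ∀ s a, Measurable fun ω => R ω s a) (hP : ∀ s a, P s a ⊆ stdSimplex ℝ S)

include hR hP

lemma measurable_eviQ {u : Ω → S → ℝ} (hu : ∀ s, Measurable fun ω => u ω s) (s : S) (a : A) :
    Measurable fun ω => eviQ (R ω) P (u ω) s a :=
  (hR s a).add ((continuous_sSup_expectation (hP s a)).measurable.comp (measurable_pi_iff.2 hu))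

lemma measurable_eviU (i : ℕ) (s : S) : Measurable fun ω => eviU (R ω) P i s := by
  induction i generalizing s with
  | zero => exact measurable_const
  | succ i ih => exact Measurable.iSup fun a => measurable_eviQ hR hP ih s a

lemma measurable_eviError (i : ℕ) : Measurable fun ω => eviError (R ω) P i :=
  (Measurable.iSup fun s => (measurable_eviU hR hP (i + 1) s).sub (measurable_eviU hR hP i s)).sub
    (Measurable.iInf fun s => (measurable_eviU hR hP (i + 1) s).sub (measurable_eviU hR hP i s))

lemma measurable_eviStop (ε : ℝ) : Measurable fun ω => eviStop (R ω) P ε := by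
  have hlt : ∀ i, MeasurableSet {ω | eviError (R ω) P i < ε} := fun i =>
    measurableSet_lt (measurable_eviError hR hP i) measurable_const
  refine measurable_to_countable' fun n => ?_
  have : (fun ω => eviStop (R ω) P ε) ⁻¹' {n} =
      ({ω | eviError (R ω) P n < ε} ∩ ⋂ i ∈ Set.Iio n, {ω | eviError (R ω) P i < ε}ᶜ) ∪
        {ω | n = 0 ∧ ω ∈ ⋂ i, {ω | eviError (R ω) P i < ε}ᶜ} := by
    ext ω
    simp only [Set.mem_preimage, Set.mem_singleton_iff, eviStop, Set.mem_union, Set.mem_inter_iff,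
      Set.mem_ofPred_eq, Set.mem_iInter, Set.mem_Iio, Set.mem_compl_iff]
    constructor
    · rintro rfl
      by_cases hex : ∃ i, eviError (R ω) P i < ε
      · exact Or.inl ⟨Nat.sInf_mem (s := {i | eviError (R ω) P i < ε}) hex,
          fun i hi => Nat.notMem_of_lt_sInf hi⟩
      · push Not at hex
        refine Or.inr ⟨?_, fun i => not_lt.2 (hex i)⟩
        rw [Nat.sInf_eq_zero]
        right
        ext i
        simpa using hex i
    · rintro (⟨h1, h2⟩ | ⟨rfl, h⟩)
      · refine le_antisymm (Nat.sInf_le h1) ?_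
        by_contra! hlt
        exact h2 _ hlt (Nat.sInf_mem (s := {i | eviError (R ω) P i < ε}) ⟨n, h1⟩)
      · rw [Nat.sInf_eq_zero]
        right
        ext i
        simpa using h i
  rw [this]
  refine ((hlt n).inter (MeasurableSet.biInter (Set.to_countable _) fun i _ => (hlt i).compl)).union
    ?_
  by_cases hn : n = 0
  · simp only [hn, true_and]
    exact MeasurableSet.iInter fun i => (hlt i).compl
  · simp [hn]

/-- Evaluating a sequence of measurable functions at a random index. -/
lemma measurable_at_index {γ : Type*} [MeasurableSpace γ] {N : Ω → ℕ} (hN : Measurable N)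
    {f : ℕ → Ω → γ} (hf : ∀ i, Measurable (f i)) : Measurable fun ω => f (N ω) ω := by
  intro B hB
  have : (fun ω => f (N ω) ω) ⁻¹' B = ⋃ i, N ⁻¹' {i} ∩ f i ⁻¹' B := by ext ω; simp
  rw [this]
  exact MeasurableSet.iUnion fun i => (hN (measurableSet_singleton i)).inter (hf i hB)

lemma measurable_eviBias (ε : ℝ) (s : S) : Measurable fun ω => eviBias (R ω) P ε s :=
  measurable_at_index hR hP (measurable_eviStop hR hP ε) (f := fun i ω =>
    (eviU (R ω) P i s - ⨅ y, eviU (R ω) P i y) /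
      max 1 (⨆ y, (eviU (R ω) P (i + 1) y - eviU (R ω) P i y))) fun i =>
    ((measurable_eviU hR hP i s).sub (Measurable.iInf fun y => measurable_eviU hR hP i y)).div
      (measurable_const.max (Measurable.iSup fun y =>
        (measurable_eviU hR hP (i + 1) y).sub (measurable_eviU hR hP i y)))

lemma measurableSet_eviPolicy (tie : S → Finset A → A) (ε : ℝ) (s : S) (b : A) :
    MeasurableSet {ω | eviPolicy tie (R ω) P ε s = b} := by
  classical
  set Q : A → Ω → ℝ := fun a ω => eviQ (R ω) P (eviU (R ω) P (eviStop (R ω) P ε)) s a with hQ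
  have hQm : ∀ a, Measurable (Q a) := fun a =>
    measurable_at_index hR hP (measurable_eviStop hR hP ε)
      (f := fun i ω => eviQ (R ω) P (eviU (R ω) P i) s a)
      fun i => measurable_eviQ hR hP (fun s => measurable_eviU hR hP i s) s a
  have hmax : ∀ a, MeasurableSet {ω | ∀ b, Q b ω ≤ Q a ω} := fun a => by
    simp only [Set.ofPred_forall]
    exact MeasurableSet.iInter fun b => measurableSet_le (hQm b) (hQm a)
  have hF : ∀ F : Finset A, MeasurableSet {ω | ({a | ∀ b, Q b ω ≤ Q a ω} : Finset A) = F} := by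
    intro F
    have : {ω | ({a | ∀ b, Q b ω ≤ Q a ω} : Finset A) = F} =
        ⋂ a, {ω | (∀ b, Q b ω ≤ Q a ω) ↔ a ∈ F} := by
      ext ω
      simp [Finset.ext_iff]
    rw [this]
    refine MeasurableSet.iInter fun a => ?_
    by_cases ha : a ∈ F
    · simpa [ha] using hmax a
    · have h2 := (hmax a).compl
      simpa [ha, Set.compl_ofPred] using h2
  have : {ω | eviPolicy tie (R ω) P ε s = b} =
      ⋃ F ∈ {F : Finset A | tie s F = b}, {ω | ({a | ∀ b, Q b ω ≤ Q a ω} : Finset A) = F} := by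
    ext ω
    simp only [Set.mem_iUnion, Set.mem_ofPred_eq, exists_prop, exists_eq_right']
    unfold eviPolicy
    constructor
    · intro h
      rw [← h]
    · intro h
      rw [← h]
  rw [this]
  exact MeasurableSet.biUnion (Set.to_countable _) fun F _ => hF F

end EviMeasurable

/-! ### The policy of an epoch is determined at its start -/

section EpochData

variable {S A : Type*} [Fintype S] [DecidableEq S] [Fintype A] [DecidableEq A]
variable {δ d : ℝ} {st st' : ℕ → S} {act act' : ℕ → A} {x x' : ℕ → S → ℝ} {tk tk' : ℕ → ℕ} {k : ℕ}

lemma transBall_subset (phat : S → ℝ) (β : ℝ) : transBall phat β ⊆ stdSimplex ℝ S := fun _ h => h.1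

/-- The optimistic rewards of epoch `k`. -/
noncomputable def epochReward (δ d : ℝ) (st : ℕ → S) (act : ℕ → A) (x : ℕ → S → ℝ) (tk : ℕ → ℕ)
    (k : ℕ) (s : S) (a : A) : ℝ :=
  rhat st act x tk k s a + rewardRadius δ d st act tk k s a

/-- The transition vectors that are plausible in epoch `k`. -/
noncomputable def epochBall (δ : ℝ) (st : ℕ → S) (act : ℕ → A) (tk : ℕ → ℕ) (k : ℕ) (s : S)
    (a : A) : Set (S → ℝ) :=
  transBall (phat st act tk k s a) (transRadius δ st act tk k s a)

/-- The normalized bias vector of epoch `k`. -/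
noncomputable def epochBias (δ d : ℝ) (st : ℕ → S) (act : ℕ → A) (x : ℕ → S → ℝ) (tk : ℕ → ℕ)
    (k : ℕ) : S → ℝ :=
  eviBias (epochReward δ d st act x tk k) (epochBall δ st act tk k) (1 / √(tk k : ℝ))

lemma epochPolicy_eq (tie : S → Finset A → A) : epochPolicy δ d tie st act x tk k =
    eviPolicy tie (epochReward δ d st act x tk k) (epochBall δ st act tk k) (1 / √(tk k : ℝ)) :=
  rfl

section Congr

variable (h : AgreeUpTo (tk k) st act st' act') (hk : 1 ≤ k)
  (htk : ∀ j ∈ Icc 1 k, tk j = tk' j) (hmono : ∀ j ∈ Icc 1 k, 1 ≤ tk j ∧ tk j ≤ tk k)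

include h hk htk

lemma countN_congr (s : S) (a : A) : countN st act tk k s a = countN st' act' tk' k s a := by
  unfold countN
  rw [← htk k (by simp [hk]), visits_congr h le_rfl le_rfl]

lemma epochBall_congr (s : S) (a : A) :
    epochBall δ st act tk k s a = epochBall δ st' act' tk' k s a := by
  have h1 : phat st act tk k s a = phat st' act' tk' k s a := by
    funext y
    unfold phat
    rw [countN_congr h hk htk, ← htk k (by simp [hk])]
    congr 3
    refine filter_congr fun τ hτ => ?_
    rw [mem_Ico] at hτ
    rw [h.1 τ (mem_Icc.2 ⟨hτ.1, by omega⟩), h.2 τ (mem_Ico.2 hτ),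
      h.1 (τ + 1) (mem_Icc.2 ⟨by omega, by omega⟩)]
  have h2 : transRadius δ st act tk k s a = transRadius δ st' act' tk' k s a := by
    unfold transRadius
    rw [countN_congr h hk htk, ← htk k (by simp [hk])]
  unfold epochBall
  rw [h1, h2]

include hmono

lemma visits_epoch_congr {j : ℕ} (hj : j ∈ Ico 1 k) (s : S) (a : A) :
    visits st act (tk j) (tk (j + 1)) s a = visits st' act' (tk' j) (tk' (j + 1)) s a := by
  rw [mem_Ico] at hj
  have h1 : j ∈ Icc 1 k := mem_Icc.2 ⟨hj.1, by omega⟩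
  have h2 : j + 1 ∈ Icc 1 k := mem_Icc.2 ⟨by omega, by omega⟩
  rw [← htk j h1, ← htk _ h2]
  exact visits_congr h (hmono j h1).1 (hmono _ h2).2 s a

lemma epochReward_congr (hx : ∀ τ ∈ Ico 1 (tk k), x τ = x' τ) (s : S) (a : A) :
    epochReward δ d st act x tk k s a = epochReward δ d st' act' x' tk' k s a := by
  have h1 : rhat st act x tk k s a = rhat st' act' x' tk' k s a := by
    unfold rhat
    rw [countN_congr h hk htk]
    congr 1
    refine Finset.sum_congr (filter_congr fun j hj => by
      rw [visits_epoch_congr h hk htk hmono hj]) fun j hj => ?_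
    have hj := mem_Ico.1 (mem_filter.1 hj).1
    have h1 : j ∈ Icc 1 k := mem_Icc.2 ⟨hj.1, by omega⟩
    have h2 : j + 1 ∈ Icc 1 k := mem_Icc.2 ⟨by omega, by omega⟩
    rw [← htk j h1, ← htk _ h2]
    refine Finset.sum_congr rfl fun τ hτ => ?_
    rw [mem_Ico] at hτ
    rw [hx τ (mem_Ico.2 ⟨(hmono j h1).1.trans hτ.1, hτ.2.trans_le (hmono _ h2).2⟩)]
  have h2 : countE st act tk k s a = countE st' act' tk' k s a := by
    unfold countE
    congr 1
    exact filter_congr fun j hj => by rw [visits_epoch_congr h hk htk hmono hj]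
  unfold epochReward rewardRadius
  rw [h1, h2, countN_congr h hk htk, ← htk k (by simp [hk])]

lemma epochPolicy_congr (tie : S → Finset A → A) (hx : ∀ τ ∈ Ico 1 (tk k), x τ = x' τ) :
    epochPolicy δ d tie st act x tk k = epochPolicy δ d tie st' act' x' tk' k := by
  rw [epochPolicy_eq, epochPolicy_eq, ← htk k (by simp [hk])]
  congr 1
  · funext s a; exact epochReward_congr h hk htk hmono hx s a
  · funext s a; exact epochBall_congr h hk htk s a

lemma epochBias_congr (hx : ∀ τ ∈ Ico 1 (tk k), x τ = x' τ) :
    epochBias δ d st act x tk k = epochBias δ d st' act' x' tk' k := by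
  unfold epochBias
  rw [← htk k (by simp [hk])]
  congr 1
  · funext s a; exact epochReward_congr h hk htk hmono hx s a
  · funext s a; exact epochBall_congr h hk htk s a

end Congr

lemma epochIdx_epochStart {n : ℕ} (hn : 1 ≤ n) :
    epochIdx st act (epochStart st act n) = epochIdx st act n := by
  induction n, hn using Nat.le_induction with
  | base => rw [epochStart_one]
  | succ n hn ih =>
    rcases epochStart_succ_eq_or (st := st) (act := act) n with h | h
    · rw [h]
    · have := epochStart_le (st := st) (act := act) hn
      rw [h, ih, epochIdx_succ, if_neg (by omega), add_zero]

lemma epochBegin_le {n : ℕ} (hn : 1 ≤ n) (hk : k ≤ epochIdx st act n) : epochBegin st act k ≤ n :=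
  Nat.sInf_le ⟨hn, hk⟩

lemma epochBegin_spec {n : ℕ} (hn : 1 ≤ n) (hk : k ≤ epochIdx st act n) :
    1 ≤ epochBegin st act k ∧ k ≤ epochIdx st act (epochBegin st act k) :=
  Nat.sInf_mem (s := {t | 1 ≤ t ∧ k ≤ epochIdx st act t}) ⟨n, hn, hk⟩

lemma epochBegin_mono {n : ℕ} (hn : 1 ≤ n) (hk : k ≤ epochIdx st act n) :
    ∀ j ∈ Icc 1 k, 1 ≤ epochBegin st act j ∧ epochBegin st act j ≤ epochBegin st act k := by
  intro j hj
  rw [mem_Icc] at hj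
  have h := epochBegin_spec hn hk
  exact ⟨(epochBegin_spec hn (hj.2.trans hk)).1, epochBegin_le h.1 (hj.2.trans h.2)⟩

lemma epochBegin_epochIdx_le {n : ℕ} (hn : 1 ≤ n) :
    epochBegin st act (epochIdx st act n) ≤ epochStart st act n :=
  epochBegin_le (one_le_epochStart n) (epochIdx_epochStart hn).symm.le

variable {Ω : Type*} [mΩ : MeasurableSpace Ω] {M : MDP S A} {s₁ : S} {μ : Measure Ω}
  {r : ℕ → S → A → Ω → ℕ → ℝ≥0} {sto : ℕ → Ω → S} {acto : ℕ → Ω → A}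

lemma observed_congr {n : ℕ} {σ : ℕ → S} {α : ℕ → A} {ω : Ω} (hω : ω ∈ histSet sto acto σ α n)
    {τ : ℕ} (hτ : τ < n) :
    observed r sto acto ω τ = observed r (fun t _ => σ t) (fun t _ => α t) ω τ := by
  funext s
  refine Finset.sum_congr rfl fun τ' hτ' => ?_
  rw [mem_Icc] at hτ'
  have h1 : sto τ' ω = σ τ' := hω.1 τ' (mem_Icc.2 ⟨hτ'.1, by omega⟩)
  have h2 : acto τ' ω = α τ' := hω.2 τ' (mem_Ico.2 ⟨hτ'.1, by omega⟩)
  simp only [h1, h2]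

/-- On a fixed history, the optimistic rewards are functions of the rewards generated before the
epoch. -/
lemma measurable_epochReward (σ : ℕ → S) (α : ℕ → A) {n : ℕ} (hk : ∀ j ∈ Icc 1 k, tk j ≤ n)
    (hpos : ∀ j ∈ Icc 1 k, 1 ≤ tk j) (s : S) (a : A) :
    Measurable[rewardsBefore r n] fun ω =>
      epochReward δ d σ α (observed r (fun t _ => σ t) (fun t _ => α t) ω) tk k s a := by
  have hobs : ∀ τ, 1 ≤ τ → τ < n → Measurable[rewardsBefore r n] fun ω =>
      observed r (fun t _ => σ t) (fun t _ => α t) ω τ s := by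
    intro τ _ hτ
    refine Finset.measurable_sum _ fun τ' hτ' => ?_
    rw [mem_Icc] at hτ'
    dsimp only
    split_ifs
    · have h1 : Measurable[rewardsBefore r n] (r τ' s (α τ')) :=
        (measurable_rewardSigma τ' s (α τ')).mono
          (rewardSigma_le_rewardsBefore hτ'.1 (by omega)) le_rfl
      exact ((measurable_pi_apply (τ - τ')).comp h1).coe_nnreal_real
    · exact measurable_const
  refine Measurable.add_const (Measurable.div_const ?_ _) _
  refine Finset.measurable_sum _ fun j hj => Finset.measurable_sum _ fun τ hτ => ?_
  have hj := mem_Ico.1 (mem_filter.1 hj).1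
  rw [mem_Ico] at hτ
  exact hobs τ ((hpos j (mem_Icc.2 ⟨hj.1, by omega⟩)).trans hτ.1)
    (hτ.2.trans_le (hk (j + 1) (mem_Icc.2 ⟨by omega, by omega⟩)))

/-- The actions of the algorithm are predictable from the rewards before the present epoch. -/
lemma policyPredictable_of_run {tie : S → Finset A → A}
    (halg : ∀ᵐ ω ∂μ, ∃ tk : ℕ → ℕ, IsDUCRL2Run δ d tie (fun t => sto t ω)
      (fun t => acto t ω) (observed r sto acto ω) tk) : PolicyPredictable μ r sto acto := by
  intro σ α n hn b
  set k := epochIdx σ α n with hk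
  have hk1 : 1 ≤ k := one_le_epochIdx hn
  have hmono := epochBegin_mono (st := σ) (act := α) hn (le_refl k)
  have hle : epochBegin σ α k ≤ epochStart σ α n := epochBegin_epochIdx_le hn
  refine ⟨{ω | epochPolicy δ d tie σ α (observed r (fun t _ => σ t) (fun t _ => α t) ω)
    (epochBegin σ α) k (σ n) = b}, ?_, ?_⟩
  · simp only [epochPolicy_eq]
    exact measurableSet_eviPolicy (mΩ := rewardsBefore r (epochStart σ α n))
      (fun s a => measurable_epochReward σ α (fun j hj => (hmono j hj).2.trans hle)
        (fun j hj => (hmono j hj).1) s a) (fun s a => transBall_subset _ _) tie _ _ b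
  · filter_upwards [halg] with ω ⟨tk, hrun⟩ hω
    have hidx : epochIdx (fun t => sto t ω) (fun t => acto t ω) n = k := epochIdx_congr hω le_rfl
    have htk : ∀ j ∈ Icc 1 k, epochBegin σ α j = tk j := fun j hj => by
      rw [mem_Icc] at hj
      rw [← hrun.epochBegin_eq hj.1]
      exact (epochBegin_congr hω hn (by rw [hidx]; exact hj.2)).symm
    have hstart : tk k ≤ n := by
      have := hrun.tk_epochIdx hn
      rw [hidx] at this
      rw [this]; exact epochStart_le hn
    have hlt := hrun.lt_tk_epochIdx_succ hn
    rw [hidx] at hlt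
    have hbk : epochBegin σ α k ≤ n := epochBegin_le hn le_rfl
    have hsym : AgreeUpTo n σ α (fun t => sto t ω) (fun t => acto t ω) :=
      ⟨fun τ hτ => (hω.1 τ hτ).symm, fun τ hτ => (hω.2 τ hτ).symm⟩
    have hpol := epochPolicy_congr (δ := δ) (d := d) (k := k) (tk := epochBegin σ α) (tk' := tk)
      (x := observed r (fun t _ => σ t) (fun t _ => α t) ω) (x' := observed r sto acto ω)
      (hsym.mono hbk) hk1 htk hmono tie fun τ hτ =>
        (observed_congr hω ((mem_Ico.1 hτ).2.trans_le hbk)).symm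
    have hst : sto n ω = σ n := hω.1 n (mem_Icc.2 ⟨hn, le_rfl⟩)
    rw [hpol, hrun.act_eq k hk1 n hstart hlt, hst]

/-- The bias vector of the epoch of time `t`, clamped to `[0, D]`. The clamping has no effect when
the true transition probabilities are plausible. -/
noncomputable def biasProcess (δ d D : ℝ) (r : ℕ → S → A → Ω → ℕ → ℝ≥0) (st : ℕ → Ω → S)
    (act : ℕ → Ω → A) (t : ℕ) (ω : Ω) (y : S) : ℝ :=
  max 0 (min D (epochBias δ d (fun t => st t ω) (fun t => act t ω) (observed r st act ω)
    (epochBegin (fun t => st t ω) (fun t => act t ω))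
    (epochIdx (fun t => st t ω) (fun t => act t ω) t) y))

lemma biasProcess_mem {D : ℝ} (hD : 0 ≤ D) (t : ℕ) (ω : Ω) (y : S) :
    biasProcess δ d D r sto acto t ω y ∈ Set.Icc 0 D :=
  ⟨le_max_left _ _, max_le hD (min_le_left _ _)⟩

lemma measurable_biasProcess (D : ℝ) {t : ℕ} (ht : 1 ≤ t) (y : S) :
    Measurable[pastSigma r sto acto t] fun ω => biasProcess δ d D r sto acto t ω y := by
  refine Measurable.max measurable_const (Measurable.min measurable_const ?_)
  refine measurable_of_histSet (st := sto) (act := acto) (n := t)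
    (fun τ hτ s => measurableSet_st_pastSigma (mem_Icc.1 hτ).1 (mem_Icc.1 hτ).2 s)
    (fun τ hτ a => measurableSet_act_pastSigma (mem_Ico.1 hτ).1 (mem_Ico.1 hτ).2.le a)
    fun σ α => ?_
  set k := epochIdx σ α t with hk
  have hk1 : 1 ≤ k := one_le_epochIdx ht
  have hmono := epochBegin_mono (st := σ) (act := α) ht (le_refl k)
  have hbk : epochBegin σ α k ≤ t := epochBegin_le ht le_rfl
  refine ⟨fun ω => epochBias δ d σ α (observed r (fun t _ => σ t) (fun t _ => α t) ω)
    (epochBegin σ α) k y, ?_, fun ω hω => ?_⟩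
  · refine Measurable.mono ?_ (rewardsBefore_le_pastSigma (le_refl t)) le_rfl
    exact measurable_eviBias (mΩ := rewardsBefore r t)
      (fun s a => measurable_epochReward σ α (fun j hj => (hmono j hj).2.trans hbk)
        (fun j hj => (hmono j hj).1) s a) (fun s a => transBall_subset _ _) _ y
  · have hidx : epochIdx (fun t => sto t ω) (fun t => acto t ω) t = k := epochIdx_congr hω le_rfl
    have hsym : AgreeUpTo t σ α (fun t => sto t ω) (fun t => acto t ω) :=
      ⟨fun τ hτ => (hω.1 τ hτ).symm, fun τ hτ => (hω.2 τ hτ).symm⟩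
    rw [hidx]
    refine congrFun (epochBias_congr (k := k) (tk := epochBegin σ α)
      (x := observed r (fun t _ => σ t) (fun t _ => α t) ω) (x' := observed r sto acto ω)
      (hsym.mono hbk) hk1 (fun j hj => ?_) hmono fun τ hτ =>
        (observed_congr hω ((mem_Ico.1 hτ).2.trans_le hbk)).symm).symm y
    exact epochBegin_congr hsym ht (mem_Icc.1 hj).2

end EpochData

/-! ### Moments of the rewards -/

lemma measurable_norm1 : Measurable norm1 :=
  Measurable.tsum fun i => (measurable_pi_apply i).coe_nnreal_ennreal

lemma measurable_total : Measurable total := measurable_norm1.ennreal_toReal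

lemma measurable_headSum (m : ℕ) : Measurable (headSum m) :=
  Finset.measurable_sum _ fun i _ => (measurable_pi_apply i).coe_nnreal_real

lemma measurable_tailSum (m : ℕ) : Measurable (tailSum m) :=
  measurable_total.sub (measurable_headSum m)

lemma ofReal_tailSum {v : ℕ → ℝ≥0} (hv : norm1 v ≤ 1) (m : ℕ) :
    ENNReal.ofReal (tailSum m v) = ∑' i, (v (m + i) : ℝ≥0∞) := by
  have h := Summable.sum_add_tsum_nat_add' (f := fun i => (v i : ℝ≥0∞)) (k := m) ENNReal.summable
  have hfin : norm1 v ≠ ⊤ := (hv.trans_lt ENNReal.one_lt_top).ne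
  have h1 : ENNReal.ofReal (headSum m v) = ∑ i ∈ range m, (v i : ℝ≥0∞) := by
    rw [headSum, ENNReal.ofReal_sum_of_nonneg fun i _ => NNReal.coe_nonneg (v i)]
    simp
  rw [tailSum, ENNReal.ofReal_sub _ (headSum_nonneg m v), total, ENNReal.ofReal_toReal hfin, h1,
    norm1, ← h]
  simp only [add_comm m]
  refine ENNReal.add_sub_cancel_left ?_
  rw [← h1]; exact ENNReal.ofReal_ne_top

section Moments

variable {S A : Type*} [Fintype S] [DecidableEq S] [Fintype A] [DecidableEq A]
variable {Ω : Type*} [mΩ : MeasurableSpace Ω] {M : MDP S A} {μ : Measure Ω}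
  {r : ℕ → S → A → Ω → ℕ → ℝ≥0} {d : ℝ}

/-- The mean of the part of the rewards of `(s, a)` with delay at least `m`. -/
noncomputable def meanTail (μ : Measure Ω) (r : ℕ → S → A → Ω → ℕ → ℝ≥0) (m : ℕ) (s : S) (a : A) :
    ℝ :=
  ∫ ω, tailSum m (r 1 s a ω) ∂μ

variable (hr : RewardAssumption M μ r)

include hr

lemma RewardAssumption.tailSum_mem {τ : ℕ} (hτ : 1 ≤ τ) (m : ℕ) (s : S) (a : A) :
    ∀ᵐ ω ∂μ, tailSum m (r τ s a ω) ∈ Set.Icc 0 1 :=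
  (hr.norm_le τ hτ s a).mono fun _ h => ⟨tailSum_nonneg h m, tailSum_le_one h m⟩

lemma RewardAssumption.total_mem {τ : ℕ} (hτ : 1 ≤ τ) (s : S) (a : A) :
    ∀ᵐ ω ∂μ, total (r τ s a ω) ∈ Set.Icc 0 1 :=
  (hr.norm_le τ hτ s a).mono fun _ h => ⟨total_nonneg _, total_le_one h⟩

lemma RewardAssumption.headSum_mem {τ : ℕ} (hτ : 1 ≤ τ) (m : ℕ) (s : S) (a : A) :
    ∀ᵐ ω ∂μ, headSum m (r τ s a ω) ∈ Set.Icc 0 1 :=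
  (hr.norm_le τ hτ s a).mono fun _ h =>
    ⟨headSum_nonneg _ _, (headSum_le_total h m).trans (total_le_one h)⟩

lemma RewardAssumption.integral_tailSum {τ : ℕ} (hτ : 1 ≤ τ) (m : ℕ) (s : S) (a : A) :
    ∫ ω, tailSum m (r τ s a ω) ∂μ = meanTail μ r m s a :=
  ((hr.ident τ hτ s a).comp (measurable_tailSum m)).integral_eq

lemma RewardAssumption.integral_total {τ : ℕ} (hτ : 1 ≤ τ) (s : S) (a : A) :
    ∫ ω, total (r τ s a ω) ∂μ = M.r s a := by
  unfold total
  rw [integral_toReal (f := fun ω => norm1 (r τ s a ω)) (measurable_norm1.comp (hr.meas τ s a)).aemeasurable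
    ((hr.norm_le τ hτ s a).mono fun _ h => h.trans_lt ENNReal.one_lt_top), hr.mean τ hτ,
    ENNReal.toReal_ofReal (M.r_mem s a).1]

lemma RewardAssumption.meanTail_nonneg (m : ℕ) (s : S) (a : A) : 0 ≤ meanTail μ r m s a :=
  integral_nonneg_of_ae ((hr.tailSum_mem le_rfl m s a).mono fun _ h => h.1)

variable [IsProbabilityMeasure μ]

lemma RewardAssumption.integrable_tailSum {τ : ℕ} (hτ : 1 ≤ τ) (m : ℕ) (s : S) (a : A) :
    Integrable (fun ω => tailSum m (r τ s a ω)) μ :=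
  Integrable.of_mem_Icc 0 1 ((measurable_tailSum m).comp (hr.meas τ s a)).aemeasurable
    (hr.tailSum_mem hτ m s a)

lemma RewardAssumption.integrable_total {τ : ℕ} (hτ : 1 ≤ τ) (s : S) (a : A) :
    Integrable (fun ω => total (r τ s a ω)) μ :=
  Integrable.of_mem_Icc 0 1 (measurable_total.comp (hr.meas τ s a)).aemeasurable
    (hr.total_mem hτ s a)

lemma RewardAssumption.integral_headSum {τ : ℕ} (hτ : 1 ≤ τ) (m : ℕ) (s : S) (a : A) :
    ∫ ω, headSum m (r τ s a ω) ∂μ = M.r s a - meanTail μ r m s a := by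
  rw [← hr.integral_total hτ, ← hr.integral_tailSum hτ,
    ← integral_sub (hr.integrable_total hτ s a) (hr.integrable_tailSum hτ m s a)]
  exact integral_congr_ae (Eventually.of_forall fun ω => by simp [tailSum])

/-- The mean tails inherit the bound of the spill-over assumption. -/
lemma RewardAssumption.sum_meanTail_le (hd : 0 ≤ d) (hspill : SpilloverAssumption μ r d)
    (c : ℕ → S × A) (n : ℕ) : ∑ m ∈ Icc 1 n, meanTail μ r m (c m).1 (c m).2 ≤ d := by
  unfold meanTail
  rw [← integral_finsetSum _ fun m _ => hr.integrable_tailSum le_rfl m _ _]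
  have hall : ∀ᵐ ω ∂μ, ∀ s a, norm1 (r 1 s a ω) ≤ 1 :=
    ae_all_iff.2 fun s => ae_all_iff.2 fun a => hr.norm_le 1 le_rfl s a
  have h : ∀ᵐ ω ∂μ, ∑ m ∈ Icc 1 n, tailSum m (r 1 (c m).1 (c m).2 ω) ≤ d := by
    filter_upwards [hall, hspill 1 le_rfl] with ω h1 h2
    rw [← ENNReal.ofReal_le_ofReal_iff hd,
      ENNReal.ofReal_sum_of_nonneg fun m _ => tailSum_nonneg (h1 _ _) m]
    refine le_trans (Finset.sum_le_sum fun m _ => ?_) ((ENNReal.sum_le_tsum (Icc 1 n)).trans h2)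
    rw [ofReal_tailSum (h1 _ _)]
    exact le_iSup₂ (f := fun s a => ∑' i : ℕ, (r 1 s a ω (m + i) : ℝ≥0∞)) (c m).1 (c m).2
  calc _ ≤ ∫ _, d ∂μ := integral_mono_ae
        (integrable_finsetSum _ fun m _ => hr.integrable_tailSum le_rfl m _ _)
        (integrable_const d) h
    _ = d := by simp

end Moments

/-! ### Deviation bounds -/

section Deviations

variable {Ω : Type*} [mΩ : MeasurableSpace Ω] {μ : Measure Ω}

lemma measure_exp_ge_le {X : Ω → ℝ} (hX : Measurable fun ω => ENNReal.ofReal (Real.exp (X ω)))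
    (h : ∫⁻ ω, ENNReal.ofReal (Real.exp (X ω)) ∂μ ≤ 1) (c : ℝ) :
    μ {ω | c ≤ X ω} ≤ ENNReal.ofReal (Real.exp (-c)) := by
  have h1 := (mul_meas_ge_le_lintegral (μ := μ) hX (ENNReal.ofReal (Real.exp c))).trans h
  have h2 : {ω | ENNReal.ofReal (Real.exp c) ≤ ENNReal.ofReal (Real.exp (X ω))} =
      {ω | c ≤ X ω} := by
    ext ω
    simp [ENNReal.ofReal_le_ofReal_iff (Real.exp_pos _).le]
  rw [h2] at h1
  calc μ {ω | c ≤ X ω}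
      = ENNReal.ofReal (Real.exp (-c)) * (ENNReal.ofReal (Real.exp c) * μ {ω | c ≤ X ω}) := by
        rw [← mul_assoc, ← ENNReal.ofReal_mul (Real.exp_pos _).le, ← Real.exp_add]
        simp
    _ ≤ ENNReal.ofReal (Real.exp (-c)) * 1 := by gcongr
    _ = _ := mul_one _

/-- The optimal exponent in the Chernoff bound: `V` is the sum of the squared ranges. -/
lemma measure_ge_sqrt_le {X V : Ω → ℝ} {c v : ℝ} (hc : 0 < c) (hv : 0 < v)
    (h : ∀ l : ℝ, 0 < l → μ {ω | c ≤ l * X ω - l ^ 2 * V ω / 8} ≤ ENNReal.ofReal (Real.exp (-c))) :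
    μ {ω | V ω = v ∧ √(c * v / 2) ≤ X ω} ≤ ENNReal.ofReal (Real.exp (-c)) := by
  -- `l = √(8 c / v)` maximizes `l √(c v / 2) - l² v / 8`, and the maximum is `c`.
  have hl : 0 < √(8 * c / v) := Real.sqrt_pos.2 (by positivity)
  refine le_trans (measure_mono ?_) (h (√(8 * c / v)) hl)
  rintro ω ⟨h1, h2⟩
  show c ≤ _
  rw [h1, Real.sq_sqrt (by positivity)]
  have h3 : √(8 * c / v) * √(c * v / 2) = 2 * c := by
    rw [← Real.sqrt_mul (by positivity), show 8 * c / v * (c * v / 2) = (2 * c) ^ 2 by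
      field_simp; ring, Real.sqrt_sq (by positivity)]
  have h4 := mul_le_mul_of_nonneg_left h2 hl.le
  have h5 : 8 * c / v * v / 8 = c := by field_simp
  linarith

/-- The same for a random number of summands less than `t`. -/
lemma measure_ge_sqrt_le_mul {X : Ω → ℝ} {N : Ω → ℕ} {c : ℝ} {t : ℕ} (hc : 0 < c)
    (hN : ∀ ω, N ω < t)
    (h : ∀ l : ℝ, 0 < l → μ {ω | c ≤ l * X ω - l ^ 2 * N ω / 8} ≤ ENNReal.ofReal (Real.exp (-c))) :
    μ {ω | 1 ≤ N ω ∧ √(c * N ω / 2) ≤ X ω} ≤ t * ENNReal.ofReal (Real.exp (-c)) := by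
  have hsub : {ω | 1 ≤ N ω ∧ √(c * N ω / 2) ≤ X ω} ⊆
      ⋃ n ∈ Ico 1 t, {ω | (N ω : ℝ) = (n : ℝ) ∧ √(c * n / 2) ≤ X ω} := by
    rintro ω ⟨h1, h2⟩
    simp only [Set.mem_iUnion, exists_prop]
    exact ⟨N ω, mem_Ico.2 ⟨h1, hN ω⟩, rfl, h2⟩
  refine (measure_mono hsub).trans ((measure_biUnion_finset_le _ _).trans ?_)
  refine (Finset.sum_le_card_nsmul _ _ (ENNReal.ofReal (Real.exp (-c))) fun n hn => ?_).trans ?_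
  · exact measure_ge_sqrt_le (V := fun ω => (N ω : ℝ)) hc
      (by exact_mod_cast (mem_Ico.1 hn).1) h
  · rw [nsmul_eq_mul]
    gcongr
    simp

variable {S A : Type*} [Fintype S] [DecidableEq S] [Fintype A] [DecidableEq A] {M : MDP S A}
  {s₁ : S} {r : ℕ → S → A → Ω → ℕ → ℝ≥0} {st : ℕ → Ω → S} {act : ℕ → Ω → A}
  [IsProbabilityMeasure μ]

/-- Markov's inequality for an exponential process of the rewards. -/
lemma IsInteraction.measure_reward_sum_ge_le (hint : IsInteraction M s₁ μ r st act)
    (hm : ∀ t s a, Measurable (r t s a)) (hpol : PolicyPredictable μ r st act)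
    {f : ℕ → S → A → (ℕ → ℝ≥0) → ℝ} (hf : ∀ m s a, Measurable (f m s a))
    (hf1 : ∀ τ, 1 ≤ τ → ∀ m s a, ∫⁻ ω, ENNReal.ofReal (Real.exp (f m s a (r τ s a ω))) ∂μ ≤ 1)
    {n : ℕ} (hn : 1 ≤ n) (c : ℝ) :
    μ {ω | c ≤ ∑ τ ∈ Ico 1 n, f (epochEnd (fun t => st t ω) (fun t => act t ω) n τ - τ)
      (st τ ω) (act τ ω) (r τ (st τ ω) (act τ ω) ω)} ≤ ENNReal.ofReal (Real.exp (-c)) := by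
  set g : ℕ → ℕ → S → A → (ℕ → ℝ≥0) → ℝ≥0∞ :=
    fun _ m s a v => ENNReal.ofReal (Real.exp (f m s a v)) with hg
  have hgm : ∀ τ m s a, Measurable (g τ m s a) := fun _ m s a =>
    (Real.measurable_exp.comp (hf m s a)).ennreal_ofReal
  have heq : ∀ ω, epochProd g r st act n ω = ENNReal.ofReal (Real.exp (∑ τ ∈ Ico 1 n,
      f (epochEnd (fun t => st t ω) (fun t => act t ω) n τ - τ)
      (st τ ω) (act τ ω) (r τ (st τ ω) (act τ ω) ω))) := fun ω => by
    rw [epochProd, Real.exp_sum, ENNReal.ofReal_prod_of_nonneg fun t _ => (Real.exp_pos _).le]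
  have h1 := hint.lintegral_epochProd_le_one hm hpol hgm hf1 hn
  have h2 := measurable_epochProd hint.meas_st hint.meas_act hm hgm n
  simp only [heq] at h1
  exact measure_exp_ge_le (funext heq ▸ h2) h1 c

/-- Markov's inequality for the exponential process of the transitions. -/
lemma IsInteraction.measure_transition_sum_ge_le (hint : IsInteraction M s₁ μ r st act)
    [Nonempty S] (hm : ∀ t s a, Measurable (r t s a)) {W : ℕ → Ω → S → ℝ} {C : ℕ → Ω → ℝ}
    (hW : ∀ t, 1 ≤ t → ∀ y, Measurable[pastSigma r st act t] fun ω => W t ω y)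
    (hC : ∀ t, 1 ≤ t → Measurable[pastSigma r st act t] (C t))
    (hWC : ∀ t, 1 ≤ t → ∀ ω y y', W t ω y - W t ω y' ≤ C t ω) {n : ℕ} (hn : 1 ≤ n) (c : ℝ) :
    μ {ω | c ≤ ∑ τ ∈ Ico 1 n, (∑ y, M.p (st τ ω) (act τ ω) y * W τ ω y - W τ ω (st (τ + 1) ω) -
      C τ ω ^ 2 / 8)} ≤ ENNReal.ofReal (Real.exp (-c)) := by
  have h1 := hint.lintegral_transProd_le_one hm hW hC hWC hn
  have h2 := measurable_transProd (M := M) hW hC n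
  simp only [transProd_eq] at h1
  exact measure_exp_ge_le (by
    simpa only [← transProd_eq] using h2.mono (hint.pastSigma_le hm n) le_rfl) h1 c

end Deviations

/-! ### The exceptional events -/

section Exceptional

variable {S A : Type*} [Fintype S] [DecidableEq S] [Fintype A] [DecidableEq A]
variable {Ω : Type*} [mΩ : MeasurableSpace Ω] {M : MDP S A} {s₁ : S} {μ : Measure Ω}
  {r : ℕ → S → A → Ω → ℕ → ℝ≥0} {st : ℕ → Ω → S} {act : ℕ → Ω → A}

lemma visits_lt_self (st : ℕ → S) (act : ℕ → A) {t : ℕ} (ht : 1 ≤ t) (s : S) (a : A) :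
    visits st act 1 t s a < t := by
  have := card_filter_le (Ico 1 t) fun τ => st τ = s ∧ act τ = a
  rw [Nat.card_Ico] at this
  unfold visits
  omega

/-- A sum over the occurrences of a pair with a constant subtracted from each term. -/
lemma sum_visits_sub (st : ℕ → S) (act : ℕ → A) (t : ℕ) (s : S) (a : A) (f : ℕ → ℝ) (l c : ℝ) :
    ∑ τ ∈ Ico 1 t, (if st τ = s ∧ act τ = a then l * f τ - c else 0) =
      l * (∑ τ ∈ Ico 1 t, if st τ = s ∧ act τ = a then f τ else 0) -
        c * (visits st act 1 t s a : ℝ) := by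
  unfold visits
  rw [← Finset.sum_filter, ← Finset.sum_filter, Finset.sum_sub_distrib, Finset.mul_sum,
    Finset.sum_const, nsmul_eq_mul, mul_comm c]

section Rewards

variable [IsProbabilityMeasure μ] (hint : IsInteraction M s₁ μ r st act)
  (hr : RewardAssumption M μ r) (hpol : PolicyPredictable μ r st act)

include hint hr hpol

/-- Deviations of the rewards of one pair, for a bounded function `f m` of the reward sequence and
of the delay `m` at which the epoch ends. -/
lemma IsInteraction.measure_pair_reward_le {f : ℕ → (ℕ → ℝ≥0) → ℝ} {e : ℕ → ℝ}
    (hf : ∀ m, Measurable (f m)) (s : S) (a : A)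
    (hf1 : ∀ τ, 1 ≤ τ → ∀ m, ∀ᵐ ω ∂μ, f m (r τ s a ω) ∈ Set.Icc 0 1)
    (he : ∀ τ, 1 ≤ τ → ∀ m, ∫ ω, f m (r τ s a ω) ∂μ = e m) {σ : ℝ} (hσ : σ ^ 2 = 1)
    {c : ℝ} (hc : 0 < c) {t : ℕ} (ht : 1 ≤ t) :
    μ {ω | 1 ≤ visits (fun t => st t ω) (fun t => act t ω) 1 t s a ∧
      √(c * visits (fun t => st t ω) (fun t => act t ω) 1 t s a / 2) ≤
        ∑ τ ∈ Ico 1 t, if st τ ω = s ∧ act τ ω = a then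
          σ * (f (epochEnd (fun t => st t ω) (fun t => act t ω) t τ - τ) (r τ s a ω) -
            e (epochEnd (fun t => st t ω) (fun t => act t ω) t τ - τ)) else 0} ≤
      t * ENNReal.ofReal (Real.exp (-c)) := by
  refine measure_ge_sqrt_le_mul hc (fun ω => visits_lt_self _ _ ht s a) fun l hl => ?_
  have h := hint.measure_reward_sum_ge_le hr.meas hpol (f := fun m s' a' v =>
    if s' = s ∧ a' = a then l * (σ * (f m v - e m)) - l ^ 2 / 8 else 0)
    (fun m s' a' => by
      split_ifs
      · exact ((((hf m).sub_const _).const_mul _).const_mul _).sub_const _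
      · exact measurable_const)
    (fun τ hτ m s' a' => by
      split_ifs with h
      · rw [h.1, h.2]
        have h2 := lintegral_exp_sub_le_one (ν := μ) ((hf m).comp (hr.meas τ s a)) (hf1 τ hτ m)
          (l * σ)
        simp only [Function.comp_apply] at h2
        rw [he τ hτ m] at h2
        refine le_trans (le_of_eq (lintegral_congr fun ω => ?_)) h2
        congr 2
        rw [mul_pow, hσ]
        ring
      · simp) ht c
  refine le_trans (measure_mono fun ω hω => ?_) h
  have hω' : c ≤ _ := hω
  show c ≤ _
  refine hω'.trans (le_of_eq ?_)
  rw [mul_div_right_comm, ← sum_visits_sub]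
  refine Finset.sum_congr rfl fun τ _ => ?_
  split_ifs with h
  · rw [h.1, h.2]
  · rfl

/-- Deviations of the sum of the rewards along the trajectory. -/
lemma IsInteraction.measure_reward_noise_le {c : ℝ} (hc : 0 < c) {T : ℕ} (hT : 1 ≤ T) :
    μ {ω | √(c * T / 2) ≤ ∑ τ ∈ Icc 1 T,
      (M.r (st τ ω) (act τ ω) - total (r τ (st τ ω) (act τ ω) ω))} ≤
      ENNReal.ofReal (Real.exp (-c)) := by
  have hT0 : (0 : ℝ) < T := by exact_mod_cast hT
  refine le_trans (measure_mono ?_) (measure_ge_sqrt_le (μ := μ) (V := fun _ => (T : ℝ)) hc hT0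
    (X := fun ω => ∑ τ ∈ Icc 1 T,
      (M.r (st τ ω) (act τ ω) - total (r τ (st τ ω) (act τ ω) ω))) fun l hl => ?_)
  · exact fun ω hω => ⟨rfl, hω⟩
  have h := hint.measure_reward_sum_ge_le hr.meas hpol (f := fun _ s a v =>
    (-l) * (total v - M.r s a) - (-l) ^ 2 * (1 - 0) ^ 2 / 8)
    (fun m s' a' => ((measurable_total.sub_const _).const_mul _).sub_const _)
    (fun τ hτ m s a => by
      have h2 := lintegral_exp_sub_le_one (ν := μ) (measurable_total.comp (hr.meas τ s a))
        (hr.total_mem hτ s a) (-l)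
      simp only [Function.comp_apply] at h2
      rwa [hr.integral_total hτ s a] at h2) (show 1 ≤ T + 1 by omega) c
  refine le_trans (measure_mono fun ω hω => ?_) h
  have hω' : c ≤ _ := hω
  show c ≤ _
  refine hω'.trans (le_of_eq ?_)
  rw [show Ico 1 (T + 1) = Icc 1 T by ext i; simp only [mem_Ico, mem_Icc]; omega,
    Finset.sum_sub_distrib (f := fun τ => -l * (total (r τ (st τ ω) (act τ ω) ω) -
      M.r (st τ ω) (act τ ω))), Finset.sum_const, Nat.card_Icc, ← Finset.mul_sum, nsmul_eq_mul]
  simp only [Finset.sum_sub_distrib, Nat.add_sub_cancel]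
  ring

/-- The spilled rewards of a state are at most a multiple of their conditional means. -/
lemma IsInteraction.measure_tail_le (s : S) (c : ℝ) {t : ℕ} (ht : 1 ≤ t) :
    μ {ω | c ≤ ∑ τ ∈ Ico 1 t, if st τ ω = s then
      tailSum (epochEnd (fun t => st t ω) (fun t => act t ω) t τ - τ) (r τ s (act τ ω) ω) -
        (Real.exp 1 - 1) * meanTail μ r
          (epochEnd (fun t => st t ω) (fun t => act t ω) t τ - τ) s (act τ ω) else 0} ≤
      ENNReal.ofReal (Real.exp (-c)) := by
  have h := hint.measure_reward_sum_ge_le hr.meas hpol (f := fun m s' a v =>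
    if s' = s then tailSum m v - (Real.exp 1 - 1) * meanTail μ r m s a else 0)
    (fun m s' a => by
      split_ifs
      · exact (measurable_tailSum m).sub_const _
      · exact measurable_const)
    (fun τ hτ m s' a => by
      split_ifs with h
      · rw [h]
        have h2 := lintegral_exp_sub_mul_le_one (ν := μ)
          ((measurable_tailSum m).comp (hr.meas τ s a)) (hr.tailSum_mem hτ m s a)
        simp only [Function.comp_apply] at h2
        rwa [hr.integral_tailSum hτ m s a] at h2
      · simp) ht c
  refine le_trans (measure_mono fun ω hω => ?_) h
  have hω' : c ≤ _ := hω
  show c ≤ _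
  refine hω'.trans (le_of_eq (Finset.sum_congr rfl fun τ _ => ?_))
  split_ifs with h
  · rw [h]
  · rfl

end Rewards

section Transitions

variable [IsProbabilityMeasure μ] [Nonempty S] (hint : IsInteraction M s₁ μ r st act)
  (hm : ∀ t s a, Measurable (r t s a))

include hint hm

/-- Deviations of the frequency of the transitions from `(s, a)` into the set `B`. -/
lemma IsInteraction.measure_pair_transition_le (s : S) (a : A) (B : Finset S) {c : ℝ} (hc : 0 < c)
    {t : ℕ} (ht : 1 ≤ t) :
    μ {ω | 1 ≤ visits (fun t => st t ω) (fun t => act t ω) 1 t s a ∧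
      √(c * visits (fun t => st t ω) (fun t => act t ω) 1 t s a / 2) ≤
        ∑ τ ∈ Ico 1 t, if st τ ω = s ∧ act τ ω = a then
          ∑ y ∈ B, M.p s a y - (if st (τ + 1) ω ∈ B then 1 else 0) else 0} ≤
      t * ENNReal.ofReal (Real.exp (-c)) := by
  refine measure_ge_sqrt_le_mul hc (fun ω => visits_lt_self _ _ ht s a) fun l hl => ?_
  have hown : ∀ t, 1 ≤ t → MeasurableSet[pastSigma r st act t] {ω | st t ω = s ∧ act t ω = a} :=
    fun t ht => (measurableSet_st_pastSigma ht le_rfl s).inter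
      (measurableSet_act_pastSigma ht le_rfl a)
  have h := hint.measure_transition_sum_ge_le hm
    (W := fun τ ω y => if st τ ω = s ∧ act τ ω = a then (if y ∈ B then l else 0) else 0)
    (C := fun τ ω => if st τ ω = s ∧ act τ ω = a then l else 0)
    (fun t ht y => Measurable.ite (hown t ht) measurable_const measurable_const)
    (fun t ht => Measurable.ite (hown t ht) measurable_const measurable_const)
    (fun t ht ω y y' => by
      split_ifs <;> linarith) ht c
  refine le_trans (measure_mono fun ω hω => ?_) h
  have hω' : c ≤ _ := hω
  show c ≤ _
  refine hω'.trans (le_of_eq ?_)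
  rw [mul_div_right_comm, ← sum_visits_sub]
  refine Finset.sum_congr rfl fun τ _ => ?_
  split_ifs with h h2
  · rw [h.1, h.2]
    simp only [mul_ite, mul_zero, Finset.sum_ite_mem, Finset.univ_inter, ← Finset.sum_mul]
    ring
  · rw [h.1, h.2]
    simp only [mul_ite, mul_zero, Finset.sum_ite_mem, Finset.univ_inter, ← Finset.sum_mul]
    ring
  · simp

/-- Deviations of the martingale of a predictable bounded function of the next state. -/
lemma IsInteraction.measure_transition_noise_le {W : ℕ → Ω → S → ℝ} {D : ℝ} (hD : 0 < D)
    (hW : ∀ t, 1 ≤ t → ∀ y, Measurable[pastSigma r st act t] fun ω => W t ω y)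
    (hWD : ∀ t ω y, W t ω y ∈ Set.Icc 0 D) {c : ℝ} (hc : 0 < c) {T : ℕ} (hT : 1 ≤ T) :
    μ {ω | D * √(c * T / 2) ≤ ∑ τ ∈ Icc 1 T,
      (∑ y, M.p (st τ ω) (act τ ω) y * W τ ω y - W τ ω (st (τ + 1) ω))} ≤
      ENNReal.ofReal (Real.exp (-c)) := by
  have hT0 : (0 : ℝ) < T := by exact_mod_cast hT
  refine le_trans (measure_mono ?_) (measure_ge_sqrt_le (μ := μ) (V := fun _ => D ^ 2 * T) (v := D ^ 2 * T) hc
    (by positivity) (X := fun ω => ∑ τ ∈ Icc 1 T,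
      (∑ y, M.p (st τ ω) (act τ ω) y * W τ ω y - W τ ω (st (τ + 1) ω))) fun l hl => ?_)
  · intro ω hω
    refine ⟨rfl, le_trans (le_of_eq ?_) hω⟩
    rw [show c * (D ^ 2 * T) / 2 = D ^ 2 * (c * T / 2) by ring, Real.sqrt_mul (by positivity),
      Real.sqrt_sq hD.le]
  have h := hint.measure_transition_sum_ge_le hm (W := fun τ ω y => l * W τ ω y)
    (C := fun _ _ => l * D) (fun t ht y => (hW t ht y).const_mul _) (fun t ht => measurable_const)
    (fun t ht ω y y' => by
      have h1 := hWD t ω y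
      have h2 := hWD t ω y'
      have h3 : W t ω y - W t ω y' ≤ D := by linarith [h1.2, h2.1]
      rw [← mul_sub]
      exact mul_le_mul_of_nonneg_left h3 hl.le) (show 1 ≤ T + 1 by omega) c
  refine le_trans (measure_mono fun ω hω => ?_) h
  have hω' : c ≤ _ := hω
  show c ≤ _
  refine hω'.trans (le_of_eq ?_)
  rw [show Ico 1 (T + 1) = Icc 1 T by ext i; simp only [mem_Ico, mem_Icc]; omega,
    Finset.sum_sub_distrib (f := fun τ => ∑ y, M.p (st τ ω) (act τ ω) y * (l * W τ ω y) -
      l * W τ ω (st (τ + 1) ω)), Finset.sum_const, Nat.card_Icc, nsmul_eq_mul, Finset.mul_sum]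
  simp only [Nat.add_sub_cancel, mul_sub, Finset.mul_sum, mul_left_comm l]
  ring

end Transitions

end Exceptional

/-! ### The good event -/

section GoodEvent

variable {S A : Type*} [Fintype S] [DecidableEq S] [Fintype A] [DecidableEq A]
variable {Ω : Type*} [mΩ : MeasurableSpace Ω]

/-- The deviations at time `t` are within their bounds. The fields `transition`, `total_upper`,
`head_lower` and `tail_upper` make the confidence sets of an epoch that starts at time `t` valid and
tight; the two noise terms enter the regret over `t` steps. -/
structure GoodAt (M : MDP S A) (μ : Measure Ω) (r : ℕ → S → A → Ω → ℕ → ℝ≥0) (st : ℕ → Ω → S)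
    (act : ℕ → Ω → A) (δ d D : ℝ) (t : ℕ) (ω : Ω) : Prop where
  reward_noise : ∑ τ ∈ Icc 1 t, (M.r (st τ ω) (act τ ω) - total (r τ (st τ ω) (act τ ω) ω)) <
    √(2 * Real.log (8 * t / δ) * t / 2)
  transition_noise : ∑ τ ∈ Icc 1 t, (∑ y, M.p (st τ ω) (act τ ω) y *
      biasProcess δ d D r st act τ ω y - biasProcess δ d D r st act τ ω (st (τ + 1) ω)) <
    D * √(2 * Real.log (8 * t / δ) * t / 2)
  transition : ∀ s a (B : Finset S), 1 ≤ visits (fun t => st t ω) (fun t => act t ω) 1 t s a →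
    (∑ τ ∈ Ico 1 t, if st τ ω = s ∧ act τ ω = a then
      ∑ y ∈ B, M.p s a y - (if st (τ + 1) ω ∈ B then 1 else 0) else 0) <
    √(7 * Fintype.card S * Real.log (2 * Fintype.card A * t / δ) *
      visits (fun t => st t ω) (fun t => act t ω) 1 t s a / 2)
  total_upper : ∀ s a, 1 ≤ visits (fun t => st t ω) (fun t => act t ω) 1 t s a →
    (∑ τ ∈ Ico 1 t, if st τ ω = s ∧ act τ ω = a then
      1 * (total (r τ s a ω) - M.r s a) else 0) <
    √(7 * Real.log (2 * Fintype.card S * Fintype.card A * t / δ) *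
      visits (fun t => st t ω) (fun t => act t ω) 1 t s a / 2)
  head_lower : ∀ s a, 1 ≤ visits (fun t => st t ω) (fun t => act t ω) 1 t s a →
    (∑ τ ∈ Ico 1 t, if st τ ω = s ∧ act τ ω = a then
      (-1) * (headSum (epochEnd (fun t => st t ω) (fun t => act t ω) t τ - τ) (r τ s a ω) -
        (M.r s a - meanTail μ r (epochEnd (fun t => st t ω) (fun t => act t ω) t τ - τ) s a))
        else 0) <
    √(7 * Real.log (2 * Fintype.card S * Fintype.card A * t / δ) *
      visits (fun t => st t ω) (fun t => act t ω) 1 t s a / 2)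
  tail_upper : ∀ s, (∑ τ ∈ Ico 1 t, if st τ ω = s then
      tailSum (epochEnd (fun t => st t ω) (fun t => act t ω) t τ - τ) (r τ s (act τ ω) ω) -
        (Real.exp 1 - 1) * meanTail μ r
          (epochEnd (fun t => st t ω) (fun t => act t ω) t τ - τ) s (act τ ω) else 0) <
    3 * Real.log (2 * Fintype.card S * Fintype.card A * t / δ)

lemma exp_neg_nat_mul_log (n : ℕ) {x : ℝ} (hx : 0 < x) :
    Real.exp (-(n * Real.log x)) = (x ^ n)⁻¹ := by
  rw [Real.exp_neg, Real.exp_nat_mul, Real.exp_log hx]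

lemma measure_iUnion_le_card_mul {ι : Type*} [Fintype ι] {μ : Measure Ω} {E : ι → Set Ω} {c : ℝ≥0∞}
    (h : ∀ i, μ (E i) ≤ c) : μ (⋃ i, E i) ≤ Fintype.card ι * c := by
  refine (measure_iUnion_fintype_le μ E).trans ?_
  refine (Finset.sum_le_card_nsmul _ _ c fun i _ => h i).trans (le_of_eq ?_)
  rw [nsmul_eq_mul, card_univ]

lemma two_mul_inv_pow_le {x t : ℝ} {n : ℕ} (ht : 1 ≤ t) (hx2 : 2 * t ≤ x) (hn : 7 ≤ n) :
    (x ^ n)⁻¹ ≤ 1 / (12 * t ^ 2) := by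
  have hx : 2 ≤ x := by linarith
  have h1 : x ^ 7 ≤ x ^ n := pow_le_pow_right₀ (by linarith) hn
  have h2 : (2 : ℝ) ^ 5 ≤ x ^ 5 := pow_le_pow_left₀ (by norm_num) hx 5
  have h3 : (2 * t) ^ 2 ≤ x ^ 2 := pow_le_pow_left₀ (by linarith) hx2 2
  have h4 : (2 * t) ^ 2 * 2 ^ 5 ≤ x ^ 2 * x ^ 5 := mul_le_mul h3 h2 (by norm_num) (by positivity)
  rw [one_div]
  refine inv_anti₀ (by positivity) ?_
  nlinarith [pow_add x 2 5]

/-- The probability that `p q t 2 ^ p` events of probability `x⁻⁷ᵖ` occur, `x = 2 q t / δ`. -/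
lemma transition_union_le {p q t : ℕ} {δ : ℝ} (hp : 2 ≤ p) (hq : 1 ≤ q) (ht : 1 ≤ t)
    (hδ : δ ∈ Set.Ioo (0 : ℝ) 1) :
    (p * (q * 2 ^ p) : ℝ) * (t * Real.exp (-(7 * p * Real.log (2 * q * t / δ)))) ≤
      δ / (12 * t ^ 2) := by
  obtain ⟨h0, h1⟩ := hδ
  have ht' : (1 : ℝ) ≤ t := by exact_mod_cast ht
  have hq' : (1 : ℝ) ≤ q := by exact_mod_cast hq
  have hqt : (t : ℝ) ≤ q * t := by nlinarith
  set x : ℝ := 2 * q * t / δ with hx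
  have hxδ : 2 * (q * t) = x * δ := by rw [hx]; field_simp
  have hx2 : 2 * (t : ℝ) ≤ x := by
    rw [hx, le_div_iff₀ h0]; nlinarith
  have hx0 : 2 ≤ x := by linarith
  have hexp : Real.exp (-(7 * p * Real.log x)) = (x ^ (7 * p))⁻¹ := by
    rw [← exp_neg_nat_mul_log _ (by linarith)]; push_cast; rfl
  rw [hexp]
  have h2p : (2 : ℝ) ^ p ≤ x ^ p := pow_le_pow_left₀ (by norm_num) hx0 p
  have hpp : (p : ℝ) ≤ x ^ p := le_trans (by exact_mod_cast Nat.lt_two_pow_self.le) h2p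
  have hmul : (p : ℝ) * 2 ^ p ≤ x ^ p * x ^ p := mul_le_mul hpp h2p (by positivity) (by positivity)
  have hpow : x ^ (7 * p) = x ^ p * x ^ p * (x * x ^ (5 * p - 1)) := by
    rw [← pow_add, ← pow_succ', ← pow_add]; congr 1; omega
  have hb := two_mul_inv_pow_le ht' hx2 (show 7 ≤ 5 * p - 1 by omega)
  calc (p * (q * 2 ^ p) : ℝ) * (t * (x ^ (7 * p))⁻¹)
      = (p * 2 ^ p) * (x * δ / 2) * (x ^ (7 * p))⁻¹ := by rw [← hxδ]; ring
    _ ≤ (x ^ p * x ^ p) * (x * δ / 2) * (x ^ (7 * p))⁻¹ := by gcongr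
    _ = δ / 2 * (x ^ (5 * p - 1))⁻¹ := by
        rw [hpow]; field_simp
    _ ≤ δ / 2 * (1 / (12 * t ^ 2)) := by gcongr
    _ ≤ δ / (12 * t ^ 2) := by
        rw [mul_one_div]; gcongr; linarith

lemma reward_union_le {p q t : ℕ} {δ : ℝ} (hp : 2 ≤ p) (hq : 1 ≤ q) (ht : 1 ≤ t)
    (hδ : δ ∈ Set.Ioo (0 : ℝ) 1) :
    (p * q : ℝ) * (t * Real.exp (-(7 * Real.log (2 * p * q * t / δ)))) ≤ δ / (12 * t ^ 2) ∧
    (p : ℝ) * Real.exp (-(3 * Real.log (2 * p * q * t / δ))) ≤ δ / (12 * t ^ 2) := by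
  obtain ⟨h0, h1⟩ := hδ
  have ht' : (1 : ℝ) ≤ t := by exact_mod_cast ht
  have hp' : (2 : ℝ) ≤ p := by exact_mod_cast hp
  have hqt : (1 : ℝ) ≤ q * t := by exact_mod_cast Nat.mul_pos hq ht
  have hqt' : (t : ℝ) ≤ q * t := by exact_mod_cast Nat.le_mul_of_pos_left t hq
  set x : ℝ := 2 * p * q * t / δ with hx
  have hxδ : 2 * (p * q * t) = x * δ := by rw [hx]; field_simp
  have hx4 : 4 * (t : ℝ) ≤ x := by
    rw [hx, le_div_iff₀ h0]; nlinarith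
  have hx0 : 0 < x := by linarith
  have e7 : Real.exp (-(7 * Real.log x)) = (x ^ 7)⁻¹ := by
    rw [← exp_neg_nat_mul_log _ hx0]; norm_num
  have e3 : Real.exp (-(3 * Real.log x)) = (x ^ 3)⁻¹ := by
    rw [← exp_neg_nat_mul_log _ hx0]; norm_num
  have hb2 : (x ^ 2)⁻¹ ≤ 1 / (16 * t ^ 2) := by
    rw [one_div]
    exact inv_anti₀ (by positivity) (by nlinarith)
  have hb6 : (x ^ 6)⁻¹ ≤ (x ^ 2)⁻¹ :=
    inv_anti₀ (by positivity) (pow_le_pow_right₀ (by linarith) (by norm_num))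
  have hfin : δ / 2 * (1 / (16 * t ^ 2)) ≤ δ / (12 * t ^ 2) := by
    rw [div_mul_div_comm, mul_one]
    refine div_le_div_of_nonneg_left h0.le (by positivity) ?_
    nlinarith [sq_nonneg (t : ℝ)]
  rw [e7, e3]
  constructor
  · calc (p * q : ℝ) * (t * (x ^ 7)⁻¹) = (x * δ / 2) * (x ^ 7)⁻¹ := by rw [← hxδ]; ring
      _ = δ / 2 * (x ^ 6)⁻¹ := by field_simp
      _ ≤ δ / 2 * (1 / (16 * t ^ 2)) := by gcongr; exact hb6.trans hb2
      _ ≤ _ := hfin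
  · calc (p : ℝ) * (x ^ 3)⁻¹ ≤ (x * δ / 2) * (x ^ 3)⁻¹ := by
          gcongr; rw [← hxδ]; nlinarith
      _ = δ / 2 * (x ^ 2)⁻¹ := by field_simp
      _ ≤ δ / 2 * (1 / (16 * t ^ 2)) := by gcongr
      _ ≤ _ := hfin

lemma noise_prob_le {t : ℕ} {δ : ℝ} (ht : 1 ≤ t) (hδ : δ ∈ Set.Ioo (0 : ℝ) 1) :
    Real.exp (-(2 * Real.log (8 * t / δ))) ≤ δ / (12 * t ^ 2) := by
  obtain ⟨h0, h1⟩ := hδ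
  have ht' : (1 : ℝ) ≤ t := by exact_mod_cast ht
  have e2 : Real.exp (-(2 * Real.log (8 * t / δ))) = ((8 * t / δ) ^ 2)⁻¹ := by
    rw [← exp_neg_nat_mul_log _ (by positivity)]; norm_num
  rw [e2, div_pow, inv_div, mul_pow]
  gcongr
  · nlinarith
  · norm_num

variable {M : MDP S A} {s₁ : S} {μ : Measure Ω} {r : ℕ → S → A → Ω → ℕ → ℝ≥0} {st : ℕ → Ω → S}
  {act : ℕ → Ω → A} {δ d D : ℝ} [IsProbabilityMeasure μ] [Nontrivial S] [Nonempty A]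
  (hint : IsInteraction M s₁ μ r st act) (hr : RewardAssumption M μ r)
  (hpol : PolicyPredictable μ r st act) (hδ : δ ∈ Set.Ioo (0 : ℝ) 1) (hD : 0 < D)

include hint hr hpol hδ hD

lemma IsInteraction.measure_not_goodAt_le {t : ℕ} (ht : 1 ≤ t) :
    μ {ω | ¬ GoodAt M μ r st act δ d D t ω} ≤ ENNReal.ofReal (δ / (2 * t ^ 2)) := by
  have hp : 2 ≤ Fintype.card S := Fintype.one_lt_card
  have hq : 1 ≤ Fintype.card A := Fintype.card_pos
  have ht' : (1 : ℝ) ≤ t := by exact_mod_cast ht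
  have hp' : (2 : ℝ) ≤ Fintype.card S := by exact_mod_cast hp
  have hq' : (1 : ℝ) ≤ Fintype.card A := by exact_mod_cast hq
  have hcn : 0 < 2 * Real.log (8 * t / δ) := by
    have : 1 < 8 * t / δ := by rw [one_lt_div hδ.1]; linarith [hδ.2]
    have := Real.log_pos this
    linarith
  have hct : 0 < 7 * Fintype.card S * Real.log (2 * Fintype.card A * t / δ) := by
    have : 1 < 2 * Fintype.card A * t / δ := by rw [one_lt_div hδ.1]; nlinarith [hδ.2]
    have := Real.log_pos this
    positivity
  have hL : 0 < Real.log (2 * Fintype.card S * Fintype.card A * t / δ) := by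
    refine Real.log_pos ?_
    rw [one_lt_div hδ.1]
    have : (1 : ℝ) ≤ Fintype.card A * t := by nlinarith
    nlinarith [hδ.2]
  have hcr : 0 < 7 * Real.log (2 * Fintype.card S * Fintype.card A * t / δ) := by linarith
  set b : ℝ≥0∞ := ENNReal.ofReal (δ / (12 * t ^ 2)) with hb
  have b1 := (hint.measure_reward_noise_le hr hpol hcn ht).trans
    (ENNReal.ofReal_le_ofReal (noise_prob_le ht hδ))
  have b2 := (hint.measure_transition_noise_le hr.meas hD
    (fun t ht y => measurable_biasProcess (δ := δ) (d := d) D ht y)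
    (biasProcess_mem hD.le) hcn ht).trans (ENNReal.ofReal_le_ofReal (noise_prob_le ht hδ))
  have b3 := measure_iUnion_le_card_mul (μ := μ) fun q : S × A × Finset S =>
    hint.measure_pair_transition_le hr.meas q.1 q.2.1 q.2.2 hct ht
  have b3' := b3.trans (le_of_eq_of_le (by
    simp only [Fintype.card_prod, Fintype.card_finset]
    rw [← ENNReal.ofReal_natCast, ← ENNReal.ofReal_natCast,
      ← ENNReal.ofReal_mul (by positivity), ← ENNReal.ofReal_mul (by positivity)]
    push_cast; rfl) (ENNReal.ofReal_le_ofReal (transition_union_le hp hq ht hδ)))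
  have b4 := measure_iUnion_le_card_mul (μ := μ) fun q : S × A =>
    hint.measure_pair_reward_le hr hpol (f := fun _ => total) (e := fun _ => M.r q.1 q.2)
      (fun _ => measurable_total) q.1 q.2 (fun τ hτ _ => hr.total_mem hτ _ _)
      (fun τ hτ _ => hr.integral_total hτ _ _) (one_pow 2) hcr ht
  have b5 := measure_iUnion_le_card_mul (μ := μ) fun q : S × A =>
    hint.measure_pair_reward_le hr hpol (f := headSum)
      (e := fun m => M.r q.1 q.2 - meanTail μ r m q.1 q.2)
      measurable_headSum q.1 q.2 (fun τ hτ m => hr.headSum_mem hτ m _ _)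
      (fun τ hτ m => hr.integral_headSum hτ m _ _) (neg_one_sq) hcr ht
  have hcard : (Fintype.card (S × A) : ℝ≥0∞) * (t * ENNReal.ofReal (Real.exp
      (-(7 * Real.log (2 * Fintype.card S * Fintype.card A * t / δ))))) ≤ b := by
    refine le_of_eq_of_le ?_ (ENNReal.ofReal_le_ofReal (reward_union_le hp hq ht hδ).1)
    rw [Fintype.card_prod, ← ENNReal.ofReal_natCast, ← ENNReal.ofReal_natCast,
      ← ENNReal.ofReal_mul (by positivity), ← ENNReal.ofReal_mul (by positivity)]
    push_cast; rfl
  have b6 := (measure_iUnion_le_card_mul (μ := μ) fun s : S =>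
    hint.measure_tail_le hr hpol s
      (3 * Real.log (2 * Fintype.card S * Fintype.card A * t / δ)) ht).trans
    (le_of_eq_of_le (by
      rw [← ENNReal.ofReal_natCast, ← ENNReal.ofReal_mul (by positivity)])
      (ENNReal.ofReal_le_ofReal (reward_union_le hp hq ht hδ).2))
  have hsum : b + b + b + b + b + b = ENNReal.ofReal (δ / (2 * t ^ 2)) := by
    have h0 : 0 ≤ δ / (12 * t ^ 2) := by have := hδ.1; positivity
    rw [hb, ← ENNReal.ofReal_add h0 h0, ← ENNReal.ofReal_add (by positivity) h0,
      ← ENNReal.ofReal_add (by positivity) h0, ← ENNReal.ofReal_add (by positivity) h0,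
      ← ENNReal.ofReal_add (by positivity) h0]
    congr 1
    field_simp
    ring
  rw [← hsum]
  refine le_trans (measure_mono fun ω hω => ?_) ((measure_union_le _ _).trans
    (add_le_add ((measure_union_le _ _).trans (add_le_add ((measure_union_le _ _).trans
    (add_le_add ((measure_union_le _ _).trans (add_le_add ((measure_union_le _ _).trans
    (add_le_add b1 b2)) b3')) (b4.trans hcard))) (b5.trans hcard))) b6))
  by_contra hc
  simp only [Set.mem_union, not_or, Set.mem_iUnion, not_exists, Set.mem_ofPred_eq, not_and,
    not_le] at hc
  obtain ⟨⟨⟨⟨⟨h1, h2⟩, h3⟩, h4⟩, h5⟩, h6⟩ := hc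
  exact hω ⟨h1, h2, fun s a B => h3 (s, a, B), fun s a => h4 (s, a), fun s a => h5 (s, a), h6⟩

lemma IsInteraction.measure_exists_not_goodAt_le :
    μ {ω | ∃ t, 1 ≤ t ∧ ¬ GoodAt M μ r st act δ d D t ω} ≤ ENNReal.ofReal δ := by
  have hsub : {ω | ∃ t, 1 ≤ t ∧ ¬ GoodAt M μ r st act δ d D t ω} ⊆
      ⋃ t : ℕ, {ω | 1 ≤ t ∧ ¬ GoodAt M μ r st act δ d D t ω} := fun ω ⟨t, h⟩ =>
    Set.mem_iUnion.2 ⟨t, h⟩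
  -- `∑ 1 / t ^ 2 = π ^ 2 / 6 ≤ 2`
  have hz := (hasSum_zeta_two.mul_left (δ / 2))
  refine (measure_mono hsub).trans ((measure_iUnion_le _).trans
    (le_trans (ENNReal.tsum_le_tsum (g := fun t : ℕ => ENNReal.ofReal (δ / 2 * (1 / (t : ℝ) ^ 2)))
      fun t => ?_) ?_))
  · rcases Nat.eq_zero_or_pos t with rfl | ht
    · simp
    · refine le_trans (measure_mono fun ω h => h.2) ((hint.measure_not_goodAt_le hr hpol hδ hD
        (d := d) ht).trans (ENNReal.ofReal_le_ofReal (le_of_eq ?_)))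
      field_simp
  · have h0 := hδ.1
    rw [← ENNReal.ofReal_tsum_of_nonneg (fun t => by positivity) hz.summable, hz.tsum_eq]
    refine ENNReal.ofReal_le_ofReal ?_
    have h1 := Real.pi_lt_d2
    have h2 := Real.pi_pos
    have h3 : Real.pi ^ 2 ≤ 12 := by nlinarith
    nlinarith

end GoodEvent

/-! ### Validity and accuracy of the confidence sets -/

section TransBall

variable {S : Type*} [Fintype S] [DecidableEq S]

lemma isCompact_transBall (phat : S → ℝ) (β : ℝ) : IsCompact (transBall phat β) := by
  have h : IsClosed {q : S → ℝ | ∑ y, |q y - phat y| ≤ β} :=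
    isClosed_le (by fun_prop) continuous_const
  exact (isCompact_stdSimplex (𝕜 := ℝ) (ι := S)).inter_right h

lemma sum_abs_sub_le_of_mem_transBall {phat p q : S → ℝ} {β : ℝ} (hp : p ∈ transBall phat β)
    (hq : q ∈ transBall phat β) : ∑ y, |q y - p y| ≤ 2 * β := by
  calc ∑ y, |q y - p y| ≤ ∑ y, (|q y - phat y| + |p y - phat y|) :=
        Finset.sum_le_sum fun y _ => by
          rw [abs_sub_comm (p y)]; exact abs_sub_le _ _ _
    _ ≤ 2 * β := by rw [Finset.sum_add_distrib]; linarith [hp.2, hq.2]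

/-- The `ℓ¹` distance of two vectors of the same mass, through the set on which the first is
larger. -/
lemma sum_abs_sub_eq {p q : S → ℝ} (h : ∑ y, p y = ∑ y, q y) :
    ∑ y, |p y - q y| = 2 * ∑ y with q y < p y, (p y - q y) := by
  have h1 : ∀ y, |p y - q y| = 2 * (if q y < p y then p y - q y else 0) - (p y - q y) := by
    intro y
    split_ifs with h2
    · rw [abs_of_pos (by linarith)]; ring
    · rw [abs_of_nonpos (by linarith)]; ring
  simp only [h1]
  rw [Finset.sum_sub_distrib, Finset.sum_sub_distrib p q, h, sub_self, sub_zero, ← Finset.mul_sum, Finset.sum_filter]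

end TransBall

section Confidence

variable {S A : Type*} [Fintype S] [DecidableEq S] [Fintype A] [DecidableEq A]

section Counts

variable {st : ℕ → S} {act : ℕ → A} {tk : ℕ → ℕ} {k : ℕ} {s : S} {a : A}

lemma phat_nonneg (y : S) : 0 ≤ phat st act tk k s a y := by
  unfold phat; positivity

lemma sum_phat_mul (B : Finset S) :
    (∑ y ∈ B, phat st act tk k s a y) * max 1 (countN st act tk k s a : ℝ) =
      ∑ τ ∈ Ico 1 (tk k), if st τ = s ∧ act τ = a then (if st (τ + 1) ∈ B then 1 else 0) else 0 := by
  have hpos : (0 : ℝ) < max 1 (countN st act tk k s a : ℝ) := lt_max_of_lt_left one_pos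
  unfold phat
  rw [← Finset.sum_div, div_mul_cancel₀ _ hpos.ne']
  simp only [card_filter]
  push_cast
  rw [Finset.sum_comm]
  refine Finset.sum_congr rfl fun τ _ => ?_
  split_ifs with h h2
  · simp [h.1, h.2, h2]
  · simp [h.1, h.2, h2]
  · refine Finset.sum_eq_zero fun y _ => if_neg fun h3 => h ⟨h3.1, h3.2.1⟩

lemma sum_phat_mul_univ :
    (∑ y, phat st act tk k s a y) * max 1 (countN st act tk k s a : ℝ) = countN st act tk k s a := by
  rw [sum_phat_mul]
  simp only [mem_univ, if_true, countN, visits]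
  rw [card_filter]
  push_cast
  rfl

lemma sum_phat_le_one : ∑ y, phat st act tk k s a y ≤ 1 := by
  have hpos : (0 : ℝ) < max 1 (countN st act tk k s a : ℝ) := lt_max_of_lt_left one_pos
  have h := sum_phat_mul_univ (st := st) (act := act) (tk := tk) (k := k) (s := s) (a := a)
  rw [← mul_le_mul_iff_of_pos_right hpos, h, one_mul]
  exact le_max_right _ _

end Counts

variable {Ω : Type*} [mΩ : MeasurableSpace Ω] {M : MDP S A} {μ : Measure Ω}
  {r : ℕ → S → A → Ω → ℕ → ℝ≥0} {st : ℕ → Ω → S} {act : ℕ → Ω → A} {δ d D : ℝ} {ω : Ω}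
  {tie : S → Finset A → A} {tk : ℕ → ℕ} [Nontrivial S] [Nonempty A]

lemma log_two_le_log {x : ℝ} (hδ : δ ∈ Set.Ioo (0 : ℝ) 1) (hx : 2 ≤ x) :
    Real.log 2 ≤ Real.log (x / δ) := by
  refine Real.log_le_log two_pos ?_
  rw [le_div_iff₀ hδ.1]
  nlinarith [hδ.1, hδ.2]

section

variable (hδ : δ ∈ Set.Ioo (0 : ℝ) 1) {t : ℕ} (ht : 1 ≤ t)
include hδ ht

lemma log_two_le_log_trans : Real.log 2 ≤ Real.log (2 * Fintype.card A * t / δ) := by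
  refine log_two_le_log hδ ?_
  have h1 : (1 : ℝ) ≤ Fintype.card A := by exact_mod_cast Fintype.card_pos (α := A)
  have h2 : (1 : ℝ) ≤ t := by exact_mod_cast ht
  nlinarith

lemma two_mul_log_two_le_log_reward :
    2 * Real.log 2 ≤ Real.log (2 * Fintype.card S * Fintype.card A * t / δ) := by
  have h1 : (1 : ℝ) ≤ Fintype.card A := by exact_mod_cast Fintype.card_pos (α := A)
  have h2 : (1 : ℝ) ≤ t := by exact_mod_cast ht
  have h3 : (2 : ℝ) ≤ Fintype.card S := by exact_mod_cast Fintype.one_lt_card (α := S)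
  have h4 : (1 : ℝ) ≤ Fintype.card A * t := by nlinarith
  have h5 := log_two_le_log hδ (x := Fintype.card S * Fintype.card A * t) (by nlinarith)
  have h6 : 0 < (Fintype.card S : ℝ) * Fintype.card A * t / δ := by
    have := hδ.1
    positivity
  calc 2 * Real.log 2 ≤ Real.log 2 + Real.log (Fintype.card S * Fintype.card A * t / δ) := by
        linarith
    _ = _ := by
        rw [← Real.log_mul two_ne_zero h6.ne']
        congr 1; ring

end

variable (hδ : δ ∈ Set.Ioo (0 : ℝ) 1)
  (hrun : IsDUCRL2Run δ d tie (fun t => st t ω) (fun t => act t ω) (observed r st act ω) tk)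
  (hgood : ∀ t, 1 ≤ t → GoodAt M μ r st act δ d D t ω) {k : ℕ} (hk : 1 ≤ k)

include hδ hrun hgood hk

/-- The true transition probabilities are plausible. -/
lemma IsDUCRL2Run.mem_epochBall (s : S) (a : A) :
    M.p s a ∈ epochBall δ (fun t => st t ω) (fun t => act t ω) tk k s a := by
  refine ⟨M.p_mem s a, ?_⟩
  have ht : 1 ≤ tk k := hk.trans (hrun.le_tk hk)
  have hlog := log_two_le_log_trans (A := A) hδ ht
  have hl2 := Real.log_two_gt_d9
  have hS : (2 : ℝ) ≤ Fintype.card S := by exact_mod_cast Fintype.one_lt_card (α := S)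
  have hmass := sum_phat_mul_univ (st := fun t => st t ω) (act := fun t => act t ω) (tk := tk)
    (k := k) (s := s) (a := a)
  rcases Nat.eq_zero_or_pos (countN (fun t => st t ω) (fun t => act t ω) tk k s a) with hN | hN
  · -- Without visits `phat` vanishes, so the distance is `1`, which the radius exceeds.
    have h0 : ∀ y, phat (fun t => st t ω) (fun t => act t ω) tk k s a y = 0 := by
      rw [hN] at hmass
      simp only [Nat.cast_zero, max_eq_left zero_le_one, mul_one] at hmass
      intro y
      exact (Finset.sum_eq_zero_iff_of_nonneg fun y _ => phat_nonneg y).1 hmass y (mem_univ y)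
    have h1 : ∑ y, |M.p s a y - phat (fun t => st t ω) (fun t => act t ω) tk k s a y| = 1 := by
      rw [← (M.p_mem s a).2]
      exact Finset.sum_congr rfl fun y _ => by rw [h0, sub_zero, abs_of_nonneg ((M.p_mem s a).1 y)]
    rw [h1, transRadius, hN]
    simp only [Nat.cast_zero, max_eq_left zero_le_one, div_one]
    rw [Real.one_le_sqrt]
    nlinarith
  · have hN1 : (1 : ℝ) ≤ countN (fun t => st t ω) (fun t => act t ω) tk k s a := by
      exact_mod_cast hN
    have hN0 := zero_lt_one.trans_le hN1
    rw [max_eq_right hN1] at hmass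
    have hone : ∑ y, phat (fun t => st t ω) (fun t => act t ω) tk k s a y = 1 := by
      rw [← mul_right_cancel_iff_of_pos hN0, hmass, one_mul]
    rw [sum_abs_sub_eq ((M.p_mem s a).2.trans hone.symm)]
    set B : Finset S :=
      {y | phat (fun t => st t ω) (fun t => act t ω) tk k s a y < M.p s a y} with hB
    have h1 := (hgood (tk k) ht).transition s a B hN
    have h2 := sum_phat_mul (st := fun t => st t ω) (act := fun t => act t ω) (tk := tk)
      (k := k) (s := s) (a := a) B
    rw [max_eq_right hN1] at h2
    have h3 := sum_visits_sub (fun t => st t ω) (fun t => act t ω) (tk k) s a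
      (fun τ => if st (τ + 1) ω ∈ B then 1 else 0) (-1) (-∑ y ∈ B, M.p s a y)
    have h4 : (∑ τ ∈ Ico 1 (tk k), if st τ ω = s ∧ act τ ω = a then
        ∑ y ∈ B, M.p s a y - (if st (τ + 1) ω ∈ B then 1 else 0) else 0) =
        (∑ y ∈ B, (M.p s a y - phat (fun t => st t ω) (fun t => act t ω) tk k s a y)) *
          countN (fun t => st t ω) (fun t => act t ω) tk k s a := by
      rw [Finset.sum_sub_distrib, sub_mul, h2]
      rw [show (countN (fun t => st t ω) (fun t => act t ω) tk k s a) =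
        visits (fun t => st t ω) (fun t => act t ω) 1 (tk k) s a from rfl]
      linear_combination (norm := skip) h3
      rw [← sub_eq_zero]
      have : ∀ τ, (if st τ ω = s ∧ act τ ω = a then
        ∑ y ∈ B, M.p s a y - (if st (τ + 1) ω ∈ B then (1 : ℝ) else 0) else 0) =
        if st τ ω = s ∧ act τ ω = a then
        -1 * (if st (τ + 1) ω ∈ B then 1 else 0) - -∑ y ∈ B, M.p s a y else 0 := fun τ => by
        split_ifs <;> ring
      simp only [this]
      ring
    rw [h4] at h1
    set N : ℝ := (countN (fun t => st t ω) (fun t => act t ω) tk k s a : ℝ) with hNdef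
    rw [show (visits (fun t => st t ω) (fun t => act t ω) 1 (tk k) s a : ℝ) = N from rfl] at h1
    rw [transRadius, max_eq_right hN1]
    set Λ := Real.log (2 * Fintype.card A * tk k / δ)
    have hΛ : 0 ≤ Λ := by linarith
    have h5 : √(14 * Fintype.card S * Λ / N) * N = 2 * √(7 * Fintype.card S * Λ * N / 2) := by
      rw [← sq_eq_sq₀ (by positivity) (by positivity), mul_pow, mul_pow,
        Real.sq_sqrt (by positivity), Real.sq_sqrt (by positivity)]
      field_simp
      ring
    rw [← mul_le_mul_iff_of_pos_right hN0, h5]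
    linarith

variable [IsProbabilityMeasure μ] (hr : RewardAssumption M μ r)
  (hspill : SpilloverAssumption μ r d) (hd : 0 < d)
  (hnorm : ∀ τ, 1 ≤ τ → ∀ s a, norm1 (r τ s a ω) ≤ 1)

include hr hspill hd hnorm

/-- The optimistic rewards dominate the true ones. -/
lemma IsDUCRL2Run.le_epochReward (s : S) (a : A) : M.r s a ≤
    epochReward δ d (fun t => st t ω) (fun t => act t ω) (observed r st act ω) tk k s a := by
  have ht : 1 ≤ tk k := hk.trans (hrun.le_tk hk)
  have hlog := two_mul_log_two_le_log_reward (S := S) (A := A) hδ ht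
  have hl2 := Real.log_two_gt_d9
  have hnum := hrun.head_le_numerator (ρ := fun τ s a => r τ s a ω) (fun τ s => rfl) hk s a
  unfold epochReward rhat rewardRadius
  set num := ∑ j ∈ Ico 1 k with
    0 < visits (fun t => st t ω) (fun t => act t ω) (tk j) (tk (j + 1)) s a,
    ∑ τ ∈ Ico (tk j) (tk (j + 1)), observed r st act ω τ s
  set L := Real.log (2 * Fintype.card S * Fintype.card A * tk k / δ) with hL
  set E : ℝ := (countE (fun t => st t ω) (fun t => act t ω) tk k s a : ℝ) with hE
  have hE0 : 0 ≤ E := Nat.cast_nonneg _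
  rcases Nat.eq_zero_or_pos (countN (fun t => st t ω) (fun t => act t ω) tk k s a) with hN | hN
  · -- Without visits the radius alone exceeds `1`.
    rw [hN]
    simp only [Nat.cast_zero, max_eq_left zero_le_one, div_one, mul_one]
    have h1 : 1 ≤ √(7 * L / 2) := by
      rw [Real.one_le_sqrt]; linarith
    have h2 : 0 ≤ num := le_trans (Finset.sum_nonneg fun τ _ => by
      split_ifs
      · exact headSum_nonneg _ _
      · exact le_rfl) hnum
    have h3 := (M.r_mem s a).2
    have h4 : 0 ≤ d * E := by positivity
    linarith
  · have hN1 : (1 : ℝ) ≤ countN (fun t => st t ω) (fun t => act t ω) tk k s a := by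
      exact_mod_cast hN
    have hN0 := zero_lt_one.trans_le hN1
    have h1 := (hgood (tk k) ht).head_lower s a hN
    have hspl := hrun.sum_own_spill_le hr.meanTail_nonneg (hr.sum_meanTail_le hd.le hspill) hk s a
    have h2 := sum_visits_sub (fun t => st t ω) (fun t => act t ω) (tk k) s a
      (fun τ => headSum (epochEnd (fun t => st t ω) (fun t => act t ω) (tk k) τ - τ) (r τ s a ω) +
        meanTail μ r (epochEnd (fun t => st t ω) (fun t => act t ω) (tk k) τ - τ) s a) (-1)
      (-M.r s a)
    have h3 : (∑ τ ∈ Ico 1 (tk k), if st τ ω = s ∧ act τ ω = a then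
      (-1) * (headSum (epochEnd (fun t => st t ω) (fun t => act t ω) (tk k) τ - τ) (r τ s a ω) -
        (M.r s a - meanTail μ r (epochEnd (fun t => st t ω) (fun t => act t ω) (tk k) τ - τ) s a))
        else 0) = M.r s a * countN (fun t => st t ω) (fun t => act t ω) tk k s a -
          (∑ τ ∈ Ico 1 (tk k), if st τ ω = s ∧ act τ ω = a then
            headSum (epochEnd (fun t => st t ω) (fun t => act t ω) (tk k) τ - τ) (r τ s a ω)
            else 0) -
          (∑ τ ∈ Ico 1 (tk k), if st τ ω = s ∧ act τ ω = a then
            meanTail μ r (epochEnd (fun t => st t ω) (fun t => act t ω) (tk k) τ - τ) s a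
            else 0) := by
      have e1 : ∀ τ x y, (if st τ ω = s ∧ act τ ω = a then (-1) * (x - (M.r s a - y)) else 0) =
          (if st τ ω = s ∧ act τ ω = a then (-1) * (x + y) - (-M.r s a) else 0) := fun τ x y => by
        split_ifs <;> ring
      have e2 : ∀ τ (x y : ℝ), (if st τ ω = s ∧ act τ ω = a then x + y else 0) =
          (if st τ ω = s ∧ act τ ω = a then x else 0) +
          (if st τ ω = s ∧ act τ ω = a then y else 0) := fun τ x y => by
        split_ifs <;> ring
      simp only [e1]
      rw [h2]
      simp only [e2, Finset.sum_add_distrib, countN]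
      ring
    rw [h3] at h1
    set N : ℝ := (countN (fun t => st t ω) (fun t => act t ω) tk k s a : ℝ) with hNdef
    rw [show (visits (fun t => st t ω) (fun t => act t ω) 1 (tk k) s a : ℝ) = N from rfl] at h1
    rw [max_eq_right hN1]
    have hL0 : 0 ≤ L := by linarith
    have h5 : √(7 * L / (2 * N)) * N = √(7 * L * N / 2) := by
      rw [← sq_eq_sq₀ (by positivity) (by positivity), mul_pow,
        Real.sq_sqrt (by positivity), Real.sq_sqrt (by positivity)]
      field_simp
    rw [← mul_le_mul_iff_of_pos_right hN0, add_mul, add_mul, h5, div_mul_cancel₀ _ hN0.ne',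
      mul_assoc d, div_mul_cancel₀ _ hN0.ne']
    linarith

/-- The reward estimates are accurate, up to the spilled rewards. -/
lemma IsDUCRL2Run.epochReward_sub_le (s : S) (a : A)
    (hN : 1 ≤ countN (fun t => st t ω) (fun t => act t ω) tk k s a) :
    epochReward δ d (fun t => st t ω) (fun t => act t ω) (observed r st act ω) tk k s a - M.r s a ≤
      2 * √(7 * Real.log (2 * Fintype.card S * Fintype.card A * tk k / δ) /
        (2 * countN (fun t => st t ω) (fun t => act t ω) tk k s a)) +
      (Real.exp 1 * d * (k - 1) +
        3 * Real.log (2 * Fintype.card S * Fintype.card A * tk k / δ)) /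
        countN (fun t => st t ω) (fun t => act t ω) tk k s a := by
  have ht : 1 ≤ tk k := hk.trans (hrun.le_tk hk)
  have hlog := two_mul_log_two_le_log_reward (S := S) (A := A) hδ ht
  have hl2 := Real.log_two_gt_d9
  have hnum := hrun.numerator_le (ρ := fun τ s a => r τ s a ω) (fun τ s => rfl) hnorm hk s a
  unfold epochReward rhat rewardRadius
  set num := ∑ j ∈ Ico 1 k with
    0 < visits (fun t => st t ω) (fun t => act t ω) (tk j) (tk (j + 1)) s a,
    ∑ τ ∈ Ico (tk j) (tk (j + 1)), observed r st act ω τ s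
  set L := Real.log (2 * Fintype.card S * Fintype.card A * tk k / δ) with hL
  have hEk := hrun.countE_le hk s a
  set E : ℝ := (countE (fun t => st t ω) (fun t => act t ω) tk k s a : ℝ) with hE
  have hN1 : (1 : ℝ) ≤ countN (fun t => st t ω) (fun t => act t ω) tk k s a := by
    exact_mod_cast hN
  have hN0 := zero_lt_one.trans_le hN1
  have h1 := (hgood (tk k) ht).total_upper s a hN
  have hspl := hrun.sum_all_spill_le hr.meanTail_nonneg (hr.sum_meanTail_le hd.le hspill) hk s
  have h6 := (hgood (tk k) ht).tail_upper s
  have h2 := sum_visits_sub (fun t => st t ω) (fun t => act t ω) (tk k) s a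
    (fun τ => total (r τ s a ω)) 1 (M.r s a)
  have h3 : (∑ τ ∈ Ico 1 (tk k), if st τ ω = s ∧ act τ ω = a then
      1 * (total (r τ s a ω) - M.r s a) else 0) =
      (∑ τ ∈ Ico 1 (tk k), if st τ ω = s ∧ act τ ω = a then total (r τ s a ω) else 0) -
        M.r s a * countN (fun t => st t ω) (fun t => act t ω) tk k s a := by
    simp only [one_mul] at h2 ⊢
    exact h2
  have h7 : (∑ τ ∈ Ico 1 (tk k), if st τ ω = s then
      tailSum (epochEnd (fun t => st t ω) (fun t => act t ω) (tk k) τ - τ) (r τ s (act τ ω) ω) -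
        (Real.exp 1 - 1) * meanTail μ r
          (epochEnd (fun t => st t ω) (fun t => act t ω) (tk k) τ - τ) s (act τ ω) else 0) =
      (∑ τ ∈ Ico 1 (tk k), if st τ ω = s then
        tailSum (epochEnd (fun t => st t ω) (fun t => act t ω) (tk k) τ - τ) (r τ s (act τ ω) ω)
        else 0) - (Real.exp 1 - 1) * ∑ τ ∈ Ico 1 (tk k), if st τ ω = s then meanTail μ r
          (epochEnd (fun t => st t ω) (fun t => act t ω) (tk k) τ - τ) s (act τ ω) else 0 := by
    rw [Finset.mul_sum, ← Finset.sum_sub_distrib]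
    refine Finset.sum_congr rfl fun τ _ => ?_
    split_ifs <;> ring
  have he : 1 ≤ Real.exp 1 - 1 := by linarith [Real.add_one_le_exp (1 : ℝ)]
  have h8 := mul_le_mul_of_nonneg_left hspl (zero_le_one.trans he)
  rw [h3] at h1
  rw [h7] at h6
  set N : ℝ := (countN (fun t => st t ω) (fun t => act t ω) tk k s a : ℝ) with hNdef
  rw [show (visits (fun t => st t ω) (fun t => act t ω) 1 (tk k) s a : ℝ) = N from rfl] at h1
  rw [max_eq_right hN1]
  have hL0 : 0 ≤ L := by linarith
  have h5 : √(7 * L / (2 * N)) * N = √(7 * L * N / 2) := by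
    rw [← sq_eq_sq₀ (by positivity) (by positivity), mul_pow,
      Real.sq_sqrt (by positivity), Real.sq_sqrt (by positivity)]
    field_simp
  have h9 : d * E ≤ d * (k - 1) := mul_le_mul_of_nonneg_left hEk hd.le
  rw [← mul_le_mul_iff_of_pos_right hN0, sub_mul, add_mul, add_mul, add_mul, mul_assoc 2, h5,
    div_mul_cancel₀ _ hN0.ne', div_mul_cancel₀ _ hN0.ne', mul_assoc d, div_mul_cancel₀ _ hN0.ne']
  linarith

end Confidence

/-! ### The regret on the good event -/

section Regret

variable {S A : Type*} [Fintype S] [DecidableEq S] [Fintype A] [DecidableEq A]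
variable {Ω : Type*} [mΩ : MeasurableSpace Ω] {M : MDP S A} {μ : Measure Ω}
  {r : ℕ → S → A → Ω → ℕ → ℝ≥0} {st : ℕ → Ω → S} {act : ℕ → Ω → A} {δ d : ℝ} {ω : Ω}
  {tie : S → Finset A → A} {tk : ℕ → ℕ} [Nontrivial S] [Nonempty A]

lemma biasProcess_succ {D : ℝ} {t : ℕ} (ht : 1 ≤ t)
    (h : epochStart (fun t => st t ω) (fun t => act t ω) (t + 1) =
      epochStart (fun t => st t ω) (fun t => act t ω) t) :
    biasProcess δ d D r st act (t + 1) ω = biasProcess δ d D r st act t ω := by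
  have h1 := epochStart_le (st := fun t => st t ω) (act := fun t => act t ω) ht
  have h2 : epochIdx (fun t => st t ω) (fun t => act t ω) (t + 1) =
      epochIdx (fun t => st t ω) (fun t => act t ω) t := by
    rw [epochIdx_succ, if_neg (by omega), add_zero]
  funext y
  rw [biasProcess, biasProcess, h2]

/-- The bonus of a pair that has been visited `n` times, with logarithmic factor at most `L`. -/
lemma bonus_le {D L l n x y z : ℝ} (hD : 1 ≤ D) (hl : 0 ≤ l) (hlL : l ≤ L) (hL : 1 ≤ L)
    (hn : 1 ≤ n) (hz : 0 ≤ z)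
    (hx : 16 * L ≤ n → x ≤ 2 * √(7 * l / (2 * n)) + (z + 3 * l) / n) (hy : y = min (D + 1) x) :
    y ≤ 9 / 2 * √L * (1 / √n) + 2 * D * (if n < 16 * L then 1 else 0) + z / n := by
  have hn0 : 0 < n := by linarith
  have hsn : 0 < √n := Real.sqrt_pos.2 hn0
  have hsL : 0 < √L := Real.sqrt_pos.2 (by linarith)
  split_ifs with h
  · have h1 : y ≤ D + 1 := hy ▸ min_le_left _ _
    have h2 : 0 ≤ 9 / 2 * √L * (1 / √n) := by positivity
    have h3 : 0 ≤ z / n := by positivity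
    linarith
  · rw [not_lt] at h
    have h1 : y ≤ x := hy ▸ min_le_right _ _
    have h2 := hx h
    have h3 : √(7 * l / (2 * n)) ≤ 15 / 8 * √L * (1 / √n) := by
      rw [Real.sqrt_le_left (by positivity), mul_pow, mul_pow, Real.sq_sqrt (by linarith),
        one_div, inv_pow, Real.sq_sqrt hn0.le, ← div_eq_mul_inv, div_le_div_iff₀ (by positivity) hn0]
      nlinarith
    have h4 : 3 * l / n ≤ 3 / 4 * √L * (1 / √n) := by
      have h5 : 4 * √L ≤ √n := by
        rw [Real.le_sqrt (by positivity) hn0.le, mul_pow, Real.sq_sqrt (by linarith)]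
        linarith
      calc 3 * l / n ≤ 3 * L / n := by gcongr
        _ = 3 * (√L * √L) / (√n * √n) := by
            rw [Real.mul_self_sqrt (by linarith), Real.mul_self_sqrt hn0.le]
        _ = 3 * (√L / √n) * (√L * (1 / √n)) := by field_simp
        _ ≤ 3 * (1 / 4) * (√L * (1 / √n)) := by
            have : √L / √n ≤ 1 / 4 := by rw [div_le_iff₀ hsn]; linarith
            gcongr
        _ = _ := by ring
    rw [add_div] at h2
    simp only [mul_zero, add_zero]
    linarith

section

variable (hD : M.diameter < ⊤) (hδ : δ ∈ Set.Ioo (0 : ℝ) 1)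
  (htie : ∀ s F, F.Nonempty → tie s F ∈ F)
  (hrun : IsDUCRL2Run δ d tie (fun t => st t ω) (fun t => act t ω) (observed r st act ω) tk)
  (hgood : ∀ t, 1 ≤ t → GoodAt M μ r st act δ d M.diameter.toReal t ω)
  [IsProbabilityMeasure μ] (hr : RewardAssumption M μ r)
  (hspill : SpilloverAssumption μ r d) (hd : 0 < d)
  (hnorm : ∀ τ, 1 ≤ τ → ∀ s a, norm1 (r τ s a ω) ≤ 1)

include hD hδ htie hrun hgood hr hspill hd hnorm

/-- The regret of one step. -/
lemma IsDUCRL2Run.step_regret_le {t T : ℕ} (ht : 1 ≤ t) (htT : t ≤ T) {L : ℝ}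
    (hL : L = Real.log (2 * Fintype.card S * Fintype.card A * T / δ)) :
    M.optGain - M.r (st t ω) (act t ω) ≤
      (1 + M.diameter.toReal * √(14 * Fintype.card S * L) + 9 / 2 * √L) *
        (1 / √(startCount (fun t => st t ω) (fun t => act t ω) t)) +
      2 * M.diameter.toReal *
        (if startCount (fun t => st t ω) (fun t => act t ω) t < 16 * L then 1 else 0) +
      Real.exp 1 * d * (((epochIdx (fun t => st t ω) (fun t => act t ω) t : ℝ) - 1) /
        startCount (fun t => st t ω) (fun t => act t ω) t) +
      (∑ y, M.p (st t ω) (act t ω) y * biasProcess δ d M.diameter.toReal r st act t ω y -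
        biasProcess δ d M.diameter.toReal r st act t ω (st t ω)) := by
  set k := epochIdx (fun t => st t ω) (fun t => act t ω) t with hkdef
  have hk : 1 ≤ k := one_le_epochIdx ht
  have htk : tk k = epochStart (fun t => st t ω) (fun t => act t ω) t := hrun.tk_epochIdx ht
  have htk1 : 1 ≤ tk k := hk.trans (hrun.le_tk hk)
  have htkt : tk k ≤ t := htk ▸ epochStart_le ht
  have hact := hrun.act_eq k hk t htkt (hrun.lt_tk_epochIdx_succ ht)
  have hD1 := M.one_le_diameter_toReal hD
  set D := M.diameter.toReal
  set s := st t ω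
  set a := act t ω
  set R := epochReward δ d (fun t => st t ω) (fun t => act t ω) (observed r st act ω) tk k with hR
  set P := epochBall δ (fun t => st t ω) (fun t => act t ω) tk k with hP
  have hMP : ∀ s a, M.p s a ∈ P s a := fun s a => hrun.mem_epochBall hδ hgood hk s a
  have hMR : ∀ s a, M.r s a ≤ R s a := fun s a =>
    hrun.le_epochReward hδ hgood hk hr hspill hd hnorm s a
  have hPs : ∀ s a, P s a ⊆ stdSimplex ℝ S := fun _ _ => transBall_subset _ _
  have htkpos : (0 : ℝ) < tk k := by exact_mod_cast htk1
  have hradius : ∀ s a, 0 < transRadius δ (fun t => st t ω) (fun t => act t ω) tk k s a := by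
    intro s a
    refine Real.sqrt_pos.2 (div_pos ?_ (lt_max_of_lt_left one_pos))
    have h1 := log_two_le_log_trans (A := A) hδ htk1
    have h2 := Real.log_two_gt_d9
    have h3 : (0 : ℝ) < Fintype.card S := by exact_mod_cast Fintype.card_pos
    have h4 : 0 < Real.log (2 * Fintype.card A * tk k / δ) := by linarith
    positivity
  have hstep := optGain_sub_le M hD hPs (fun _ _ => isCompact_transBall _ _)
    (fun s a => canMoveMass_transBall phat_nonneg sum_phat_le_one (hradius s a)) hMP hMR
    (ε := 1 / √(tk k : ℝ)) (by positivity) tie htie s (a := a) hact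
    (β := transRadius δ (fun t => st t ω) (fun t => act t ω) tk k s a)
    fun q hq => sum_abs_sub_le_of_mem_transBall (hMP s a) hq
  -- The clamping in `biasProcess` has no effect.
  have hbias : ∀ y, biasProcess δ d D r st act t ω y = eviBias R P (1 / √(tk k : ℝ)) y := by
    intro y
    have h1 : epochBias δ d (fun t => st t ω) (fun t => act t ω) (observed r st act ω)
        (epochBegin (fun t => st t ω) (fun t => act t ω)) k =
        epochBias δ d (fun t => st t ω) (fun t => act t ω) (observed r st act ω) tk k :=
      epochBias_congr ⟨fun _ _ => rfl, fun _ _ => rfl⟩ hk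
        (fun j hj => hrun.epochBegin_eq (mem_Icc.1 hj).1) (epochBegin_mono ht hkdef.le)
        fun _ _ => rfl
    rw [biasProcess, ← hkdef, h1]
    change max 0 (min D (eviBias R P (1 / √(tk k : ℝ)) y)) = _
    rw [min_eq_right (eviBias_le M hD hPs hMP
      (fun s a => (M.r_mem s a).1.trans (hMR s a)) _ y), max_eq_right (eviBias_nonneg _ y)]
  have hn : startCount (fun t => st t ω) (fun t => act t ω) t =
      max 1 (countN (fun t => st t ω) (fun t => act t ω) tk k s a : ℝ) := by
    rw [startCount, countN, htk]
  have hn1 := one_le_startCount (st := fun t => st t ω) (act := fun t => act t ω) t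
  have hntk : startCount (fun t => st t ω) (fun t => act t ω) t ≤ tk k := by
    rw [htk]; exact startCount_le
  set n := startCount (fun t => st t ω) (fun t => act t ω) t
  have hn0 : 0 < n := by linarith
  have hcS : (2 : ℝ) ≤ Fintype.card S := by exact_mod_cast Fintype.one_lt_card (α := S)
  have hcA : (1 : ℝ) ≤ Fintype.card A := by exact_mod_cast Fintype.card_pos (α := A)
  have htkT : (tk k : ℝ) ≤ T := by exact_mod_cast htkt.trans htT
  have hlogR := two_mul_log_two_le_log_reward (S := S) (A := A) hδ htk1
  have hlog2 := Real.log_two_gt_d9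
  have hlL : Real.log (2 * Fintype.card S * Fintype.card A * tk k / δ) ≤ L := by
    rw [hL]
    have := hδ.1
    exact Real.log_le_log (by positivity) (by gcongr)
  have hΛL : Real.log (2 * Fintype.card A * tk k / δ) ≤ L := by
    refine le_trans (Real.log_le_log (by have := hδ.1; positivity) ?_) hlL
    have := hδ.1
    gcongr
    nlinarith
  have hβ : transRadius δ (fun t => st t ω) (fun t => act t ω) tk k s a ≤
      √(14 * Fintype.card S * L) * (1 / √n) := by
    rw [mul_one_div, ← Real.sqrt_div (by nlinarith), transRadius, ← hn]
    gcongr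
  have hε : 1 / √(tk k : ℝ) ≤ 1 / √n := by gcongr
  have hb := bonus_le (D := D) (L := L)
    (l := Real.log (2 * Fintype.card S * Fintype.card A * tk k / δ)) (n := n)
    (x := R s a - M.r s a) (z := Real.exp 1 * d * ((k : ℝ) - 1)) hD1 (by linarith) hlL
    (by linarith) hn1 (by
      have : (1 : ℝ) ≤ k := by exact_mod_cast hk
      have := (Real.exp_pos 1)
      exact mul_nonneg (by positivity) (by linarith)) (fun h16 => by
      -- `max 1 N ≥ 16 L > 1` excludes `N = 0`.
      have hN1 : 1 ≤ countN (fun t => st t ω) (fun t => act t ω) tk k s a := by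
        by_contra hc
        have h0 : countN (fun t => st t ω) (fun t => act t ω) tk k s a = 0 := by omega
        rw [hn, h0] at h16
        simp only [Nat.cast_zero, max_eq_left zero_le_one] at h16
        linarith
      have h := hrun.epochReward_sub_le hδ hgood hk hr hspill hd hnorm s a hN1
      rw [max_eq_right (by exact_mod_cast hN1)] at hn
      rw [hn]
      exact h) rfl
  simp only [hbias]
  have hDβ := mul_le_mul_of_nonneg_left hβ (show 0 ≤ D by linarith)
  rw [mul_div_assoc (Real.exp 1 * d)] at hb
  linarith

/-- The sum of the step regrets. -/
lemma IsDUCRL2Run.regret_le {T : ℕ} (hT : 1 ≤ T) {L : ℝ}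
    (hL : L = Real.log (2 * Fintype.card S * Fintype.card A * T / δ)) :
    regret M r st act T ω ≤
      (1 + M.diameter.toReal * √(14 * Fintype.card S * L) + 9 / 2 * √L) *
        (2 * √2 * √((Fintype.card S : ℝ) * Fintype.card A * T)) +
      2 * M.diameter.toReal * ((Fintype.card S : ℝ) * Fintype.card A * (2 * (16 * L))) +
      Real.exp 1 * d * ((Fintype.card S : ℝ) * Fintype.card A *
        ((epochIdx (fun t => st t ω) (fun t => act t ω) T : ℝ) ^ 2 / 2)) +
      M.diameter.toReal * (epochIdx (fun t => st t ω) (fun t => act t ω) T : ℝ) +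
      (1 + M.diameter.toReal) * √(2 * Real.log (8 * T / δ) * T / 2) := by
  have hD1 := M.one_le_diameter_toReal hD
  have hL0 : 0 ≤ L := by
    have := two_mul_log_two_le_log_reward (S := S) (A := A) hδ hT
    have := Real.log_two_gt_d9
    rw [hL]; linarith
  have hvis : ∀ t, 1 ≤ t → _ := fun t ht => hrun.visits_lt ht
  have h1 := Finset.sum_le_sum fun t (ht : t ∈ Icc 1 T) => hrun.step_regret_le hD hδ htie hgood hr
    hspill hd hnorm (mem_Icc.1 ht).1 (mem_Icc.1 ht).2 hL
  simp only [Finset.sum_add_distrib, ← Finset.mul_sum] at h1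
  have h2 := sum_inv_sqrt_startCount_le hvis T
  have h3 := sum_startCount_lt_le hvis T (show 0 ≤ 16 * L by linarith)
  have h4 := sum_epochIdx_div_startCount_le hvis hT
  have h5 := sum_bias_increments_le (st := fun t => st t ω) (act := fun t => act t ω)
    (W := fun t => biasProcess δ d M.diameter.toReal r st act t ω) (D := M.diameter.toReal)
    (fun t _ y => biasProcess_mem (by linarith) t ω y) (fun t ht h => biasProcess_succ ht h) hT
  have h6 := (hgood T hT).transition_noise
  have h7 := (hgood T hT).reward_noise
  set D := M.diameter.toReal
  have h8 : regret M r st act T ω =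
      ∑ t ∈ Icc 1 T, (M.optGain - M.r (st t ω) (act t ω)) +
        ∑ t ∈ Icc 1 T, (M.r (st t ω) (act t ω) - total (r t (st t ω) (act t ω) ω)) := by
    rw [← Finset.sum_add_distrib]
    simp only [sub_add_sub_cancel, Finset.sum_sub_distrib, Finset.sum_const, Nat.card_Icc,
      nsmul_eq_mul, Nat.add_sub_cancel]
    rfl
  have h9 : ∑ t ∈ Icc 1 T, (∑ y, M.p (st t ω) (act t ω) y * biasProcess δ d D r st act t ω y -
        biasProcess δ d D r st act t ω (st t ω)) =
      ∑ t ∈ Icc 1 T, (∑ y, M.p (st t ω) (act t ω) y * biasProcess δ d D r st act t ω y -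
        biasProcess δ d D r st act t ω (st (t + 1) ω)) +
      ∑ t ∈ Icc 1 T, (biasProcess δ d D r st act t ω (st (t + 1) ω) -
        biasProcess δ d D r st act t ω (st t ω)) := by
    rw [← Finset.sum_add_distrib]
    exact Finset.sum_congr rfl fun t _ => by ring
  rw [h9] at h1
  have hsL := Real.sqrt_nonneg L
  have hsL2 := Real.sqrt_nonneg (14 * Fintype.card S * L)
  have m2 := mul_le_mul_of_nonneg_left h2
    (show 0 ≤ 1 + D * √(14 * Fintype.card S * L) + 9 / 2 * √L by positivity)
  have m3 := mul_le_mul_of_nonneg_left h3 (show 0 ≤ 2 * D by linarith)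
  have m4 := mul_le_mul_of_nonneg_left h4 (show 0 ≤ Real.exp 1 * d by positivity)
  rw [h8]
  linarith

end

end Regret

/-! ### Numerical constants -/

section Constants

lemma le_of_sq_le_sq_of_nonneg {x y : ℝ} (hy : 0 ≤ y) (h : x ^ 2 ≤ y ^ 2) : x ≤ y :=
  (abs_le_of_sq_le_sq' h hy).2

/-- Unless the bound exceeds the trivial bound `T`, the horizon is long. -/
lemma long_horizon {D p q t δ : ℝ} (hD : 1 ≤ D) (hp : 2 ≤ p) (hq : 1 ≤ q) (ht : 2 ≤ t)
    (hδ : δ ∈ Set.Ioo (0 : ℝ) 1) (h : 34 * D * p * √(q * t * Real.log (t / δ)) < t) :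
    8 ≤ Real.log (t / δ) ∧ 1156 * (D * p) ^ 2 * q * Real.log (t / δ) < t := by
  have hδ0 := hδ.1
  have htδ : t ≤ t / δ := by rw [le_div_iff₀ hδ0]; nlinarith [hδ.2]
  have hlog2 := Real.log_two_gt_d9
  have hl1 : Real.log 2 ≤ Real.log (t / δ) := Real.log_le_log two_pos (ht.trans htδ)
  have hlt : 1156 * (D * p) ^ 2 * q * Real.log (t / δ) < t := by
    have h1 := pow_lt_pow_left₀ h (by positivity) two_ne_zero
    rw [mul_pow, Real.sq_sqrt (mul_nonneg (by positivity) (by linarith))] at h1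
    have h2 : t * (1156 * (D * p) ^ 2 * q * Real.log (t / δ)) < t * t := by
      calc _ = (34 * D * p) ^ 2 * (q * t * Real.log (t / δ)) := by ring
        _ < t ^ 2 := h1
        _ = t * t := sq t
    exact lt_of_mul_lt_mul_left h2 (by linarith)
  refine ⟨?_, hlt⟩
  have h4 : (4 : ℝ) ≤ (D * p) ^ 2 := by nlinarith [mul_le_mul hD hp (by norm_num) (by linarith)]
  have h5 : 4 ≤ (D * p) ^ 2 * q := by nlinarith
  have h6 : 3000 ≤ t := by nlinarith
  refine le_trans ?_ (Real.log_le_log (by linarith) htδ)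
  rw [Real.le_log_iff_exp_le (by linarith), show (8 : ℝ) = (8 : ℕ) * 1 by norm_num,
    Real.exp_nat_mul]
  calc Real.exp 1 ^ 8 ≤ 2.7182818286 ^ 8 :=
        pow_le_pow_left₀ (Real.exp_pos 1).le Real.exp_one_lt_d9.le 8
    _ ≤ 3000 := by norm_num
    _ ≤ t := h6

/-- The terms of the regret bound add up to the claimed constants. In units of
`D p √(q t log (t / δ))`, the first product is at most `1 + 15 + 12.8`, the term in `2 D` is at most
`1.9`, and the last two terms are at most `0.1 + 1.5`; the term in `d` is dealt with by the second
summand of the bound. -/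
lemma regret_constants {D p q t δ d K L : ℝ} (hD : 1 ≤ D) (hp : 2 ≤ p) (hq : 1 ≤ q) (ht : 2 ≤ t)
    (hδ : δ ∈ Set.Ioo (0 : ℝ) 1) (hd : 0 < d) (hK0 : 0 ≤ K)
    (hK : K ≤ p * q * Real.logb 2 (8 * t / (p * q)))
    (hL : L = Real.log (2 * p * q * t / δ))
    (h8 : 8 ≤ Real.log (t / δ)) (hlong : 1156 * (D * p) ^ 2 * q * Real.log (t / δ) < t) :
    (1 + D * √(14 * p * L) + 9 / 2 * √L) * (2 * √2 * √(p * q * t)) +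
      2 * D * (p * q * (2 * (16 * L))) + Real.exp 1 * d * (p * q * (K ^ 2 / 2)) +
      D * K + (1 + D) * √(2 * Real.log (8 * t / δ) * t / 2) ≤
    34 * D * p * √(q * t * Real.log (t / δ)) +
      2 * d * (p * q) ^ 3 * Real.logb 2 (8 * t / (p * q)) ^ 2 := by
  have hδ0 := hδ.1
  set l := Real.log (t / δ) with hl
  have hpq : 2 ≤ p * q := by nlinarith
  have hDp : 1 ≤ D * p := by nlinarith
  have htδ : t ≤ t / δ := by rw [le_div_iff₀ hδ0]; nlinarith [hδ.2]
  have hpqt : 8 * (p * q) ≤ t := by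
    have h1 : p * q ≤ (D * p) ^ 2 * q := by
      have : p ≤ (D * p) ^ 2 := by nlinarith
      nlinarith
    nlinarith
  have hlog : ∀ x, 0 < x → x ≤ t / δ → Real.log (x * (t / δ)) ≤ 2 * l := fun x hx hxt => by
    rw [Real.log_mul hx.ne' (by positivity)]
    have := Real.log_le_log hx hxt
    linarith
  have hL2 : L ≤ 2 * l := by
    rw [hL, show 2 * p * q * t / δ = (2 * p * q) * (t / δ) by ring]
    exact hlog _ (by positivity) (by linarith)
  have hN2 : Real.log (8 * t / δ) ≤ 2 * l := by
    rw [show 8 * t / δ = 8 * (t / δ) by ring]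
    exact hlog _ (by positivity) (by linarith)
  have hL0 : 0 ≤ L := by
    rw [hL]
    refine Real.log_nonneg ?_
    rw [show 2 * p * q * t / δ = (2 * p * q) * (t / δ) by ring]
    nlinarith
  have hlogb : Real.logb 2 (8 * t / (p * q)) ≤ 3 * l := by
    have h1 : Real.log (8 * t / (p * q)) ≤ 2 * l := by
      refine le_trans (Real.log_le_log (by positivity) ?_) (hlog 4 (by norm_num) (by linarith))
      calc 8 * t / (p * q) ≤ 8 * t / 2 := by gcongr
        _ = 4 * t := by ring
        _ ≤ 4 * (t / δ) := by linarith
    have hlog2 := Real.log_two_gt_d9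
    rw [Real.logb, div_le_iff₀ (by linarith)]
    nlinarith
  set u := √(q * t * l) with hu
  have hu0 : 0 ≤ u := Real.sqrt_nonneg _
  have hu2 : u ^ 2 = q * t * l := Real.sq_sqrt (by positivity)
  -- `D p q l` is the size of the terms that do not grow with `t`.
  have hy : 34 * (D * p * q * l) ≤ u := by
    refine le_of_sq_le_sq_of_nonneg hu0 ?_
    have h1 := mul_le_mul_of_nonneg_left hlong.le (show 0 ≤ q * l by positivity)
    rw [hu2]
    linarith
  have hU : 2 * u ≤ D * p * u := by
    have : 2 ≤ D * p := by nlinarith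
    gcongr
  set Y := 2 * √2 * √(p * q * t) with hY
  have hY0 : 0 ≤ Y := by positivity
  have hY2 : Y ^ 2 = 8 * (p * q * t) := by
    rw [hY, mul_pow, mul_pow, Real.sq_sqrt (by norm_num), Real.sq_sqrt (by positivity)]; ring
  have hp2 : 2 * p ≤ p ^ 2 := by nlinarith
  have hpu : p * (q * t * l) * 2 ≤ (p * u) ^ 2 := by
    rw [mul_pow, hu2]
    have := mul_le_mul_of_nonneg_right hp2 (show 0 ≤ q * t * l by positivity)
    linarith
  have hqt : 0 ≤ p * (q * t) := by positivity
  have hpuD : p * u ≤ D * p * u := by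
    rw [mul_assoc]; exact le_mul_of_one_le_left (by positivity) hD
  have c1 : Y ≤ D * p * u := by
    have : Y ≤ p * u := by
      refine le_of_sq_le_sq_of_nonneg (by positivity) (le_trans ?_ hpu)
      rw [hY2]
      have := mul_le_mul_of_nonneg_left h8 hqt
      linarith
    exact this.trans (hpuD)
  have c2 : √(14 * p * L) * Y ≤ 15 * (p * u) := by
    refine le_of_sq_le_sq_of_nonneg (by positivity) ?_
    rw [mul_pow, hY2, Real.sq_sqrt (by positivity), mul_pow, mul_pow, hu2]
    have h1 : p * (p * (q * t)) * L ≤ p * (p * (q * t)) * (2 * l) := by gcongr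
    have h2 : 0 ≤ p * (p * (q * t)) * l := by positivity
    linarith
  have c3 : √L * Y ≤ 283 / 100 * (p * u) := by
    refine le_of_sq_le_sq_of_nonneg (by positivity) ?_
    rw [mul_pow, hY2, Real.sq_sqrt hL0, mul_pow (283 / 100)]
    have h1 : p * (q * t) * L ≤ p * (q * t) * (2 * l) := by gcongr
    have h2 := sq_nonneg (p * u)
    linarith
  have c4 : √(2 * Real.log (8 * t / δ) * t / 2) ≤ 142 / 100 * u := by
    rw [Real.sqrt_le_left (by positivity), mul_pow, hu2]
    have h1 : Real.log (8 * t / δ) * t ≤ 2 * l * t := by gcongr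
    have h2 : l * t ≤ q * (l * t) := le_mul_of_one_le_left (by positivity) hq
    linarith [show 0 ≤ l * t by positivity]
  have c5 : D * (p * q * L) ≤ D * (p * q * (2 * l)) := by gcongr
  have c6 : D * K ≤ D * (p * q * (3 * l)) := by
    have := hK.trans (mul_le_mul_of_nonneg_left hlogb (show 0 ≤ p * q by linarith))
    gcongr
  have c7 : Real.exp 1 * d * (p * q * (K ^ 2 / 2)) ≤
      2 * d * (p * q) ^ 3 * Real.logb 2 (8 * t / (p * q)) ^ 2 := by
    have h1 : K ^ 2 ≤ (p * q * Real.logb 2 (8 * t / (p * q))) ^ 2 := pow_le_pow_left₀ hK0 hK 2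
    have h2 : Real.exp 1 ≤ 4 := by linarith [Real.exp_one_lt_d9]
    calc Real.exp 1 * d * (p * q * (K ^ 2 / 2))
        ≤ 4 * d * (p * q * ((p * q * Real.logb 2 (8 * t / (p * q))) ^ 2 / 2)) := by gcongr
      _ = _ := by ring
  have m2 := mul_le_mul_of_nonneg_left c2 (show 0 ≤ D by linarith)
  have m4 := mul_le_mul_of_nonneg_left c4 (show 0 ≤ 1 + D by linarith)
  have m5 : (1 + D) * u ≤ D * p * u := by
    have : 1 + D ≤ D * p := by nlinarith
    gcongr
  linarith

end Constants

/-! ### Conclusion -/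

section Conclusion

variable {S A : Type*} [Fintype S] [DecidableEq S] [Fintype A] [DecidableEq A]
variable {Ω : Type*} [mΩ : MeasurableSpace Ω] {M : MDP S A} {μ : Measure Ω}
  {r : ℕ → S → A → Ω → ℕ → ℝ≥0} {st : ℕ → Ω → S} {act : ℕ → Ω → A} {δ d : ℝ} {ω : Ω}
  {tie : S → Finset A → A} {tk : ℕ → ℕ} [Nontrivial S] [Nonempty A] {s₁ : S}

lemma regret_le_horizon (T : ℕ) : regret M r st act T ω ≤ T := by
  have h1 := M.optGain_le_one
  have h2 : 0 ≤ ∑ t ∈ Icc 1 T, (norm1 (r t (st t ω) (act t ω) ω)).toReal :=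
    Finset.sum_nonneg fun _ _ => ENNReal.toReal_nonneg
  have h3 : (T : ℝ) * M.optGain ≤ T := mul_le_of_le_one_right (Nat.cast_nonneg T) h1
  unfold regret
  linarith

/-- The regret bound with confidence parameter `δ` and horizon `T`. -/
noncomputable def regretBound (M : MDP S A) (d δ : ℝ) (T : ℕ) : ℝ :=
  34 * M.diameter.toReal * Fintype.card S * √(Fintype.card A * T * Real.log (T / δ)) +
    2 * d * ((Fintype.card S : ℝ) * Fintype.card A) ^ 3 *
      (Real.logb 2 (8 * T / ((Fintype.card S : ℝ) * Fintype.card A))) ^ 2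

lemma regretBound_nonneg (M : MDP S A) (hd : 0 < d) (δ : ℝ) (T : ℕ) : 0 ≤ regretBound M d δ T := by
  have : 0 ≤ M.diameter.toReal := ENNReal.toReal_nonneg
  unfold regretBound
  positivity

variable (hD : M.diameter < ⊤) (hδ : δ ∈ Set.Ioo (0 : ℝ) 1)
  (htie : ∀ s F, F.Nonempty → tie s F ∈ F) [IsProbabilityMeasure μ] (hr : RewardAssumption M μ r)
  (hspill : SpilloverAssumption μ r d) (hd : 0 < d)

include hD hδ htie hr hspill hd

lemma IsDUCRL2Run.regret_le_regretBound
    (hrun : IsDUCRL2Run δ d tie (fun t => st t ω) (fun t => act t ω) (observed r st act ω) tk)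
    (hgood : ∀ t, 1 ≤ t → GoodAt M μ r st act δ d M.diameter.toReal t ω)
    (hnorm : ∀ τ, 1 ≤ τ → ∀ s a, norm1 (r τ s a ω) ≤ 1) {T : ℕ} (hT : 1 < T) :
    regret M r st act T ω ≤ regretBound M d δ T := by
  have hD1 := M.one_le_diameter_toReal hD
  have hp : (2 : ℝ) ≤ Fintype.card S := by exact_mod_cast Fintype.one_lt_card (α := S)
  have hq : (1 : ℝ) ≤ Fintype.card A := by exact_mod_cast Fintype.card_pos (α := A)
  have ht : (2 : ℝ) ≤ T := by exact_mod_cast hT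
  have h0 : 0 ≤ 2 * d * ((Fintype.card S : ℝ) * Fintype.card A) ^ 3 *
      (Real.logb 2 (8 * T / ((Fintype.card S : ℝ) * Fintype.card A))) ^ 2 := by positivity
  rcases le_or_gt (T : ℝ) (34 * M.diameter.toReal * Fintype.card S *
    √(Fintype.card A * T * Real.log (T / δ))) with h | h
  · -- The claimed bound exceeds the trivial one.
    have := regret_le_horizon (M := M) (r := r) (st := st) (act := act) (ω := ω) T
    unfold regretBound
    linarith
  · obtain ⟨h8, hlong⟩ := long_horizon hD1 hp hq ht hδ h
    have hpq : (Fintype.card S : ℝ) * Fintype.card A ≤ T := by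
      have h1 : (Fintype.card S : ℝ) ≤ (M.diameter.toReal * Fintype.card S) ^ 2 := by
        have : (Fintype.card S : ℝ) ≤ M.diameter.toReal * Fintype.card S := by nlinarith
        nlinarith
      have h2 : (Fintype.card S : ℝ) * Fintype.card A ≤
          (M.diameter.toReal * Fintype.card S) ^ 2 * Fintype.card A := by gcongr
      nlinarith
    exact (hrun.regret_le hD hδ htie hgood hr hspill hd hnorm hT.le rfl).trans
      (regret_constants hD1 hp hq ht hδ hd (Nat.cast_nonneg _) (hrun.epochIdx_le hT.le hpq) rfl
        h8 hlong)

variable (hint : IsInteraction M s₁ μ r st act)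
  (halg : ∀ᵐ ω ∂μ, ∃ tk : ℕ → ℕ, IsDUCRL2Run δ d tie (fun t => st t ω)
      (fun t => act t ω) (observed r st act ω) tk)

include hint halg

lemma measure_regretBound_lt_le :
    μ {ω | ¬ ∀ T : ℕ, 1 < T → regret M r st act T ω ≤ regretBound M d δ T} ≤
      ENNReal.ofReal δ := by
  have hD1 := M.one_le_diameter_toReal hD
  refine le_trans (measure_mono_ae ?_) (hint.measure_exists_not_goodAt_le hr
    (policyPredictable_of_run halg) hδ (D := M.diameter.toReal) (d := d) (by linarith))
  have hall : ∀ᵐ ω ∂μ, ∀ τ, 1 ≤ τ → ∀ s a, norm1 (r τ s a ω) ≤ 1 :=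
    ae_all_iff.2 fun τ => ae_all_iff.2 fun hτ => ae_all_iff.2 fun s => ae_all_iff.2 fun a =>
      hr.norm_le τ hτ s a
  filter_upwards [halg, hall] with ω ⟨tk, hrun⟩ hnorm hω
  by_contra hc
  refine hω fun T hT => hrun.regret_le_regretBound hD hδ htie hr hspill hd (fun t ht => ?_) hnorm hT
  by_contra hg
  exact hc ⟨t, ht, hg⟩

omit hD hδ htie hspill hd halg in
lemma integrable_regret (T : ℕ) : Integrable (regret M r st act T) μ := by
  refine (integrable_const _).sub (integrable_finsetSum _ fun t ht => ?_)
  have ht1 := (mem_Icc.1 ht).1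
  refine Integrable.of_mem_Icc (μ := μ) 0 1 (Measurable.aemeasurable ?_) ?_
  · exact measurable_at_pair (G := fun s a ω => (norm1 (r t s a ω)).toReal) (hint.meas_st t)
      (hint.meas_act t) fun s a => measurable_total.comp (hr.meas t s a)
  · have hall : ∀ᵐ ω ∂μ, ∀ s a, norm1 (r t s a ω) ≤ 1 :=
      ae_all_iff.2 fun s => ae_all_iff.2 fun a => hr.norm_le t ht1 s a
    exact hall.mono fun ω h => ⟨total_nonneg _, total_le_one (h _ _)⟩

lemma integral_regret_le {T : ℕ} (hT : 1 < T) :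
    ∫ ω, regret M r st act T ω ∂μ ≤ regretBound M d δ T + T * δ := by
  -- The exceptional event need not be measurable; a measurable hull serves as well.
  set bad := toMeasurable μ
    {ω | ¬ ∀ T : ℕ, 1 < T → regret M r st act T ω ≤ regretBound M d δ T} with hbad
  have hm : MeasurableSet bad := measurableSet_toMeasurable _ _
  have hμ : μ.real bad ≤ δ := by
    have h1 := measure_regretBound_lt_le hD hδ htie hr hspill hd hint halg
    rw [← measure_toMeasurable] at h1
    exact ENNReal.toReal_le_of_le_ofReal hδ.1.le h1
  have hB := regretBound_nonneg M hd δ T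
  have hle : ∀ ω, regret M r st act T ω ≤
      regretBound M d δ T + bad.indicator (fun _ => (T : ℝ)) ω := by
    intro ω
    by_cases h : ω ∈ bad
    · rw [Set.indicator_of_mem h]
      linarith [regret_le_horizon (M := M) (r := r) (st := st) (act := act) (ω := ω) T]
    · rw [Set.indicator_of_notMem h, add_zero]
      by_contra hc
      exact h (subset_toMeasurable μ _ fun hall => hc (hall T hT))
  have hind : Integrable (bad.indicator fun _ => (T : ℝ)) μ := (integrable_const _).indicator hm
  calc _ ≤ ∫ ω, (regretBound M d δ T + bad.indicator (fun _ => (T : ℝ)) ω) ∂μ :=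
        integral_mono (integrable_regret hr hint T) ((integrable_const _).add hind) hle
    _ = regretBound M d δ T + T * μ.real bad := by
        rw [integral_add (integrable_const _) hind, integral_indicator hm, setIntegral_const]
        simp [mul_comm]
    _ ≤ _ := by gcongr

end Conclusion

end DelayedMDP


theorem theorem1 {S A Ω : Type*} [Fintype S] [DecidableEq S] [Nontrivial S]
    [Fintype A] [DecidableEq A] [Nonempty A] [MeasurableSpace Ω]
    (M : DelayedMDP.MDP S A) (hD : M.diameter < ⊤)
    (δ d : ℝ) (hδ : δ ∈ Set.Ioo (0 : ℝ) 1) (hd : 0 < d)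
    (tie : S → Finset A → A) (htie : ∀ s F, F.Nonempty → tie s F ∈ F) (s₁ : S)
    (μ : Measure Ω) [IsProbabilityMeasure μ]
    (r : ℕ → S → A → Ω → ℕ → ℝ≥0) (st : ℕ → Ω → S) (act : ℕ → Ω → A)
    (hr : DelayedMDP.RewardAssumption M μ r)
    (hspill : DelayedMDP.SpilloverAssumption μ r d)
    (hint : DelayedMDP.IsInteraction M s₁ μ r st act)
    (halg : ∀ᵐ ω ∂μ, ∃ tk : ℕ → ℕ, DelayedMDP.IsDUCRL2Run δ d tie (fun t => st t ω)
      (fun t => act t ω) (DelayedMDP.observed r st act ω) tk) :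
    ENNReal.ofReal (1 - δ) ≤ μ {ω | ∀ T : ℕ, 1 < T →
        DelayedMDP.regret M r st act T ω ≤
          34 * M.diameter.toReal * Fintype.card S * √(Fintype.card A * T * Real.log (T / δ)) +
            2 * d * ((Fintype.card S : ℝ) * Fintype.card A) ^ 3 *
              (Real.logb 2 (8 * T / ((Fintype.card S : ℝ) * Fintype.card A))) ^ 2} ∧
      ∀ T : ℕ, 1 < T → δ = 1 / T →
        Integrable (DelayedMDP.regret M r st act T) μ ∧
          ∫ ω, DelayedMDP.regret M r st act T ω ∂μ ≤
            68 * M.diameter.toReal * Fintype.card S * √(Fintype.card A * T * Real.log T) +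
              2 * d * ((Fintype.card S : ℝ) * Fintype.card A) ^ 3 *
                (Real.logb 2 (8 * T / ((Fintype.card S : ℝ) * Fintype.card A))) ^ 2 := by
  constructor
  · have h1 := DelayedMDP.measure_regretBound_lt_le hD hδ htie hr hspill hd hint halg
    have h2 := measure_union_le (μ := μ)
      {ω | ∀ T : ℕ, 1 < T → DelayedMDP.regret M r st act T ω ≤ DelayedMDP.regretBound M d δ T}
      {ω | ¬ ∀ T : ℕ, 1 < T → DelayedMDP.regret M r st act T ω ≤ DelayedMDP.regretBound M d δ T}
    rw [show {ω | ∀ T : ℕ, 1 < T → DelayedMDP.regret M r st act T ω ≤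
        DelayedMDP.regretBound M d δ T} ∪ {ω | ¬ ∀ T : ℕ, 1 < T →
        DelayedMDP.regret M r st act T ω ≤ DelayedMDP.regretBound M d δ T} = Set.univ from
      Set.union_compl_self _, measure_univ] at h2
    rw [ENNReal.ofReal_sub _ hδ.1.le, ENNReal.ofReal_one, tsub_le_iff_right]
    exact h2.trans (by gcongr; exact le_rfl)
  · intro T hT hδT
    refine ⟨DelayedMDP.integrable_regret hr hint T, ?_⟩
    have h1 := DelayedMDP.integral_regret_le hD hδ htie hr hspill hd hint halg hT
    have ht : (2 : ℝ) ≤ T := by exact_mod_cast hT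
    have hD1 := M.one_le_diameter_toReal hD
    have hp : (2 : ℝ) ≤ Fintype.card S := by exact_mod_cast Fintype.one_lt_card (α := S)
    have hq : (1 : ℝ) ≤ Fintype.card A := by exact_mod_cast Fintype.card_pos (α := A)
    have h2 : (T : ℝ) * δ = 1 := by rw [hδT]; field_simp
    have h3 : Real.log (T / δ) = 2 * Real.log T := by
      rw [hδT, div_div_eq_mul_div, div_one, Real.log_mul (by positivity) (by positivity)]; ring
    have hlog : Real.log 2 ≤ Real.log T := Real.log_le_log two_pos ht
    have hlog2 := Real.log_two_gt_d9
    have h4 : √(Fintype.card A * T * Real.log (T / δ)) =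
        √2 * √(Fintype.card A * T * Real.log T) := by
      rw [h3, ← Real.sqrt_mul (by norm_num)]; congr 1; ring
    have h5 : 1 ≤ √(Fintype.card A * T * Real.log T) := by
      rw [Real.one_le_sqrt]
      have : 2 ≤ (Fintype.card A : ℝ) * T := by nlinarith
      nlinarith
    have h6 : √2 ≤ 3 / 2 := by rw [Real.sqrt_le_left (by norm_num)]; norm_num
    set u := √(Fintype.card A * T * Real.log T)
    set X := M.diameter.toReal * Fintype.card S * u with hX
    have h7 : 1 ≤ X := by
      have : 1 ≤ M.diameter.toReal * Fintype.card S := by nlinarith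
      nlinarith
    have h8 : √2 * X ≤ 3 / 2 * X := by gcongr
    rw [DelayedMDP.regretBound, h4, h2] at h1
    linarith
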